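/- Let $\Delta(\mathcal A)$ be the set of probability distributions on a finite set $\mathcal A\subset\mathbb R^d$ and, for $p\in\Delta(\mathcal A)$, let $\bar a_p=\mathbb E_{a\sim p}[a]$, $H_p=\mathbb E_{a\sim p}[aa^\top]$ and $\Sigma_p=H_p-\bar a_p\bar a_p^\top$. Let $\dim(\mathcal A)$ be the dimension of the affine hull of $\mathcal A$, let $\det$ denote the product of the $\dim(\mathcal A)$ largest eigenvalues, and for $\hat\theta\in\mathbb R^d$, $\gamma>0$ put $$F_{\hat\theta,\gamma}(p)=\langle\bar a_p,\hat\theta\rangle-\gamma^{-1}\log\det(\Sigma_p)\qquad(+\infty\text{ if }\det(\Sigma_p)=0).$$ There are a single program $P$ for a random access machine over the reals (unit-cost comparisons, $+,-,\times,/,\sqrt{\cdot}$ on reals, natural-number operations charged by bit length, read-only access to the input), and constants $C,k$, such that the following holds. (1) For all $d\ge 1$, all finite non-empty sets $\mathcal A$ in the Euclidean unit ball of $\mathbb R^d$, all $\hat\theta\in\mathbb R^d$ and all $\gamma>0$, the program $P$ on input $(\mathcal A,\hat\theta,\gamma)$ outputs, as a sparse list of pairs (index of an action, weight), a distribution $p\in\Delta(\mathcal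 A)$ in time at most $$C\,|\mathcal A|\,d^k\,\bigl((1+\log|\mathcal A|)(1+\log(1+\gamma\|\hat\theta\|))\bigr)^k$$ and with working memory (bits for natural numbers, one unit for each real number) at most $$C\,(1+\log|\mathcal A|)\,d^k\,(1+\log(1+\gamma\|\hat\theta\|)),$$ that is, in time $\tilde O(|\mathcal A|\,\mathrm{poly}(d))$ and memory $\tilde O(\log|\mathcal A|\,\mathrm{poly}(d))$, where $\tilde O$ also hides factors that are polylogarithmic in $\gamma\|\hat\theta\|$. This $p$ is an approximate minimizer of the log-determinant barrier objective, $$F_{\hat\theta,\gamma}(p)\le\min_{q\in\Delta(\mathcal A)}F_{\hat\theta,\gamma}(q)+\frac{\dim(\mathcal A)}{\gamma},$$ and it satisfies, with a loss of at most a factor $2$, the inequality that exact minimizers satisfy, $$\max_{a^*\in\mathcal A}\ \sup_{\theta\in\mathbb R^d}\ \langle\bar a_p-a^*,\theta\rangle-\frac\gamma4\langle\hat\theta-\theta,\Sigma_p(\hat\theta-\theta)\rangle\le\frac{2\dim(\mathcal A)}{\gamma}.$$ (2) Consider a contextual bandit problem with $T\ge1$ rounds, contexts $x_t$ and finite non-empty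 action sets $\mathcal A_t$ in the unit ball of $\mathbb R^d$, $d\ge 1$, fixed in advance, losses $\ell_t\in[-1,1]$ with conditional mean $\mu(a_t,x_t)$ given the past and the action $a_t$, a non-empty class $\mathcal F$ of functions $f$ from contexts to $\mathbb R^d$, and an online regression oracle that from the past and $x_t$ predicts $\hat\theta_t\in\mathbb R^d$ and guarantees, for all sequences of contexts, actions in the unit ball and losses in $[-1,1]$, $$\sum_{t=1}^T(\langle a_t,\hat\theta_t\rangle-\ell_t)^2-\inf_{f\in\mathcal F}\sum_{t=1}^T(\langle a_t,f(x_t)\rangle-\ell_t)^2\le R,\qquad R\ge0.$$ Suppose $$\inf_{f\in\mathcal F}\Bigl(\frac1T\sum_{t=1}^T\sup_{a\in\mathcal A_t}(\langle a,f(x_t)\rangle-\mu(a,x_t))^2\Bigr)^{1/2}\le\varepsilon.$$ If in each round $a_t$ is drawn from the output $p_t$ of $P$ on $(\mathcal A_t,\hat\theta_t,\gamma)$, then for every $\gamma>0$ $$\mathbb E\Bigl[\sum_{t=1}^T\mu(a_t,x_t)-\inf_{a\in\mathcal A_t}\mu(a,x_t)\Bigr]\le C\Bigl(\frac{dT}{\gamma}+\gamma(R+\varepsilon^2T)+\varepsilon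 T\Bigr),$$ and for $\gamma=\sqrt{dT/(R+\varepsilon^2T)}$ (when $R+\varepsilon^2T>0$) the left-hand side is at most $C\bigl(\sqrt{dTR}+\varepsilon\sqrt d\,T\bigr)$, the regret bound of the algorithm that samples from exact minimizers, up to a constant factor. -/

import Mathlib

open MeasureTheory

/-! ## Finite action sets, designs and the log-determinant barrier -/

/-- A finite non-empty set of actions in the Euclidean unit ball of `ℝ^d`, listed without
repetition, so that `card` is its cardinality. -/
structure ActionSet (d : ℕ) where
  card : ℕ
  card_pos : 0 < card
  action : Fin card → EuclideanSpace ℝ (Fin d)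
  injective : Function.Injective action
  norm_le_one : ∀ i, ‖action i‖ ≤ 1

namespace ActionSet

variable {d : ℕ} (A : ActionSet d)

/-- Probability distributions on the action set, as weight vectors indexed by its actions. -/
def Dist : Set (Fin A.card → ℝ) := stdSimplex ℝ (Fin A.card)

/-- The dimension of the smallest affine subspace that contains the action set. -/
noncomputable def dim : ℕ := Module.finrank ℝ (vectorSpan ℝ (Set.range A.action))

/-- The mean action. -/
noncomputable def mean (p : Fin A.card → ℝ) : EuclideanSpace ℝ (Fin d) :=
  ∑ i, p i • A.action i

/-- The second moment matrix of the actions. -/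
noncomputable def secondMoment (p : Fin A.card → ℝ) : Matrix (Fin d) (Fin d) ℝ :=
  ∑ i, p i • Matrix.vecMulVec (A.action i).ofLp (A.action i).ofLp

/-- The second moment matrix minus the outer square of the mean. -/
noncomputable def cov (p : Fin A.card → ℝ) : Matrix (Fin d) (Fin d) ℝ :=
  A.secondMoment p - Matrix.vecMulVec (A.mean p).ofLp (A.mean p).ofLp

theorem cov_isHermitian (p : Fin A.card → ℝ) : (A.cov p).IsHermitian := by
  ext i j
  simp [cov, secondMoment, Matrix.sub_apply, Matrix.sum_apply, Matrix.vecMulVec_apply, mul_comm]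

/-- The product of the `dim A` largest eigenvalues of the matrix `A.cov p`. -/
noncomputable def detCov (p : Fin A.card → ℝ) : ℝ :=
  ∏ i : Fin (Fintype.card (Fin d)),
    if i.val < A.dim then (A.cov_isHermitian p).eigenvalues₀ i else 1

/-- The log-determinant barrier objective; it is `+∞` where the determinant vanishes. -/
noncomputable def barrier (θ : EuclideanSpace ℝ (Fin d)) (γ : ℝ) (p : Fin A.card → ℝ) : EReal :=
  if 0 < A.detCov p then
    ((inner ℝ (A.mean p) θ - γ⁻¹ * Real.log (A.detCov p) : ℝ) : EReal)
  else ⊤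

end ActionSet

/-- The quadratic form `⟨v, M v⟩`, that is, the squared norm of `v` induced by `M`. -/
noncomputable def quadForm {d : ℕ} (M : Matrix (Fin d) (Fin d) ℝ)
    (v : EuclideanSpace ℝ (Fin d)) : ℝ :=
  v.ofLp ⬝ᵥ (M.mulVec v.ofLp)

/-! ## A random access machine over the reals

The machine has natural number cells and real cells, both addressed by natural numbers, and
read-only access to its input.  Arithmetic on reals (with square roots) and comparisons of reals
have unit cost.  Operations on natural numbers are charged by bit length. -/

/-- The input: an action set, a loss parameter and a learning rate. -/
structure BarrierInput (d : ℕ) where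
  A : ActionSet d
  θ : EuclideanSpace ℝ (Fin d)
  γ : ℝ

namespace RAM

/-- Expressions with natural number values. -/
inductive NExp : Type
  | const (k : ℕ)
  | card
  | dim
  | cell (a : NExp)
  | add (e f : NExp)
  | sub (e f : NExp)
  | mul (e f : NExp)

/-- Expressions with real values. -/
inductive RExp : Type
  | ofNat (e : NExp)
  | cell (a : NExp)
  | action (i j : NExp)
  | theta (j : NExp)
  | gamma
  | add (e f : RExp)
  | sub (e f : RExp)
  | mul (e f : RExp)
  | div (e f : RExp)
  | sqrt (e : RExp)

/-- Tests. -/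
inductive Test : Type
  | ltNat (e f : NExp)
  | ltReal (e f : RExp)
  | not (b : Test)
  | and (b c : Test)

/-- Programs. -/
inductive Prog : Type
  | skip
  | setNat (a e : NExp)
  | setReal (a : NExp) (e : RExp)
  | seq (P Q : Prog)
  | ite (b : Test) (P Q : Prog)
  | loop (b : Test) (P : Prog)

/-- The working memory; all but finitely many cells hold `0`. -/
structure State where
  nat : ℕ →₀ ℕ
  real : ℕ →₀ ℝ

/-- The memory that a state takes: the shortest initial segment of natural number cells that
holds all the nonzero ones, each charged one plus the bit length of its content, and the shortest
initial segment of real cells that holds all the nonzero ones, each charged one. -/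
def State.memory (σ : State) : ℕ :=
  (∑ a ∈ Finset.range (σ.nat.support.sup Nat.succ), (1 + (σ.nat a).size))
    + σ.real.support.sup Nat.succ

/-- The initial working memory. -/
noncomputable def State.init : State := ⟨0, 0⟩

variable {d : ℕ} (I : BarrierInput d) (σ : State)

def NExp.val : NExp → ℕ
  | const k => k
  | card => I.A.card
  | dim => d
  | cell a => σ.nat a.val
  | add e f => e.val + f.val
  | sub e f => e.val - f.val
  | mul e f => e.val * f.val

/-- The time to evaluate a natural number expression. -/
def NExp.cost : NExp → ℕ
  | const k => 1 + k.size
  | card => 1 + I.A.card.size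
  | dim => 1 + d.size
  | cell a => a.cost + 1 + (a.val I σ).size + (σ.nat (a.val I σ)).size
  | add e f => e.cost + f.cost + 1 + (e.val I σ).size + (f.val I σ).size
  | sub e f => e.cost + f.cost + 1 + (e.val I σ).size + (f.val I σ).size
  | mul e f => e.cost + f.cost + (1 + (e.val I σ).size) * (1 + (f.val I σ).size)

noncomputable def RExp.val : RExp → ℝ
  | ofNat e => (e.val I σ : ℝ)
  | cell a => σ.real (a.val I σ)
  | action i j =>
      if hi : i.val I σ < I.A.card then
        if hj : j.val I σ < d then I.A.action ⟨i.val I σ, hi⟩ ⟨j.val I σ, hj⟩ else 0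
      else 0
  | theta j => if hj : j.val I σ < d then I.θ ⟨j.val I σ, hj⟩ else 0
  | gamma => I.γ
  | add e f => e.val + f.val
  | sub e f => e.val - f.val
  | mul e f => e.val * f.val
  | div e f => e.val / f.val
  | sqrt e => Real.sqrt e.val

/-- The time to evaluate a real expression. -/
def RExp.cost : RExp → ℕ
  | ofNat e => e.cost I σ + 1 + (e.val I σ).size
  | cell a => a.cost I σ + 1 + (a.val I σ).size
  | action i j =>
      i.cost I σ + j.cost I σ + 1 + (i.val I σ).size + (j.val I σ).size
  | theta j => j.cost I σ + 1 + (j.val I σ).size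
  | gamma => 1
  | add e f => e.cost + f.cost + 1
  | sub e f => e.cost + f.cost + 1
  | mul e f => e.cost + f.cost + 1
  | div e f => e.cost + f.cost + 1
  | sqrt e => e.cost + 1

def Test.holds : Test → Prop
  | ltNat e f => e.val I σ < f.val I σ
  | ltReal e f => e.val I σ < f.val I σ
  | not b => ¬ b.holds
  | and b c => b.holds ∧ c.holds

/-- The time to evaluate a test. -/
def Test.cost : Test → ℕ
  | ltNat e f => e.cost I σ + f.cost I σ + 1 + (e.val I σ).size + (f.val I σ).size
  | ltReal e f => e.cost I σ + f.cost I σ + 1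
  | not b => b.cost + 1
  | and b c => b.cost + c.cost + 1

/-- The state after writing the value of `e` to the natural number cell with address `a`. -/
noncomputable def State.setNat (a e : NExp) : State :=
  { σ with nat := σ.nat.update (a.val I σ) (e.val I σ) }

/-- The state after writing the value of `e` to the real cell with address `a`. -/
noncomputable def State.setReal (a : NExp) (e : RExp) : State :=
  { σ with real := σ.real.update (a.val I σ) (e.val I σ) }

/-- `Exec I P σ σ' t m`: on input `I` and from the state `σ`, the program `P` halts in the
state `σ'` after time `t`, and `m` is the largest memory taken by a state on the way. -/
inductive Exec {d : ℕ} (I : BarrierInput d) : Prog → State → State → ℕ → ℕ → Prop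
  | skip (σ : State) : Exec I .skip σ σ 1 σ.memory
  | setNat (a e : NExp) (σ : State) :
      Exec I (.setNat a e) σ (σ.setNat I a e)
        (a.cost I σ + e.cost I σ + 1 + (a.val I σ).size + (e.val I σ).size)
        (max σ.memory (σ.setNat I a e).memory)
  | setReal (a : NExp) (e : RExp) (σ : State) :
      Exec I (.setReal a e) σ (σ.setReal I a e)
        (a.cost I σ + e.cost I σ + 1 + (a.val I σ).size)
        (max σ.memory (σ.setReal I a e).memory)
  | seq {P Q : Prog} {σ σ' σ'' : State} {t t' m m' : ℕ} :
      Exec I P σ σ' t m → Exec I Q σ' σ'' t' m' →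
      Exec I (.seq P Q) σ σ'' (t + t') (max m m')
  | iteTrue {b : Test} {P Q : Prog} {σ σ' : State} {t m : ℕ} :
      b.holds I σ → Exec I P σ σ' t m → Exec I (.ite b P Q) σ σ' (b.cost I σ + t) m
  | iteFalse {b : Test} {P Q : Prog} {σ σ' : State} {t m : ℕ} :
      ¬ b.holds I σ → Exec I Q σ σ' t m → Exec I (.ite b P Q) σ σ' (b.cost I σ + t) m
  | loopTrue {b : Test} {P : Prog} {σ σ' σ'' : State} {t t' m m' : ℕ} :
      b.holds I σ → Exec I P σ σ' t m → Exec I (.loop b P) σ' σ'' t' m' →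
      Exec I (.loop b P) σ σ'' (b.cost I σ + t + t') (max m m')
  | loopFalse {b : Test} {P : Prog} {σ : State} :
      ¬ b.holds I σ → Exec I (.loop b P) σ σ (b.cost I σ) σ.memory

/-- The weight vector that a state holds as a sparse list of key-value pairs: natural number
cell `0` holds the number of pairs, the natural number cell `k + 1` and the real cell `k` hold
the key (the index of an action) and the value of the pair number `k`. -/
noncomputable def State.weights (σ : State) (n : ℕ) (i : Fin n) : ℝ :=
  ∑ k ∈ Finset.range (σ.nat 0), if σ.nat (k + 1) = i.val then σ.real k else 0

/-- On input `I` the program `P`, started on empty working memory, halts with output `p` after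
time `t` and takes memory `m`. -/
def Prog.Computes (P : Prog) {d : ℕ} (I : BarrierInput d) (p : Fin I.A.card → ℝ)
    (t m : ℕ) : Prop :=
  ∃ σ : State, Exec I P State.init σ t m ∧ p = σ.weights I.A.card

end RAM

/-! ## Contextual bandits with an online regression oracle

Rounds are numbered from `0`; only the first `T` terms of the sequences matter. -/

section Bandit

variable {d : ℕ} {X : Type*}

/-- An online regression oracle: from the past triples (context, action, loss) and the current
context it predicts a parameter vector. -/
abbrev RegressionOracle (d : ℕ) (X : Type*) : Type _ :=
  List (X × EuclideanSpace ℝ (Fin d) × ℝ) → X → EuclideanSpace ℝ (Fin d)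

/-- The prediction of the oracle in round `t` along a sequence. -/
def RegressionOracle.predict (alg : RegressionOracle d X) (x : ℕ → X)
    (a : ℕ → EuclideanSpace ℝ (Fin d)) (l : ℕ → ℝ) (t : ℕ) : EuclideanSpace ℝ (Fin d) :=
  alg ((List.range t).map fun s => (x s, a s, l s)) (x t)

/-- The square loss regret of the oracle against the class `F` after `T` rounds is at most `R`,
for every sequence of contexts, actions in the unit ball and losses in `[-1, 1]`. -/
def RegressionOracle.RegretAtMost (alg : RegressionOracle d X)
    (F : Set (X → EuclideanSpace ℝ (Fin d))) (T : ℕ) (R : ℝ) : Prop :=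
  ∀ (x : ℕ → X) (a : ℕ → EuclideanSpace ℝ (Fin d)) (l : ℕ → ℝ),
    (∀ t < T, ‖a t‖ ≤ 1 ∧ l t ∈ Set.Icc (-1 : ℝ) 1) →
    ∑ t ∈ Finset.range T, (inner ℝ (a t) (alg.predict x a l t) - l t) ^ 2
      - ⨅ f : F, ∑ t ∈ Finset.range T, (inner ℝ (a t) (f.1 (x t)) - l t) ^ 2 ≤ R

/-- The average misspecification level of the class `F` on a sequence of contexts and action
sets, for the mean loss `μ`. -/
noncomputable def misspecification (F : Set (X → EuclideanSpace ℝ (Fin d)))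
    (μ : EuclideanSpace ℝ (Fin d) → X → ℝ) (x : ℕ → X) (A : ℕ → ActionSet d) (T : ℕ) : ℝ :=
  ⨅ f : F, Real.sqrt ((1 / (T : ℝ)) * ∑ t ∈ Finset.range T,
    ⨆ i : Fin (A t).card,
      (inner ℝ ((A t).action i) (f.1 (x t)) - μ ((A t).action i) (x t)) ^ 2)

variable {Ω : Type*} [mΩ : MeasurableSpace Ω]

/-- The random prediction of the oracle in round `t` of a bandit interaction. -/
def banditPrediction (alg : RegressionOracle d X) (x : ℕ → X) (A : ℕ → ActionSet d)
    (act : (t : ℕ) → Ω → Fin (A t).card) (loss : ℕ → Ω → ℝ) (t : ℕ) (ω : Ω) :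
    EuclideanSpace ℝ (Fin d) :=
  alg.predict x (fun s => (A s).action (act s ω)) (fun s => loss s ω) t

/-- The `T`-round interaction in which the learner, in each round `t`, hands the action set `A t`,
the prediction of the oracle and the learning rate `γ` to the program `P`, plays an action drawn
from the distribution that `P` returns, observes a loss in `[-1, 1]` whose conditional mean is
given by `μ`, and updates the oracle.  The σ-algebra `ℱ t` is the information before round `t`;
`act t` is the index of the action played, `dist t` is the distribution it is drawn from. -/
structure IsInteraction (P : RAM.Prog) (γ : ℝ) (T : ℕ) (alg : RegressionOracle d X)
    (μ : EuclideanSpace ℝ (Fin d) → X → ℝ) (x : ℕ → X) (A : ℕ → ActionSet d)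
    (ℙ : Measure Ω) (ℱ : Filtration ℕ mΩ) (act : (t : ℕ) → Ω → Fin (A t).card)
    (dist : (t : ℕ) → Ω → Fin (A t).card → ℝ) (loss : ℕ → Ω → ℝ) : Prop where
  measurable_act : ∀ t < T, Measurable[ℱ (t + 1)] (act t)
  measurable_loss : ∀ t < T, Measurable[ℱ (t + 1)] (loss t)
  measurable_prediction : ∀ t < T, Measurable[ℱ t] (banditPrediction alg x A act loss t)
  loss_mem : ∀ t < T, ∀ ω, loss t ω ∈ Set.Icc (-1 : ℝ) 1
  computed : ∀ t < T, ∀ ω, ∃ time memory : ℕ,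
    P.Computes ⟨A t, banditPrediction alg x A act loss t ω, γ⟩ (dist t ω) time memory
  sampled : ∀ t < T, ∀ i : Fin (A t).card,
    ℙ[(act t ⁻¹' {i}).indicator (fun _ => (1 : ℝ)) | ℱ t] =ᵐ[ℙ] fun ω => dist t ω i
  loss_mean : ∀ t < T,
    ℙ[loss t | ℱ t ⊔ MeasurableSpace.comap (act t) ⊤] =ᵐ[ℙ]
      fun ω => μ ((A t).action (act t ω)) (x t)

/-- The pseudoregret against the best unconstrained policy. -/
noncomputable def pseudoRegret (μ : EuclideanSpace ℝ (Fin d) → X → ℝ) (x : ℕ → X)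
    (A : ℕ → ActionSet d) (T : ℕ) (ℙ : Measure Ω) (act : (t : ℕ) → Ω → Fin (A t).card) : ℝ :=
  ∫ ω, ∑ t ∈ Finset.range T,
    (μ ((A t).action (act t ω)) (x t) - ⨅ i : Fin (A t).card, μ ((A t).action i) (x t)) ∂ℙ

end Bandit

section

open Matrix

theorem Matrix.PosSemidef.log_det_le {m : ℕ} {X : Matrix (Fin m) (Fin m) ℝ} (hX : X.PosSemidef)
    (hdet : 0 < X.det) {t : ℝ} (ht : 0 < t) :
    Real.log X.det ≤ X.trace / t - m + m * Real.log t := by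
  have hd := hX.isHermitian.det_eq_prod_eigenvalues
  have htr := hX.isHermitian.trace_eq_sum_eigenvalues
  simp only [RCLike.ofReal_real_eq_id, id] at hd htr
  have hpos : ∀ i, 0 < hX.isHermitian.eigenvalues i := fun i => by
    refine lt_of_le_of_ne (hX.eigenvalues_nonneg i) fun h => ?_
    rw [hd, Finset.prod_eq_zero (Finset.mem_univ i) h.symm] at hdet
    exact lt_irrefl _ hdet
  rw [hd, Real.log_prod fun i _ => (hpos i).ne', htr, Finset.sum_div]
  have key : ∀ i, Real.log (hX.isHermitian.eigenvalues i) ≤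
      hX.isHermitian.eigenvalues i / t - 1 + Real.log t := fun i => by
    have h := Real.log_le_sub_one_of_pos (div_pos (hpos i) ht)
    rw [Real.log_div (hpos i).ne' ht.ne'] at h
    linarith
  refine (Finset.sum_le_sum fun i _ => key i).trans (le_of_eq ?_)
  simp [Finset.sum_add_distrib, Finset.sum_sub_distrib]

theorem Matrix.PosSemidef.exists_eq_transpose_mul_self {m : ℕ} {X : Matrix (Fin m) (Fin m) ℝ}
    (hX : X.PosSemidef) : ∃ B : Matrix (Fin m) (Fin m) ℝ, X = Bᵀ * B := by
  open scoped MatrixOrder in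
  obtain ⟨B, hB⟩ := CStarAlgebra.nonneg_iff_eq_star_mul_self.mp hX.nonneg
  exact ⟨B, by simpa [star_eq_conjTranspose, conjTranspose_eq_transpose_of_trivial] using hB⟩

theorem Matrix.PosSemidef.log_det_sub_le {m : ℕ} {M N L : Matrix (Fin m) (Fin m) ℝ}
    (hL : L.PosSemidef) (hML : M * L = 1) (hN : N.PosSemidef)
    (hdM : 0 < M.det) (hdN : 0 < N.det) {t : ℝ} (ht : 0 < t) :
    Real.log N.det - Real.log M.det ≤ (L * N).trace / t - m + m * Real.log t := by
  obtain ⟨B, rfl⟩ := hL.exists_eq_transpose_mul_self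
  have hX : (B * N * Bᵀ).PosSemidef := by
    simpa [conjTranspose_eq_transpose_of_trivial] using hN.mul_mul_conjTranspose_same B
  have hdet : M.det * (B.det * B.det) = 1 := by
    have := congrArg Matrix.det hML
    simpa [det_mul, det_transpose] using this
  have hBB : 0 < B.det * B.det := by
    by_contra h
    nlinarith [mul_nonneg hdM.le (not_lt.mp h |> neg_nonneg.mpr)]
  have hXd : (B * N * Bᵀ).det = N.det * (B.det * B.det) := by
    simp only [det_mul, det_transpose]; ring
  have h := hX.log_det_le (by rw [hXd]; positivity) ht
  rw [hXd, Real.log_mul hdN.ne' hBB.ne'] at h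
  have hlog : Real.log M.det + Real.log (B.det * B.det) = 0 := by
    rw [← Real.log_mul hdM.ne' hBB.ne', hdet, Real.log_one]
  have htr : (B * N * Bᵀ).trace = (Bᵀ * B * N).trace := by
    rw [trace_mul_comm, ← Matrix.mul_assoc]
  rw [htr] at h
  linarith

/-- The rank-one update formula for the determinant. -/
theorem Matrix.det_add_smul_vecMulVec {m : ℕ} {M L : Matrix (Fin m) (Fin m) ℝ}
    (hML : M * L = 1) (s : ℝ) (v : Fin m → ℝ) :
    (M + s • vecMulVec v v).det = M.det * (1 + s * (v ⬝ᵥ L *ᵥ v)) := by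
  have hL : M⁻¹ = L := inv_eq_right_inv hML
  have hu : IsUnit M.det := M.isUnit_iff_isUnit_det.mp (IsUnit.of_mul_eq_one L hML)
  have h := det_add_mul (replicateCol Unit (s • v)) (replicateRow Unit v) hu
  rw [← vecMulVec_eq, smul_vecMulVec, hL] at h
  rw [h]
  congr 1
  rw [det_unique, add_apply, one_apply_eq, Matrix.mul_assoc, ← replicateCol_mulVec,
    replicateRow_mul_replicateCol_apply, mulVec_smul, dotProduct_smul, smul_eq_mul]

/-- The product of the largest eigenvalues of a matrix that lives on the range of an isometry. -/
theorem Matrix.IsHermitian.prod_largest_eigenvalues {d m : ℕ} {S : Matrix (Fin d) (Fin d) ℝ}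
    (hS : S.IsHermitian) (hpos : S.PosSemidef) {U : Matrix (Fin d) (Fin m) ℝ} (hU : Uᵀ * U = 1)
    (hUS : U * Uᵀ * S = S) :
    (∏ i : Fin (Fintype.card (Fin d)), if i.val < m then hS.eigenvalues₀ i else 1)
      = (Uᵀ * S * U).det := by
  set e := Fintype.equivOfCardEq (Fintype.card_fin (Fintype.card (Fin d))) with he
  have hev : ∀ i, hS.eigenvalues (e i) = hS.eigenvalues₀ i := fun i => by
    simp [Matrix.IsHermitian.eigenvalues, he]
  have hnn : ∀ i, 0 ≤ hS.eigenvalues₀ i := fun i => by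
    rw [← hev]; exact hpos.eigenvalues_nonneg _
  have hrankU : U.rank ≤ m := by simpa using U.rank_le_card_width
  have hmd : m ≤ d := by
    have h1 : (1 : Matrix (Fin m) (Fin m) ℝ).rank ≤ U.rank := by
      rw [← hU]; exact rank_mul_le_right _ _
    have h2 : U.rank ≤ d := by simpa using U.rank_le_card_height
    simpa using h1.trans h2
  have hrank : S.rank ≤ m := by
    rw [← hUS, Matrix.mul_assoc]
    exact (rank_mul_le_left _ _).trans hrankU
  have hzero : ∀ i : Fin (Fintype.card (Fin d)), m ≤ i.val → hS.eigenvalues₀ i = 0 := by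
    intro i hi
    by_contra hne
    have hipos := lt_of_le_of_ne (hnn i) (Ne.symm hne)
    rw [hS.rank_eq_card_non_zero_eigs] at hrank
    have hinj : Fintype.card (Fin (m + 1)) ≤ Fintype.card {j // hS.eigenvalues j ≠ 0} := by
      refine Fintype.card_le_of_injective
        (fun k : Fin (m + 1) => ⟨e ⟨k.val, by omega⟩, ?_⟩) ?_
      · rw [hev]
        refine (lt_of_lt_of_le hipos (hS.eigenvalues₀_antitone ?_)).ne'
        rw [Fin.le_def]
        simp only
        omega
      · intro a b hab
        simp only [Subtype.mk.injEq, EmbeddingLike.apply_eq_iff_eq, Fin.mk.injEq] at hab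
        exact Fin.ext hab
    rw [Fintype.card_fin] at hinj
    omega
  have hcount : ∀ x : ℝ, ∏ i : Fin (Fintype.card (Fin d)), (x + hS.eigenvalues₀ i)
      = x ^ (d - m) * ∏ i : Fin (Fintype.card (Fin d)),
          (if i.val < m then x + hS.eigenvalues₀ i else 1) := by
    intro x
    have hsplit : ∀ i : Fin (Fintype.card (Fin d)), x + hS.eigenvalues₀ i
        = (if i.val < m then 1 else x) * (if i.val < m then x + hS.eigenvalues₀ i else 1) := by
      intro i
      split_ifs with h
      · ring
      · rw [hzero i (not_lt.mp h)]; ring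
    rw [Finset.prod_congr rfl fun i _ => hsplit i, Finset.prod_mul_distrib]
    congr 1
    rw [Finset.prod_ite]
    simp only [Finset.prod_const_one, one_mul, Finset.prod_const]
    congr 1
    have h1 := Finset.card_filter_add_card_filter_not (s := (Finset.univ : Finset (Fin (Fintype.card (Fin d)))))
      (fun i => i.val < m)
    have h2 : (Finset.univ.filter fun i : Fin (Fintype.card (Fin d)) => i.val < m).card = m := by
      rw [Fin.card_filter_val_lt]
      simp [hmd]
    simp only [Finset.card_univ, Fintype.card_fin] at h1 
    omega
  have hdet : ∀ x : ℝ, x ≠ 0 → (x • (1 : Matrix (Fin d) (Fin d) ℝ) + S).det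
      = x ^ (d - m) * (x • (1 : Matrix (Fin m) (Fin m) ℝ) + Uᵀ * S * U).det := by
    intro x hx
    have h1 : x • (1 : Matrix (Fin d) (Fin d) ℝ) + S
        = x • (1 + (x⁻¹ • U) * (Uᵀ * S)) := by
      rw [smul_add, Matrix.smul_mul, smul_smul, mul_inv_cancel₀ hx, one_smul, ← Matrix.mul_assoc,
        hUS]
    have h2 : x • (1 : Matrix (Fin m) (Fin m) ℝ) + Uᵀ * S * U
        = x • (1 + (Uᵀ * S) * (x⁻¹ • U)) := by
      rw [smul_add, Matrix.mul_smul, smul_smul, mul_inv_cancel₀ hx, one_smul]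
    rw [h1, h2, det_smul, det_smul, det_one_add_mul_comm, ← mul_assoc, ← pow_add]
    simp [Nat.sub_add_cancel hmd]
  have hdet' : ∀ x : ℝ, (x • (1 : Matrix (Fin d) (Fin d) ℝ) + S).det
      = ∏ i : Fin (Fintype.card (Fin d)), (x + hS.eigenvalues₀ i) := by
    intro x
    have h1 := congrArg (Polynomial.eval (-x)) hS.charpoly_eq
    rw [eval_charpoly, Polynomial.eval_prod] at h1
    have h2 : (x • (1 : Matrix (Fin d) (Fin d) ℝ) + S) = -(scalar (Fin d) (-x) - S) := by
      ext i j
      simp only [add_apply, smul_apply, one_apply, neg_apply, sub_apply, scalar_apply, diagonal_apply,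
        smul_eq_mul]
      split_ifs <;> ring
    rw [h2, det_neg, h1, ← Equiv.prod_comp e]
    simp only [Polynomial.eval_sub, Polynomial.eval_X, Polynomial.eval_C, hev]
    have : (-1 : ℝ) ^ Fintype.card (Fin d) = ∏ i : Fin (Fintype.card (Fin d)), (-1 : ℝ) := by simp
    rw [this, ← Finset.prod_mul_distrib]
    refine Finset.prod_congr rfl fun i _ => ?_
    simp; ring
  have hlim : ∀ᶠ x in nhdsWithin (0 : ℝ) {0}ᶜ,
      (∏ i : Fin (Fintype.card (Fin d)), (if i.val < m then x + hS.eigenvalues₀ i else 1))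
        = (x • (1 : Matrix (Fin m) (Fin m) ℝ) + Uᵀ * S * U).det := by
    filter_upwards [self_mem_nhdsWithin] with x hx
    have h := (hdet x hx).symm.trans ((hdet' x).trans (hcount x))
    exact (mul_left_cancel₀ (pow_ne_zero _ hx) h).symm
  have hc1 : Continuous fun x : ℝ => ∏ i : Fin (Fintype.card (Fin d)),
      (if i.val < m then x + hS.eigenvalues₀ i else 1) := by
    refine continuous_finsetProd _ fun i _ => ?_
    split_ifs <;> fun_prop
  have hc2 : Continuous fun x : ℝ =>
      (x • (1 : Matrix (Fin m) (Fin m) ℝ) + Uᵀ * S * U).det := by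
    refine Continuous.matrix_det ?_
    fun_prop
  have h1 := (hc1.tendsto 0).mono_left (nhdsWithin_le_nhds (s := {0}ᶜ))
  have h2 := (hc2.tendsto 0).mono_left (nhdsWithin_le_nhds (s := {0}ᶜ))
  have := tendsto_nhds_unique (h1.congr' hlim) h2
  simpa using this

end

namespace ActionSet

open Matrix
variable {d : ℕ} (A : ActionSet d)

/-- The deviation of an action from the mean action. -/
noncomputable def dev (p : Fin A.card → ℝ) (i : Fin A.card) : Fin d → ℝ :=
  (A.action i).ofLp - (A.mean p).ofLp

theorem mean_ofLp (p : Fin A.card → ℝ) : (A.mean p).ofLp = ∑ i, p i • (A.action i).ofLp := by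
  simp [mean, WithLp.ofLp_sum]

theorem cov_eq_sum {p : Fin A.card → ℝ} (hp : ∑ i, p i = 1) (c : Fin d → ℝ) :
    A.cov p = (∑ i, p i • vecMulVec ((A.action i).ofLp - c) ((A.action i).ofLp - c))
      - vecMulVec ((A.mean p).ofLp - c) ((A.mean p).ofLp - c) := by
  have hm := A.mean_ofLp p
  ext x y
  have hx : (A.mean p).ofLp x = ∑ i, p i * (A.action i).ofLp x := by
    rw [hm]; simp [Finset.sum_apply]
  have hy : (A.mean p).ofLp y = ∑ i, p i * (A.action i).ofLp y := by
    rw [hm]; simp [Finset.sum_apply]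
  have hs : ∑ i, p i * (((A.action i).ofLp x - c x) * ((A.action i).ofLp y - c y))
      = ∑ i, p i * ((A.action i).ofLp x * (A.action i).ofLp y) - (A.mean p).ofLp x * c y
        - c x * (A.mean p).ofLp y + c x * c y := by
    rw [hx, hy]
    calc _ = ∑ i, (p i * ((A.action i).ofLp x * (A.action i).ofLp y)
          - p i * (A.action i).ofLp x * c y - c x * (p i * (A.action i).ofLp y)
          + p i * (c x * c y)) := Finset.sum_congr rfl fun i _ => by ring
      _ = _ := by
        simp only [Finset.sum_add_distrib, Finset.sum_sub_distrib, ← Finset.sum_mul,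
          ← Finset.mul_sum, hp, one_mul]
  simp only [cov, secondMoment, Matrix.sub_apply, Matrix.sum_apply, Matrix.smul_apply,
    vecMulVec_apply, Pi.sub_apply, smul_eq_mul, hs]
  ring

theorem cov_eq_sum_dev {p : Fin A.card → ℝ} (hp : ∑ i, p i = 1) :
    A.cov p = ∑ i, p i • vecMulVec (A.dev p i) (A.dev p i) := by
  rw [A.cov_eq_sum hp (A.mean p).ofLp]
  simp [dev]

theorem cov_posSemidef {p : Fin A.card → ℝ} (hp : p ∈ A.Dist) : (A.cov p).PosSemidef := by
  rw [A.cov_eq_sum_dev hp.2]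
  refine posSemidef_sum _ fun i _ => PosSemidef.smul ?_ (hp.1 i)
  simpa using posSemidef_vecMulVec_self_star (A.dev p i)

theorem trace_mul_cov (K : Matrix (Fin d) (Fin d) ℝ) {q : Fin A.card → ℝ} (hq : ∑ i, q i = 1)
    (c : Fin d → ℝ) :
    (K * A.cov q).trace = (∑ i, q i * (((A.action i).ofLp - c) ⬝ᵥ K *ᵥ ((A.action i).ofLp - c)))
      - ((A.mean q).ofLp - c) ⬝ᵥ K *ᵥ ((A.mean q).ofLp - c) := by
  rw [A.cov_eq_sum hq c, Matrix.mul_sub, trace_sub, Matrix.mul_sum, trace_sum]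
  simp only [Matrix.mul_smul, trace_smul, mul_vecMulVec, trace_vecMulVec, smul_eq_mul,
    dotProduct_comm]

/-- Coordinates on the direction of the affine hull of the action set. -/
theorem exists_frame : ∃ U : Matrix (Fin d) (Fin A.dim) ℝ, Uᵀ * U = 1 ∧
    (∀ i j, (U * Uᵀ) *ᵥ ((A.action i).ofLp - (A.action j).ofLp)
      = (A.action i).ofLp - (A.action j).ofLp) ∧
    ∀ N : Matrix (Fin d) (Fin d) ℝ,
      (∀ i j, N *ᵥ ((A.action i).ofLp - (A.action j).ofLp) = 0) → N * U = 0 := by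
  set V := vectorSpan ℝ (Set.range A.action) with hV
  let b : OrthonormalBasis (Fin A.dim) ℝ V := stdOrthonormalBasis ℝ V
  let U : Matrix (Fin d) (Fin A.dim) ℝ := Matrix.of fun x k => (b k : EuclideanSpace ℝ (Fin d)) x
  have hUmul : ∀ (y : Fin A.dim → ℝ), U *ᵥ y = (∑ k, y k • (b k : EuclideanSpace ℝ (Fin d))).ofLp := by
    intro y
    ext x
    simp [U, mulVec, dotProduct, mul_comm]
  have hUT : ∀ (v : EuclideanSpace ℝ (Fin d)) k, (Uᵀ *ᵥ v.ofLp) k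
      = inner ℝ (b k : EuclideanSpace ℝ (Fin d)) v := by
    intro v k
    simp [U, mulVec, dotProduct, PiLp.inner_apply, mul_comm]
  have hmem : ∀ i j, A.action i - A.action j ∈ V := fun i j =>
    vsub_mem_vectorSpan ℝ (Set.mem_range_self i) (Set.mem_range_self j)
  refine ⟨U, ?_, ?_, ?_⟩
  · ext k l
    have h := orthonormal_iff_ite.mp b.orthonormal k l
    rw [Submodule.coe_inner] at h
    rw [Matrix.one_apply, ← h]
    simp [U, mul_apply, PiLp.inner_apply, mul_comm]
  · intro i j
    have h := b.sum_repr ⟨A.action i - A.action j, hmem i j⟩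
    have h' := congrArg (fun v : V => (v : EuclideanSpace ℝ (Fin d)).ofLp) h
    simp only at h'
    rw [WithLp.ofLp_sub] at h'
    rw [← mulVec_mulVec, hUmul]
    conv_rhs => rw [← h']
    congr 1
    rw [Submodule.coe_sum]
    refine Finset.sum_congr rfl fun k _ => ?_
    rw [← WithLp.ofLp_sub, hUT, Submodule.coe_smul, b.repr_apply_apply]
    rfl
  · intro N hN
    have hker : ∀ v ∈ V, N *ᵥ v.ofLp = 0 := by
      intro v hv
      have hle : V ≤ LinearMap.ker ((Matrix.mulVecLin N).comp
          (WithLp.linearEquiv 2 ℝ (Fin d → ℝ)).toLinearMap) := by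
        rw [hV, vectorSpan_def, Submodule.span_le]
        rintro _ ⟨_, ⟨i, rfl⟩, _, ⟨j, rfl⟩, rfl⟩
        simpa [Matrix.mulVec_sub] using hN i j
      simpa using hle hv
    ext x k
    have := congrFun (hker (b k) (b k).2) x
    simpa [U, mul_apply, mulVec, dotProduct] using this

theorem frame_mulVec_dev {m : ℕ} {U : Matrix (Fin d) (Fin m) ℝ}
    (hU : ∀ i j, (U * Uᵀ) *ᵥ ((A.action i).ofLp - (A.action j).ofLp)
      = (A.action i).ofLp - (A.action j).ofLp) {p : Fin A.card → ℝ} (hp : ∑ i, p i = 1)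
    (i : Fin A.card) : (U * Uᵀ) *ᵥ A.dev p i = A.dev p i := by
  have h : A.dev p i = ∑ j, p j • ((A.action i).ofLp - (A.action j).ofLp) := by
    simp only [smul_sub, Finset.sum_sub_distrib, ← Finset.sum_smul, hp, one_smul, dev, mean_ofLp]
  rw [h, mulVec_sum]
  exact Finset.sum_congr rfl fun j _ => by rw [mulVec_smul, hU]

theorem frame_mul_cov {m : ℕ} {U : Matrix (Fin d) (Fin m) ℝ}
    (hU : ∀ i j, (U * Uᵀ) *ᵥ ((A.action i).ofLp - (A.action j).ofLp)
      = (A.action i).ofLp - (A.action j).ofLp) {p : Fin A.card → ℝ} (hp : ∑ i, p i = 1) :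
    U * Uᵀ * A.cov p = A.cov p := by
  rw [A.cov_eq_sum_dev hp, Matrix.mul_sum]
  exact Finset.sum_congr rfl fun i _ => by
    rw [Matrix.mul_smul, mul_vecMulVec, A.frame_mulVec_dev hU hp]

theorem detCov_eq {U : Matrix (Fin d) (Fin A.dim) ℝ} (hU1 : Uᵀ * U = 1)
    (hU : ∀ i j, (U * Uᵀ) *ᵥ ((A.action i).ofLp - (A.action j).ofLp)
      = (A.action i).ofLp - (A.action j).ofLp) {p : Fin A.card → ℝ} (hp : p ∈ A.Dist) :
    A.detCov p = (Uᵀ * A.cov p * U).det :=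
  (A.cov_isHermitian p).prod_largest_eigenvalues (A.cov_posSemidef hp) hU1
    (A.frame_mul_cov hU hp.2)

/-- Moving the mass `s` to the action `i`. -/
noncomputable def mix (p : Fin A.card → ℝ) (s : ℝ) (i : Fin A.card) : Fin A.card → ℝ :=
  fun j => (1 - s) * p j + if j = i then s else 0

theorem mix_mem {p : Fin A.card → ℝ} (hp : p ∈ A.Dist) {s : ℝ} (hs : 0 ≤ s) (hs1 : s ≤ 1)
    (i : Fin A.card) : A.mix p s i ∈ A.Dist := by
  refine ⟨fun j => ?_, ?_⟩
  · have := hp.1 j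
    have h1 : 0 ≤ 1 - s := by linarith
    unfold mix
    split_ifs <;> positivity
  · simp [mix, Finset.sum_add_distrib, ← Finset.mul_sum, hp.2]

theorem mean_mix (p : Fin A.card → ℝ) (s : ℝ) (i : Fin A.card) :
    (A.mean (A.mix p s i)).ofLp = (A.mean p).ofLp + s • A.dev p i := by
  simp only [mean_ofLp, mix, add_smul, Finset.sum_add_distrib, dev, ite_smul, zero_smul,
    Finset.sum_ite_eq', Finset.mem_univ, if_true, mul_smul, ← Finset.smul_sum]
  module

theorem dev_mix (p : Fin A.card → ℝ) (s : ℝ) (i j : Fin A.card) :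
    A.dev (A.mix p s i) j = A.dev p j - s • A.dev p i := by
  rw [dev, mean_mix, ← sub_sub, ← dev]

theorem cov_mix (p : Fin A.card → ℝ) (s : ℝ) (i : Fin A.card) :
    A.cov (A.mix p s i) = (1 - s) • (A.cov p + s • vecMulVec (A.dev p i) (A.dev p i)) := by
  have h2 : A.secondMoment (A.mix p s i) = (1 - s) • A.secondMoment p
      + s • vecMulVec (A.action i).ofLp (A.action i).ofLp := by
    simp only [secondMoment, mix, add_smul, Finset.sum_add_distrib, ite_smul, zero_smul,
      Finset.sum_ite_eq', Finset.mem_univ, if_true, mul_smul, ← Finset.smul_sum]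
  have ha : (A.action i).ofLp = (A.mean p).ofLp + A.dev p i := by simp [dev]
  rw [cov, h2, mean_mix, cov, ha]
  ext x y
  simp [vecMulVec_apply]
  ring

end ActionSet

namespace ActionSet

open Matrix
variable {d : ℕ} (A : ActionSet d)

/-- `K` is the pseudo-inverse of the covariance matrix of `p`, whose rank is `r`, and `Q` is the
orthogonal projection onto its kernel. -/
structure Design (p : Fin A.card → ℝ) (K Q : Matrix (Fin d) (Fin d) ℝ) (r : ℕ) : Prop where
  mem : p ∈ A.Dist
  K_symm : Kᵀ = K
  Q_symm : Qᵀ = Q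
  Q_idem : Q * Q = Q
  K_mul_Q : K * Q = 0
  cov_mul_Q : A.cov p * Q = 0
  cov_mul_K : A.cov p * K = 1 - Q
  trace_Q : Q.trace = d - r

variable {A}

theorem dotProduct_mulVec_of_symm {M : Matrix (Fin d) (Fin d) ℝ} (hM : Mᵀ = M)
    (u v : Fin d → ℝ) : u ⬝ᵥ M *ᵥ v = M *ᵥ u ⬝ᵥ v := by
  rw [dotProduct_mulVec, ← mulVec_transpose, hM]

theorem mean_single (i : Fin A.card) : A.mean (Pi.single i 1) = A.action i := by
  simp [mean, Pi.single_apply, ite_smul]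

theorem Design.single (i : Fin A.card) : A.Design (Pi.single i 1) 0 1 0 where
  mem := single_mem_stdSimplex ℝ i
  K_symm := transpose_zero
  Q_symm := transpose_one
  Q_idem := mul_one _
  K_mul_Q := zero_mul _
  cov_mul_Q := by
    rw [cov, mean_single]
    simp [secondMoment, Pi.single_apply, ite_smul]
  cov_mul_K := by simp
  trace_Q := by simp

namespace Design

variable {p : Fin A.card → ℝ} {K Q : Matrix (Fin d) (Fin d) ℝ} {r : ℕ}

theorem K_eq (h : A.Design p K Q r) : K = K * A.cov p * K := by
  rw [Matrix.mul_assoc, h.cov_mul_K, Matrix.mul_sub, h.K_mul_Q, sub_zero, Matrix.mul_one]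

theorem Q_mul_K (h : A.Design p K Q r) : Q * K = 0 := by
  have := congrArg transpose h.K_mul_Q
  rwa [transpose_mul, h.K_symm, h.Q_symm, transpose_zero] at this

theorem K_posSemidef (h : A.Design p K Q r) : K.PosSemidef := by
  rw [h.K_eq]
  have := (A.cov_posSemidef h.mem).conjTranspose_mul_mul_same K
  rwa [conjTranspose_eq_transpose_of_trivial, h.K_symm] at this

theorem Q_posSemidef (h : A.Design p K Q r) : Q.PosSemidef := by
  have := posSemidef_conjTranspose_mul_self Q
  rwa [conjTranspose_eq_transpose_of_trivial, h.Q_symm, h.Q_idem] at this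

theorem K_nonneg (h : A.Design p K Q r) (u : Fin d → ℝ) : 0 ≤ u ⬝ᵥ K *ᵥ u := by
  simpa using h.K_posSemidef.dotProduct_mulVec_nonneg u

theorem Q_nonneg (h : A.Design p K Q r) (u : Fin d → ℝ) : 0 ≤ u ⬝ᵥ Q *ᵥ u := by
  simpa using h.Q_posSemidef.dotProduct_mulVec_nonneg u

theorem Q_form (h : A.Design p K Q r) (u : Fin d → ℝ) :
    u ⬝ᵥ Q *ᵥ u = Q *ᵥ u ⬝ᵥ Q *ᵥ u := by
  conv_lhs => rw [← h.Q_idem, ← mulVec_mulVec, dotProduct_mulVec_of_symm h.Q_symm]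

theorem Q_mulVec_eq_zero (h : A.Design p K Q r) {u : Fin d → ℝ} (hu : u ⬝ᵥ Q *ᵥ u ≤ 0) :
    Q *ᵥ u = 0 := by
  rw [h.Q_form] at hu
  exact dotProduct_self_eq_zero.mp (le_antisymm hu (by simpa using dotProduct_star_self_nonneg (Q *ᵥ u)))

/-- The pseudo-inverse after a step towards an action outside the affine hull of the support. -/
noncomputable def extendK (K : Matrix (Fin d) (Fin d) ℝ) (k z : Fin d → ℝ) (s w ζ : ℝ) :
    Matrix (Fin d) (Fin d) ℝ :=
  (1 - s)⁻¹ • (K - ζ⁻¹ • (vecMulVec k z + vecMulVec z k)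
    + ((s⁻¹ + w) * (ζ⁻¹ * ζ⁻¹)) • vecMulVec z z)

theorem extend (h : A.Design p K Q r) (i : Fin A.card) {s : ℝ} (hs : 0 < s) (hs1 : s < 1)
    {k z : Fin d → ℝ} {w ζ : ℝ} (hk : k = K *ᵥ A.dev p i) (hz : z = Q *ᵥ A.dev p i)
    (hw : w = A.dev p i ⬝ᵥ k) (hζ : ζ = A.dev p i ⬝ᵥ z) (hpos : 0 < ζ) :
    A.Design (A.mix p s i) (extendK K k z s w ζ) (Q - ζ⁻¹ • vecMulVec z z) (r + 1) := by
  set v := A.dev p i with hv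
  have h1s : (1 - s) ≠ 0 := by linarith
  have hQz : Q *ᵥ z = z := by rw [hz, mulVec_mulVec, h.Q_idem]
  have hzQ : z ᵥ* Q = z := by rw [← mulVec_transpose, h.Q_symm, hQz]
  have hKz : K *ᵥ z = 0 := by rw [hz, mulVec_mulVec, h.K_mul_Q, zero_mulVec]
  have hQk : Q *ᵥ k = 0 := by rw [hk, mulVec_mulVec, h.Q_mul_K, zero_mulVec]
  have hkQ : k ᵥ* Q = 0 := by rw [← mulVec_transpose, h.Q_symm, hQk]
  have hSz : A.cov p *ᵥ z = 0 := by rw [hz, mulVec_mulVec, h.cov_mul_Q, zero_mulVec]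
  have hSk : A.cov p *ᵥ k = v - z := by
    rw [hk, mulVec_mulVec, h.cov_mul_K, sub_mulVec, one_mulVec, ← hz]
  have hvK : v ᵥ* K = k := by rw [← mulVec_transpose, h.K_symm, ← hk]
  have hvQ : v ᵥ* Q = z := by rw [← mulVec_transpose, h.Q_symm, ← hz]
  have hzz : z ⬝ᵥ z = ζ := by rw [hζ, hz, ← h.Q_form]
  have hkz : k ⬝ᵥ z = 0 := by
    rw [hz, dotProduct_mulVec_of_symm h.Q_symm, hQk, zero_dotProduct]
  have hzk : z ⬝ᵥ k = 0 := by rw [dotProduct_comm, hkz]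
  have hζ0 := hpos.ne'
  have hs0 := hs.ne'
  have m1 : ∀ x y x' y' : Fin d → ℝ,
      vecMulVec x y * vecMulVec x' y' = (y ⬝ᵥ x') • vecMulVec x y' := fun x y x' y' => by
    rw [vecMulVec_mul_vecMulVec, vecMulVec_smul]
  have m2 : ∀ y : Fin d → ℝ, Q * vecMulVec z y = vecMulVec z y := fun y => by rw [mul_vecMulVec, hQz]
  have m3 : ∀ x : Fin d → ℝ, vecMulVec x z * Q = vecMulVec x z := fun x => by rw [vecMulVec_mul, hzQ]
  have m4 : ∀ x : Fin d → ℝ, vecMulVec x k * Q = 0 := fun x => by rw [vecMulVec_mul, hkQ, vecMulVec_zero]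
  have m5 : ∀ y : Fin d → ℝ, K * vecMulVec z y = 0 := fun y => by rw [mul_vecMulVec, hKz, zero_vecMulVec]
  have m6 : ∀ y : Fin d → ℝ, A.cov p * vecMulVec z y = 0 := fun y => by
    rw [mul_vecMulVec, hSz, zero_vecMulVec]
  have m7 : ∀ y : Fin d → ℝ, A.cov p * vecMulVec k y = vecMulVec v y - vecMulVec z y := fun y => by
    rw [mul_vecMulVec, hSk, sub_vecMulVec]
  have m8 : ∀ x : Fin d → ℝ, vecMulVec x v * K = vecMulVec x k := fun x => by rw [vecMulVec_mul, hvK]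
  have m9 : ∀ x : Fin d → ℝ, vecMulVec x v * Q = vecMulVec x z := fun x => by rw [vecMulVec_mul, hvQ]
  refine ⟨A.mix_mem h.mem hs.le hs1.le i, ?_, ?_, ?_, ?_, ?_, ?_, ?_⟩
  · simp only [extendK, transpose_smul, transpose_add, transpose_sub, transpose_vecMulVec, h.K_symm]
    rw [add_comm (vecMulVec z k)]
  · simp only [transpose_smul, transpose_sub, transpose_vecMulVec, h.Q_symm]
  · simp only [Matrix.sub_mul, Matrix.mul_sub, Matrix.smul_mul, Matrix.mul_smul, h.Q_idem,
      m1, m2, m3, hzz, smul_smul]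
    rw [inv_mul_cancel₀ hζ0, one_smul]
    simp
  · simp only [extendK, Matrix.sub_mul, Matrix.add_mul, Matrix.mul_sub, Matrix.smul_mul,
      Matrix.mul_smul, m1, m3, m4, m5, hkz, hzz, h.K_mul_Q]
    ext x y
    simp [vecMulVec_apply]
    field_simp
    ring
  · rw [cov_mix, ← hv]
    simp only [Matrix.add_mul, Matrix.mul_sub, Matrix.smul_mul,
      Matrix.mul_smul, m1, m6, m9, ← hζ, h.cov_mul_Q]
    ext x y
    simp [vecMulVec_apply]
    field_simp
    ring
  · rw [cov_mix, ← hv, extendK, Matrix.smul_mul, Matrix.mul_smul, smul_smul, mul_inv_cancel₀ h1s,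
      one_smul]
    simp only [Matrix.add_mul, Matrix.mul_sub, Matrix.mul_add, Matrix.smul_mul,
      Matrix.mul_smul, m1, m6, m7, m8, ← hζ, ← hw, h.cov_mul_K]
    ext x y
    simp [vecMulVec_apply]
    field_simp
    ring
  · rw [trace_sub, trace_smul, trace_vecMulVec, hzz, h.trace_Q, smul_eq_mul, inv_mul_cancel₀ hζ0]
    push_cast; ring

/-- The pseudo-inverse after a step towards an action in the affine hull of the support. -/
noncomputable def stepK (K : Matrix (Fin d) (Fin d) ℝ) (k : Fin d → ℝ) (s w : ℝ) :
    Matrix (Fin d) (Fin d) ℝ :=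
  (1 - s)⁻¹ • (K - (s / (1 + s * w)) • vecMulVec k k)

theorem step (h : A.Design p K Q r) (i : Fin A.card) {s : ℝ} (hs : 0 < s) (hs1 : s < 1)
    {k : Fin d → ℝ} {w : ℝ} (hk : k = K *ᵥ A.dev p i) (hQ : Q *ᵥ A.dev p i = 0)
    (hw : w = A.dev p i ⬝ᵥ k) :
    A.Design (A.mix p s i) (stepK K k s w) Q r := by
  have hw0 : 0 ≤ w := by rw [hw, hk]; exact h.K_nonneg _
  set v := A.dev p i with hv
  have h1s : (1 - s) ≠ 0 := by linarith
  have hQk : Q *ᵥ k = 0 := by rw [hk, mulVec_mulVec, h.Q_mul_K, zero_mulVec]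
  have hSk : A.cov p *ᵥ k = v := by
    rw [hk, mulVec_mulVec, h.cov_mul_K, sub_mulVec, one_mulVec, hQ, sub_zero]
  have m1 : ∀ x y x' y' : Fin d → ℝ,
      vecMulVec x y * vecMulVec x' y' = (y ⬝ᵥ x') • vecMulVec x y' := fun x y x' y' => by
    rw [vecMulVec_mul_vecMulVec, vecMulVec_smul]
  have m4 : ∀ x : Fin d → ℝ, vecMulVec x k * Q = 0 := fun x => by
    rw [vecMulVec_mul, ← mulVec_transpose, h.Q_symm, hQk, vecMulVec_zero]
  have m7 : ∀ y : Fin d → ℝ, A.cov p * vecMulVec k y = vecMulVec v y := fun y => by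
    rw [mul_vecMulVec, hSk]
  have m8 : ∀ x : Fin d → ℝ, vecMulVec x v * K = vecMulVec x k := fun x => by
    rw [vecMulVec_mul, ← mulVec_transpose, h.K_symm, hk]
  have m9 : ∀ x : Fin d → ℝ, vecMulVec x v * Q = 0 := fun x => by
    rw [vecMulVec_mul, ← mulVec_transpose, h.Q_symm, hQ, vecMulVec_zero]
  have hsw : 1 + s * w ≠ 0 := by positivity
  refine ⟨A.mix_mem h.mem hs.le hs1.le i, ?_, h.Q_symm, h.Q_idem, ?_, ?_, ?_, h.trace_Q⟩
  · simp only [stepK, transpose_smul, transpose_sub, transpose_vecMulVec, h.K_symm]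
  · simp only [stepK, Matrix.smul_mul, Matrix.sub_mul, h.K_mul_Q, m4, smul_zero, sub_zero]
  · rw [cov_mix, ← hv]
    simp only [Matrix.smul_mul, Matrix.add_mul, h.cov_mul_Q, m9, smul_zero, add_zero]
  · rw [cov_mix, ← hv, stepK, Matrix.smul_mul, Matrix.mul_smul, smul_smul, mul_inv_cancel₀ h1s,
      one_smul]
    simp only [Matrix.add_mul, Matrix.mul_sub, Matrix.smul_mul,
      Matrix.mul_smul, m1, m7, m8, ← hw, h.cov_mul_K]
    ext x y
    simp [vecMulVec_apply]
    field_simp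
    ring

/-- The effect of `extend` on the form of the pseudo-inverse. -/
theorem extendK_form_le (h : A.Design p K Q r) (i j : Fin A.card) {s : ℝ} (hs : 0 < s)
    (hs1 : s ≤ 1 / 4) {k z : Fin d → ℝ} {w ζ W : ℝ} (hk : k = K *ᵥ A.dev p i)
    (hz : z = Q *ᵥ A.dev p i) (hw : w = A.dev p i ⬝ᵥ k) (hζ : ζ = A.dev p i ⬝ᵥ z) (hpos : 0 < ζ)
    (hmax : A.dev p j ⬝ᵥ Q *ᵥ A.dev p j ≤ ζ)
    (hWi : w ≤ W) (hWj : A.dev p j ⬝ᵥ K *ᵥ A.dev p j ≤ W) :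
    A.dev (A.mix p s i) j ⬝ᵥ extendK K k z s w ζ *ᵥ A.dev (A.mix p s i) j ≤ 6 * W + 3 / s := by
  rw [dev_mix]
  have hζ0 := hpos.ne'
  have hs0 := hs.ne'
  set v := A.dev p i with hv
  set u := A.dev p j with hu
  have hzv : z ⬝ᵥ v = ζ := by rw [dotProduct_comm, hζ]
  have hkv : k ⬝ᵥ v = w := by rw [dotProduct_comm, hw]
  obtain ⟨c, hc⟩ : ∃ c, c = (z ⬝ᵥ u) / ζ := ⟨_, rfl⟩
  have hzu : z ⬝ᵥ u = c * ζ := by rw [hc]; field_simp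
  have hc2 : c ^ 2 ≤ 1 := by
    have hq : ∀ t : ℝ, 0 ≤ u ⬝ᵥ Q *ᵥ u - 2 * t * (z ⬝ᵥ u) + t ^ 2 * ζ := by
      intro t
      have := h.Q_nonneg (u - t • v)
      rw [mulVec_sub, mulVec_smul, ← hz, dotProduct_sub, sub_dotProduct, sub_dotProduct,
        dotProduct_smul, smul_dotProduct, dotProduct_smul, smul_dotProduct, ← hζ,
        dotProduct_mulVec_of_symm h.Q_symm v u, ← hz, dotProduct_comm u z] at this
      simp only [smul_eq_mul] at this
      linarith
    have h1 := hq c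
    rw [hzu] at h1
    have h2 : c ^ 2 * ζ ≤ 1 * ζ := by nlinarith
    exact le_of_mul_le_mul_right h2 hpos
  have hKu : v ⬝ᵥ K *ᵥ u = k ⬝ᵥ u := by rw [dotProduct_mulVec_of_symm h.K_symm, hk]
  have hform : (u - s • v) ⬝ᵥ extendK K k z s w ζ *ᵥ (u - s • v)
      = (1 - s)⁻¹ * ((u - c • v) ⬝ᵥ K *ᵥ (u - c • v) + (c - s) ^ 2 / s) := by
    simp only [extendK, smul_mulVec, add_mulVec, sub_mulVec, vecMulVec_mulVec, mulVec_sub,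
      mulVec_smul, ← hk, dotProduct_sub, sub_dotProduct, dotProduct_smul, smul_dotProduct,
      dotProduct_add, op_smul_eq_smul, smul_eq_mul, hzu, hzv, hkv,
      hKu, dotProduct_comm u z, dotProduct_comm u k, dotProduct_comm v z, dotProduct_comm v k]
    field_simp
    ring
  have hpar : (u - c • v) ⬝ᵥ K *ᵥ (u - c • v) ≤ 4 * W := by
    have h1 := h.K_nonneg (u + c • v)
    simp only [mulVec_sub, mulVec_add, mulVec_smul, ← hk, dotProduct_sub, sub_dotProduct,
      dotProduct_smul, smul_dotProduct, dotProduct_add, add_dotProduct, smul_eq_mul, hKu,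
      dotProduct_comm u k, dotProduct_comm v k, hkv] at h1 ⊢
    have h0 : 0 ≤ w := by rw [hw, hk]; exact h.K_nonneg _
    nlinarith
  have hc1 : (c - s) ^ 2 ≤ 25 / 16 := by
    have h1 := abs_le.mp (abs_le_one_iff_mul_self_le_one.mpr (by nlinarith) : |c| ≤ 1)
    nlinarith
  have hinv : (1 - s)⁻¹ ≤ 4 / 3 := by
    rw [inv_le_comm₀ (by linarith) (by norm_num)]; linarith
  have hW : 0 ≤ W := (h.K_nonneg _).trans hWj
  rw [hform]
  have h3 : (c - s) ^ 2 / s ≤ 25 / 16 / s := by gcongr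
  calc _ ≤ (1 - s)⁻¹ * (4 * W + 25 / 16 / s) := by
        have : 0 ≤ (1 - s)⁻¹ := inv_nonneg.mpr (by linarith)
        gcongr
    _ ≤ 4 / 3 * (4 * W + 25 / 16 / s) := by gcongr
    _ ≤ _ := by
        have : 0 < 1 / s := by positivity
        rw [div_eq_mul_one_div (25 / 16) s, div_eq_mul_one_div 3 s]
        nlinarith

end Design
end ActionSet

theorem EuclideanSpace.inner_eq_dotProduct {d : ℕ} (x y : EuclideanSpace ℝ (Fin d)) :
    inner ℝ x y = x.ofLp ⬝ᵥ y.ofLp := by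
  simp [PiLp.inner_apply, dotProduct, mul_comm]

namespace ActionSet

open Matrix
variable {d : ℕ} {A : ActionSet d}

theorem cov_transpose (p : Fin A.card → ℝ) : (A.cov p)ᵀ = A.cov p := by
  have := A.cov_isHermitian p
  rwa [IsHermitian, conjTranspose_eq_transpose_of_trivial] at this

namespace Design

variable {p : Fin A.card → ℝ} {K Q : Matrix (Fin d) (Fin d) ℝ} {r : ℕ}

theorem full_of_frame (h : A.Design p K Q r) (hQ : ∀ i, Q *ᵥ A.dev p i = 0)
    {U : Matrix (Fin d) (Fin A.dim) ℝ} (hU1 : Uᵀ * U = 1)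
    (hU2 : ∀ i j, (U * Uᵀ) *ᵥ ((A.action i).ofLp - (A.action j).ofLp)
      = (A.action i).ofLp - (A.action j).ofLp)
    (hU3 : ∀ N : Matrix (Fin d) (Fin d) ℝ,
      (∀ i j, N *ᵥ ((A.action i).ofLp - (A.action j).ofLp) = 0) → N * U = 0) :
    U * Uᵀ = 1 - Q ∧ r = A.dim := by
  have hQU : Q * U = 0 := hU3 Q fun i j => by
    have : (A.action i).ofLp - (A.action j).ofLp = A.dev p i - A.dev p j := by simp [dev]
    rw [this, mulVec_sub, hQ, hQ, sub_zero]
  have h1 : U * Uᵀ * (1 - Q) = 1 - Q := by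
    rw [← h.cov_mul_K, ← Matrix.mul_assoc, A.frame_mul_cov hU2 h.mem.2]
  have h2 : U * Uᵀ = 1 - Q := by
    have hUQ : Uᵀ * Q = 0 := by
      have := congrArg transpose hQU
      rwa [transpose_mul, h.Q_symm, transpose_zero] at this
    rw [← h1, Matrix.mul_sub, Matrix.mul_one, Matrix.mul_assoc, hUQ, Matrix.mul_zero, sub_zero]
  refine ⟨h2, ?_⟩
  have h3 := congrArg trace h2
  rw [trace_mul_comm, hU1, trace_sub, trace_one, trace_one, h.trace_Q, Fintype.card_fin,
    Fintype.card_fin] at h3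
  have : (r : ℝ) = A.dim := by linarith
  exact_mod_cast this

theorem rank_eq_dim (h : A.Design p K Q r) (hQ : ∀ i, Q *ᵥ A.dev p i = 0) : r = A.dim := by
  obtain ⟨U, hU1, hU2, hU3⟩ := A.exists_frame
  exact (h.full_of_frame hQ hU1 hU2 hU3).2

theorem frame_inverse (h : A.Design p K Q r) {m : ℕ} {U : Matrix (Fin d) (Fin m) ℝ}
    (hU1 : Uᵀ * U = 1) (hUQ : U * Uᵀ = 1 - Q) :
    (Uᵀ * A.cov p * U) * (Uᵀ * K * U) = 1 := by
  calc (Uᵀ * A.cov p * U) * (Uᵀ * K * U) = Uᵀ * A.cov p * (U * Uᵀ) * K * U := by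
        simp only [Matrix.mul_assoc]
    _ = Uᵀ * (A.cov p * K) * U := by
        rw [hUQ, Matrix.mul_sub, Matrix.mul_assoc Uᵀ (A.cov p) Q, h.cov_mul_Q]
        simp [Matrix.mul_assoc]
    _ = (Uᵀ * U) * (Uᵀ * U) := by rw [h.cov_mul_K, ← hUQ]; simp only [Matrix.mul_assoc]
    _ = 1 := by rw [hU1, Matrix.one_mul]

theorem detCov_pos (h : A.Design p K Q r) (hQ : ∀ i, Q *ᵥ A.dev p i = 0) : 0 < A.detCov p := by
  obtain ⟨U, hU1, hU2, hU3⟩ := A.exists_frame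
  obtain ⟨hUQ, -⟩ := h.full_of_frame hQ hU1 hU2 hU3
  rw [A.detCov_eq hU1 hU2 h.mem]
  have hps : (Uᵀ * A.cov p * U).PosSemidef := by
    simpa [conjTranspose_eq_transpose_of_trivial] using
      (A.cov_posSemidef h.mem).conjTranspose_mul_mul_same U
  refine lt_of_le_of_ne hps.det_nonneg fun h0 => ?_
  have := congrArg Matrix.det (h.frame_inverse hU1 hUQ)
  rw [det_mul, ← h0, zero_mul, det_one] at this
  exact zero_ne_one this

theorem trace_le (h : A.Design p K Q r) {q : Fin A.card → ℝ} (hq : q ∈ A.Dist) :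
    (K * A.cov q).trace ≤ ∑ i, q i * (A.dev p i ⬝ᵥ K *ᵥ A.dev p i) := by
  rw [A.trace_mul_cov K hq.2 (A.mean p).ofLp]
  have := h.K_nonneg ((A.mean q).ofLp - (A.mean p).ofLp)
  simp only [dev]
  linarith

theorem log_detCov_sub_le (h : A.Design p K Q r) (hQ : ∀ i, Q *ᵥ A.dev p i = 0)
    {q : Fin A.card → ℝ} (hq : q ∈ A.Dist) (hdq : 0 < A.detCov q) {t : ℝ} (ht : 0 < t) :
    Real.log (A.detCov q) - Real.log (A.detCov p) ≤
      (∑ i, q i * (A.dev p i ⬝ᵥ K *ᵥ A.dev p i)) / t - A.dim + A.dim * Real.log t := by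
  have hdp := h.detCov_pos hQ
  obtain ⟨U, hU1, hU2, hU3⟩ := A.exists_frame
  obtain ⟨hUQ, -⟩ := h.full_of_frame hQ hU1 hU2 hU3
  rw [A.detCov_eq hU1 hU2 h.mem] at hdp ⊢
  rw [A.detCov_eq hU1 hU2 hq] at hdq ⊢
  have hL : (Uᵀ * K * U).PosSemidef := by
    simpa [conjTranspose_eq_transpose_of_trivial] using
      h.K_posSemidef.conjTranspose_mul_mul_same U
  have hN : (Uᵀ * A.cov q * U).PosSemidef := by
    simpa [conjTranspose_eq_transpose_of_trivial] using
      (A.cov_posSemidef hq).conjTranspose_mul_mul_same U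
  have h1 := hL.log_det_sub_le (h.frame_inverse hU1 hUQ) hN hdp hdq ht
  have htr : (Uᵀ * K * U * (Uᵀ * A.cov q * U)).trace = (K * A.cov q).trace := by
    have hc := A.frame_mul_cov hU2 hq.2
    have hc' : A.cov q * (U * Uᵀ) = A.cov q := by
      have := congrArg transpose hc
      rwa [transpose_mul, transpose_mul, transpose_transpose, cov_transpose] at this
    calc (Uᵀ * K * U * (Uᵀ * A.cov q * U)).trace
        = (Uᵀ * (K * (U * Uᵀ * A.cov q) * U)).trace := by simp only [Matrix.mul_assoc]
      _ = (K * (A.cov q * (U * Uᵀ))).trace := by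
          rw [hc, trace_mul_comm]; simp only [Matrix.mul_assoc]
      _ = _ := by rw [hc']
  rw [htr] at h1
  refine h1.trans ?_
  have := h.trace_le hq
  gcongr

theorem sum_mul_dev (p : Fin A.card → ℝ) {q : Fin A.card → ℝ} (hq : ∑ i, q i = 1)
    (u : Fin d → ℝ) :
    ∑ i, q i * (A.dev p i ⬝ᵥ u) = (A.mean q).ofLp ⬝ᵥ u - (A.mean p).ofLp ⬝ᵥ u := by
  simp only [dev, sub_dotProduct, mul_sub, Finset.sum_sub_distrib, ← Finset.sum_mul, hq, one_mul,
    mean_ofLp A q, sum_dotProduct, smul_dotProduct, smul_eq_mul]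

/-- The stopping rule of the algorithm bounds the optimality gap. -/
theorem barrier_le (h : A.Design p K Q r) (hQ : ∀ i, Q *ᵥ A.dev p i = 0)
    (θ : EuclideanSpace ℝ (Fin d)) {γ : ℝ} (hγ : 0 < γ)
    (hle : ∀ i, A.dev p i ⬝ᵥ K *ᵥ A.dev p i - γ * (A.dev p i ⬝ᵥ θ.ofLp) ≤ 2 * A.dim)
    {q : Fin A.card → ℝ} (hq : q ∈ A.Dist) :
    A.barrier θ γ p ≤ A.barrier θ γ q + (((A.dim : ℝ) / γ : ℝ) : EReal) := by
  have hdp := h.detCov_pos hQ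
  unfold barrier
  rw [if_pos hdp]
  split_ifs with hdq
  · rw [← EReal.coe_add, EReal.coe_le_coe_iff]
    have h1 := h.log_detCov_sub_le hQ hq hdq one_pos
    rw [Real.log_one, mul_zero, div_one, add_zero] at h1
    have h2 : ∑ i, q i * (A.dev p i ⬝ᵥ K *ᵥ A.dev p i)
        ≤ 2 * A.dim + γ * ((A.mean q).ofLp ⬝ᵥ θ.ofLp - (A.mean p).ofLp ⬝ᵥ θ.ofLp) := by
      rw [← sum_mul_dev p hq.2]
      calc _ ≤ ∑ i, q i * (2 * A.dim + γ * (A.dev p i ⬝ᵥ θ.ofLp)) :=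
            Finset.sum_le_sum fun i _ => mul_le_mul_of_nonneg_left
              (by linarith [hle i]) (hq.1 i)
        _ = _ := by
            simp only [mul_add, Finset.sum_add_distrib, ← Finset.sum_mul, hq.2, one_mul,
              Finset.mul_sum]
            congr 1
            exact Finset.sum_congr rfl fun i _ => by ring
    rw [EuclideanSpace.inner_eq_dotProduct, EuclideanSpace.inner_eq_dotProduct]
    have h3 : γ * ((A.mean p).ofLp ⬝ᵥ θ.ofLp) - Real.log (A.detCov p)
        ≤ γ * ((A.mean q).ofLp ⬝ᵥ θ.ofLp) - Real.log (A.detCov q) + A.dim := by linarith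
    have h4 := mul_le_mul_of_nonneg_left h3 (inv_nonneg.mpr hγ.le)
    have e1 : γ⁻¹ * γ = 1 := inv_mul_cancel₀ hγ.ne'
    calc _ = γ⁻¹ * (γ * ((A.mean p).ofLp ⬝ᵥ θ.ofLp) - Real.log (A.detCov p)) := by
          rw [mul_sub, ← mul_assoc, e1, one_mul]
      _ ≤ _ := h4
      _ = _ := by rw [mul_add, mul_sub, ← mul_assoc, e1, one_mul]; ring
  · rw [EReal.top_add_coe]
    exact le_top

/-- The stopping rule of the algorithm bounds the trade-off between regret and estimation. -/
theorem tradeoff_le (h : A.Design p K Q r) (hQ : ∀ i, Q *ᵥ A.dev p i = 0)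
    (θ : EuclideanSpace ℝ (Fin d)) {γ : ℝ} (hγ : 0 < γ)
    (hle : ∀ i, A.dev p i ⬝ᵥ K *ᵥ A.dev p i - γ * (A.dev p i ⬝ᵥ θ.ofLp) ≤ 2 * A.dim)
    (i : Fin A.card) (θ' : EuclideanSpace ℝ (Fin d)) :
    inner ℝ (A.mean p - A.action i) θ' - γ / 4 * quadForm (A.cov p) (θ - θ')
      ≤ 2 * ((A.dim : ℝ) / γ) := by
  have hst := hle i
  have hS : (A.cov p)ᵀ = A.cov p := cov_transpose p
  rw [EuclideanSpace.inner_eq_dotProduct, quadForm]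
  have hv : (A.mean p - A.action i).ofLp = - A.dev p i := by simp [dev]
  rw [hv, neg_dotProduct, WithLp.ofLp_sub]
  set v := A.dev p i
  obtain ⟨u, hu⟩ : ∃ u, u = θ.ofLp - θ'.ofLp := ⟨_, rfl⟩
  have hθ' : θ'.ofLp = θ.ofLp - u := by rw [hu]; abel
  rw [← hu, hθ', dotProduct_sub]
  have hSK : A.cov p *ᵥ (K *ᵥ v) = v := by
    rw [mulVec_mulVec, h.cov_mul_K, sub_mulVec, one_mulVec, hQ, sub_zero]
  have hsq := (A.cov_posSemidef h.mem).dotProduct_mulVec_nonneg ((γ / 2) • u - K *ᵥ v)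
  simp only [star_trivial, mulVec_sub, mulVec_smul, hSK, dotProduct_sub, sub_dotProduct,
    dotProduct_smul, smul_dotProduct, smul_eq_mul, dotProduct_mulVec_of_symm hS (K *ᵥ v) u] at hsq
  rw [dotProduct_comm u v, dotProduct_comm (K *ᵥ v) v] at hsq
  have hkey : γ * (v ⬝ᵥ u) - γ * (γ / 4 * (u ⬝ᵥ A.cov p *ᵥ u)) ≤ v ⬝ᵥ K *ᵥ v := by linarith
  have : γ * (-(v ⬝ᵥ θ.ofLp - v ⬝ᵥ u) - γ / 4 * (u ⬝ᵥ A.cov p *ᵥ u)) ≤ γ * (2 * (A.dim / γ)) := by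
    have e : γ * (2 * ((A.dim : ℝ) / γ)) = 2 * A.dim := by field_simp
    rw [e]
    linarith
  exact le_of_mul_le_mul_left this hγ

/-- The objective that the algorithm decreases. -/
noncomputable def _root_.ActionSet.potential (A : ActionSet d) (θ : EuclideanSpace ℝ (Fin d))
    (γ : ℝ) (p : Fin A.card → ℝ) : ℝ :=
  2 / 3 * γ * ((A.mean p).ofLp ⬝ᵥ θ.ofLp) - Real.log (A.detCov p)

theorem potential_step_le (h : A.Design p K Q r) (hQ : ∀ i, Q *ᵥ A.dev p i = 0)
    (θ : EuclideanSpace ℝ (Fin d)) {γ : ℝ} (i : Fin A.card) {w s : ℝ}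
    (hw : w = A.dev p i ⬝ᵥ K *ᵥ A.dev p i) (hs : s = 1 / (3 * w + 6))
    (hviol : 2 * A.dim < w - γ * (A.dev p i ⬝ᵥ θ.ofLp)) :
    A.potential θ γ (A.mix p s i) ≤ A.potential θ γ p - 1 / 72 := by
  have hw0 : 0 ≤ w := by rw [hw]; exact h.K_nonneg _
  have hs0 : 0 < s := by rw [hs]; positivity
  have hs6 : s ≤ 1 / 6 := by rw [hs]; gcongr; linarith
  have hsw : s * (3 * w + 6) = 1 := by rw [hs]; field_simp
  have hdp := h.detCov_pos hQ
  obtain ⟨U, hU1, hU2, hU3⟩ := A.exists_frame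
  obtain ⟨hUQ, -⟩ := h.full_of_frame hQ hU1 hU2 hU3
  have hUv : (U * Uᵀ) *ᵥ A.dev p i = A.dev p i := by
    rw [hUQ, sub_mulVec, hQ, one_mulVec, sub_zero]
  have hdet : A.detCov (A.mix p s i) = (1 - s) ^ A.dim * (A.detCov p * (1 + s * w)) := by
    rw [A.detCov_eq hU1 hU2 (A.mix_mem h.mem hs0.le (by linarith) i),
      A.detCov_eq hU1 hU2 h.mem, cov_mix]
    have e : Uᵀ * ((1 - s) • (A.cov p + s • vecMulVec (A.dev p i) (A.dev p i))) * U
        = (1 - s) • (Uᵀ * A.cov p * U + s • vecMulVec (Uᵀ *ᵥ A.dev p i) (Uᵀ *ᵥ A.dev p i)) := by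
      simp only [Matrix.mul_smul, Matrix.smul_mul, Matrix.mul_add, Matrix.add_mul, mul_vecMulVec,
        vecMulVec_mul, mulVec_transpose]
    rw [e, det_smul, Fintype.card_fin, det_add_smul_vecMulVec (h.frame_inverse hU1 hUQ), hw]
    congr 4
    have hT : (U * Uᵀ)ᵀ = U * Uᵀ := by rw [transpose_mul, transpose_transpose]
    rw [mulVec_transpose, ← dotProduct_mulVec, ← mulVec_transpose, mulVec_mulVec, mulVec_mulVec,
      ← Matrix.mul_assoc, ← Matrix.mul_assoc, Matrix.mul_assoc, ← mulVec_mulVec, hUv,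
      ← mulVec_mulVec, dotProduct_mulVec_of_symm hT, hUv]
  have hm : 1 ≤ (A.dim : ℝ) := by
    rcases Nat.eq_zero_or_pos A.dim with h0 | h0
    · exfalso
      have hz : A.dev p i = 0 := by
        rw [← hUv]
        have : U * Uᵀ = 0 := by
          ext x y
          rw [Matrix.mul_apply, Matrix.zero_apply]
          exact Finset.sum_eq_zero fun k _ => absurd k.2 (by omega)
        rw [this, zero_mulVec]
      rw [hz] at hviol hw
      simp only [zero_dotProduct] at hw hviol
      simp [hw, h0] at hviol
    · exact_mod_cast h0
  have h1s : 0 < 1 - s := by linarith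
  have hsw0 : 0 ≤ s * w := by positivity
  have hlog : Real.log (A.detCov (A.mix p s i))
      = A.dim * Real.log (1 - s) + Real.log (A.detCov p) + Real.log (1 + s * w) := by
    rw [hdet, Real.log_mul (by positivity) (by positivity), Real.log_pow,
      Real.log_mul hdp.ne' (by positivity)]
    ring
  have hl1 : - (6 / 5 * s) ≤ Real.log (1 - s) := by
    have := Real.one_sub_inv_le_log_of_pos h1s
    have h2 : (1 - s)⁻¹ ≤ 1 + 6 / 5 * s := by
      rw [inv_le_iff_one_le_mul₀ h1s]
      nlinarith
    linarith
  have hl2 : 3 / 4 * (s * w) ≤ Real.log (1 + s * w) := by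
    have := Real.one_sub_inv_le_log_of_pos (show 0 < 1 + s * w by positivity)
    have h2 : (1 + s * w)⁻¹ ≤ 1 - 3 / 4 * (s * w) := by
      rw [inv_le_iff_one_le_mul₀ (by positivity)]
      nlinarith
    linarith
  have hmean : (A.mean (A.mix p s i)).ofLp ⬝ᵥ θ.ofLp
      = (A.mean p).ofLp ⬝ᵥ θ.ofLp + s * (A.dev p i ⬝ᵥ θ.ofLp) := by
    rw [mean_mix, add_dotProduct, smul_dotProduct, smul_eq_mul]
  unfold potential
  rw [hlog, hmean]
  have hm1 : A.dim * Real.log (1 - s) ≥ A.dim * (- (6 / 5 * s)) := by gcongr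
  have hv2 : s * (γ * (A.dev p i ⬝ᵥ θ.ofLp)) ≤ s * (w - 2 * A.dim) :=
    mul_le_mul_of_nonneg_left (by linarith) hs0.le
  have hfin : 1 / 72 ≤ s * w / 12 + 2 / 15 * (A.dim * s) := by
    have : s * 1 ≤ A.dim * s := by nlinarith
    nlinarith
  linarith

/-- A bound on the forms of all deviations bounds the possible decrease of the potential. -/
theorem potential_le (h : A.Design p K Q r) (hQ : ∀ i, Q *ᵥ A.dev p i = 0)
    (θ : EuclideanSpace ℝ (Fin d)) {γ W : ℝ} (hW1 : 1 ≤ W)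
    (hW : ∀ i, A.dev p i ⬝ᵥ K *ᵥ A.dev p i ≤ W) {q : Fin A.card → ℝ} (hq : q ∈ A.Dist)
    (hdq : 0 < A.detCov q) :
    A.potential θ γ p ≤ A.potential θ γ q +
      2 / 3 * γ * ((A.mean p).ofLp ⬝ᵥ θ.ofLp - (A.mean q).ofLp ⬝ᵥ θ.ofLp)
        + 1 + A.dim * Real.log W := by
  have hWp : 0 < W := by linarith
  have h1 := h.log_detCov_sub_le hQ hq hdq hWp
  have h2 : (∑ i, q i * (A.dev p i ⬝ᵥ K *ᵥ A.dev p i)) / W ≤ 1 := by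
    rw [div_le_one hWp]
    calc _ ≤ ∑ i, q i * W := Finset.sum_le_sum fun i _ =>
          mul_le_mul_of_nonneg_left (hW i) (hq.1 i)
      _ = W := by rw [← Finset.sum_mul, hq.2, one_mul]
  have h3 : (0 : ℝ) ≤ A.dim := Nat.cast_nonneg _
  unfold potential
  linarith

end Design
end ActionSet

namespace ActionSet

open Matrix
variable {d : ℕ} {A : ActionSet d}

theorem dotProduct_le_norm (u θ : EuclideanSpace ℝ (Fin d)) : |u.ofLp ⬝ᵥ θ.ofLp| ≤ ‖u‖ * ‖θ‖ := by
  rw [← EuclideanSpace.inner_eq_dotProduct]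
  exact abs_real_inner_le_norm u θ

theorem norm_mean_le {p : Fin A.card → ℝ} (hp : p ∈ A.Dist) : ‖A.mean p‖ ≤ 1 := by
  refine (norm_sum_le _ _).trans ?_
  rw [← hp.2]
  refine Finset.sum_le_sum fun i _ => ?_
  rw [norm_smul, Real.norm_of_nonneg (hp.1 i)]
  exact mul_le_of_le_one_right (hp.1 i) (A.norm_le_one i)

theorem dev_dotProduct_le {p : Fin A.card → ℝ} (hp : p ∈ A.Dist) (i : Fin A.card)
    (θ : EuclideanSpace ℝ (Fin d)) : A.dev p i ⬝ᵥ θ.ofLp ≤ 2 * ‖θ‖ := by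
  have h1 := (le_abs_self _).trans (dotProduct_le_norm (A.action i - A.mean p) θ)
  rw [WithLp.ofLp_sub] at h1
  refine h1.trans ?_
  have := norm_sub_le (A.action i) (A.mean p)
  have := A.norm_le_one i
  have := norm_mean_le hp
  gcongr
  linarith

theorem dim_le (A : ActionSet d) : A.dim ≤ d := by
  have := Submodule.finrank_le (vectorSpan ℝ (Set.range A.action))
  simpa [dim] using this

/-- An upper bound for the initial optimality gap of the potential. -/
noncomputable def gapBound (A : ActionSet d) (θ : EuclideanSpace ℝ (Fin d)) (γ : ℝ) : ℝ :=
  A.dim + 1 + A.dim * Real.log (6 ^ A.dim * (4 + (γ * ‖θ‖) ^ 2))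

/-- The invariant of the main loop, after `n` steps have been made. -/
structure Progress (A : ActionSet d) (θ : EuclideanSpace ℝ (Fin d)) (γ : ℝ)
    (p : Fin A.card → ℝ) (K Q : Matrix (Fin d) (Fin d) ℝ) (r n : ℕ) : Prop where
  design : A.Design p K Q r
  phase : (n = r + 1 ∧
      (∀ i, A.dev p i ⬝ᵥ K *ᵥ A.dev p i ≤ (6 ^ r - 1) * (4 + (γ * ‖θ‖) ^ 2)) ∧
      ∀ i, γ * ((A.mean p).ofLp ⬝ᵥ θ.ofLp) ≤ γ * ((A.action i).ofLp ⬝ᵥ θ.ofLp) + r) ∨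
    ((∀ i, Q *ᵥ A.dev p i = 0) ∧ ∀ q ∈ A.Dist, 0 < A.detCov q →
      A.potential θ γ p + ((n : ℝ) - 1 - A.dim) / 72 ≤ A.potential θ γ q + gapBound A θ γ)

namespace Progress

variable {θ : EuclideanSpace ℝ (Fin d)} {γ : ℝ} {p : Fin A.card → ℝ}
  {K Q : Matrix (Fin d) (Fin d) ℝ} {r n : ℕ}

theorem single {i : Fin A.card}
    (hi : ∀ j, γ * ((A.action i).ofLp ⬝ᵥ θ.ofLp) ≤ γ * ((A.action j).ofLp ⬝ᵥ θ.ofLp)) :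
    Progress A θ γ (Pi.single i 1) 0 1 0 1 where
  design := Design.single i
  phase := Or.inl ⟨rfl, by simp, fun j => by rw [mean_single]; simpa using hi j⟩

theorem gapBound_nonneg : 0 ≤ gapBound A θ γ := by
  have h : (1 : ℝ) ≤ 6 ^ A.dim * (4 + (γ * ‖θ‖) ^ 2) := by
    have h1 : (1 : ℝ) ≤ 6 ^ A.dim := one_le_pow₀ (by norm_num)
    have h2 : (1 : ℝ) ≤ 4 + (γ * ‖θ‖) ^ 2 := by nlinarith [sq_nonneg (γ * ‖θ‖)]
    nlinarith
  have := Real.log_nonneg h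
  unfold gapBound
  positivity

theorem count_le (h : Progress A θ γ p K Q r n) :
    (n : ℝ) ≤ d + 1 + 72 * gapBound A θ γ := by
  have hg := gapBound_nonneg (A := A) (θ := θ) (γ := γ)
  rcases h.phase with ⟨hn, -, -⟩ | ⟨hQ, hq⟩
  · have h1 := h.design.Q_posSemidef.trace_nonneg
    rw [h.design.trace_Q] at h1
    rw [hn]; push_cast; linarith
  · have h1 := hq p h.design.mem (h.design.detCov_pos hQ)
    have h2 : (A.dim : ℝ) ≤ d := by exact_mod_cast A.dim_le
    linarith

theorem rank_le (h : Progress A θ γ p K Q r n) : r ≤ d := by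
  have h1 := h.design.Q_posSemidef.trace_nonneg
  rw [h.design.trace_Q] at h1
  have : (r : ℝ) ≤ d := by linarith
  exact_mod_cast this

theorem full (h : Progress A θ γ p K Q r n) (hQ : ∀ i, Q *ᵥ A.dev p i = 0)
    {q : Fin A.card → ℝ} (hq : q ∈ A.Dist) (hdq : 0 < A.detCov q) :
    A.potential θ γ p + ((n : ℝ) - 1 - A.dim) / 72 ≤ A.potential θ γ q + gapBound A θ γ := by
  rcases h.phase with ⟨hn, hW, hlin⟩ | ⟨-, h2⟩
  · have hr := h.design.rank_eq_dim hQ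
    subst hr
    have hx : (1 : ℝ) ≤ 4 + (γ * ‖θ‖) ^ 2 := by nlinarith [sq_nonneg (γ * ‖θ‖)]
    have h6 : (1 : ℝ) ≤ 6 ^ A.dim := one_le_pow₀ (by norm_num)
    have h1 := h.design.potential_le hQ θ (γ := γ) (W := 6 ^ A.dim * (4 + (γ * ‖θ‖) ^ 2))
      (by nlinarith) (fun i => (hW i).trans (by nlinarith)) hq hdq
    have h3 : γ * ((A.mean p).ofLp ⬝ᵥ θ.ofLp) ≤ γ * ((A.mean q).ofLp ⬝ᵥ θ.ofLp) + A.dim := by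
      have : (A.mean q).ofLp ⬝ᵥ θ.ofLp = ∑ i, q i * ((A.action i).ofLp ⬝ᵥ θ.ofLp) := by
        rw [mean_ofLp, sum_dotProduct]
        simp [smul_dotProduct]
      rw [this, Finset.mul_sum]
      calc _ = ∑ i, q i * (γ * ((A.mean p).ofLp ⬝ᵥ θ.ofLp)) := by
            rw [← Finset.sum_mul, hq.2, one_mul]
        _ ≤ ∑ i, q i * (γ * ((A.action i).ofLp ⬝ᵥ θ.ofLp) + A.dim) :=
            Finset.sum_le_sum fun i _ => mul_le_mul_of_nonneg_left (hlin i) (hq.1 i)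
        _ = _ := by
            simp only [mul_add, Finset.sum_add_distrib, ← Finset.sum_mul, hq.2, one_mul]
            congr 1
            exact Finset.sum_congr rfl fun i _ => by ring
    have h4 : (0 : ℝ) ≤ A.dim := Nat.cast_nonneg _
    have h5 : ((n : ℝ) - 1 - A.dim) / 72 = 0 := by rw [hn]; push_cast; ring
    rw [h5]
    unfold gapBound
    linarith
  · exact h2 q hq hdq

theorem extend (h : Progress A θ γ p K Q r n) (hγ : 0 < γ) (i : Fin A.card)
    (hmax : ∀ j, A.dev p j ⬝ᵥ Q *ᵥ A.dev p j ≤ A.dev p i ⬝ᵥ Q *ᵥ A.dev p i)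
    {s w ζ : ℝ} {k z : Fin d → ℝ} (hs : s = 1 / (4 + (γ * ‖θ‖) ^ 2)) (hk : k = K *ᵥ A.dev p i)
    (hz : z = Q *ᵥ A.dev p i)
    (hw : w = A.dev p i ⬝ᵥ k) (hζ : ζ = A.dev p i ⬝ᵥ z) (hpos : 0 < ζ) :
    Progress A θ γ (A.mix p s i) (Design.extendK K k z s w ζ) (Q - ζ⁻¹ • vecMulVec z z)
      (r + 1) (n + 1) := by
  have hx : (4 : ℝ) ≤ 4 + (γ * ‖θ‖) ^ 2 := by nlinarith [sq_nonneg (γ * ‖θ‖)]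
  have hs0 : 0 < s := by rw [hs]; positivity
  have hs4 : s ≤ 1 / 4 := by rw [hs]; gcongr
  rcases h.phase with ⟨hn, hW, hlin⟩ | ⟨hQ, -⟩
  · refine ⟨h.design.extend i hs0 (by linarith) hk hz hw hζ hpos, Or.inl ⟨by omega, fun j => ?_,
      fun j => ?_⟩⟩
    · refine (h.design.extendK_form_le i j hs0 hs4 hk hz hw hζ hpos
        ((hmax j).trans_eq (by rw [hζ, hz])) ((hW i).trans_eq' (by rw [hw, hk])) (hW j)).trans ?_
      have : 3 / s = 3 * (4 + (γ * ‖θ‖) ^ 2) := by rw [hs]; field_simp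
      rw [this, pow_succ (6 : ℝ) r]
      nlinarith
    · rw [mean_mix, add_dotProduct, smul_dotProduct, smul_eq_mul]
      have h1 := dev_dotProduct_le h.design.mem i θ
      have h2 : γ * (s * (A.dev p i ⬝ᵥ θ.ofLp)) ≤ 1 := by
        have h3 : γ * (s * (A.dev p i ⬝ᵥ θ.ofLp)) ≤ s * (2 * (γ * ‖θ‖)) := by
          calc _ = s * γ * (A.dev p i ⬝ᵥ θ.ofLp) := by ring
            _ ≤ s * γ * (2 * ‖θ‖) := by gcongr
            _ = _ := by ring
        refine h3.trans ?_
        rw [hs, one_div, inv_mul_le_iff₀ (by positivity)]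
        nlinarith [sq_nonneg (γ * ‖θ‖ - 1)]
      have := hlin j
      push_cast
      linarith
  · exfalso
    rw [hz, hQ i, dotProduct_zero] at hζ
    exact hpos.ne' hζ

theorem step (h : Progress A θ γ p K Q r n) (hQ : ∀ i, Q *ᵥ A.dev p i = 0)
    (i : Fin A.card) {s w : ℝ} {k : Fin d → ℝ} (hk : k = K *ᵥ A.dev p i)
    (hw : w = A.dev p i ⬝ᵥ k) (hs : s = 1 / (3 * w + 6))
    (hviol : 2 * r < w - γ * (A.dev p i ⬝ᵥ θ.ofLp)) :
    Progress A θ γ (A.mix p s i) (Design.stepK K k s w) Q r (n + 1) := by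
  have hr := h.design.rank_eq_dim hQ
  have hw0 : 0 ≤ w := by rw [hw, hk]; exact h.design.K_nonneg _
  have hs0 : 0 < s := by rw [hs]; positivity
  have hs6 : s ≤ 1 / 6 := by rw [hs]; gcongr; linarith
  refine ⟨h.design.step i hs0 (by linarith) hk (hQ i) hw, Or.inr ⟨fun j => ?_, fun q hq hdq => ?_⟩⟩
  · rw [dev_mix, mulVec_sub, mulVec_smul, hQ, hQ, smul_zero, sub_zero]
  · have h1 := h.full hQ hq hdq
    have h2 := h.design.potential_step_le hQ θ (γ := γ) i (w := w) (by rw [hw, hk]) hs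
      (by rw [← hr]; exact hviol)
    push_cast
    linarith

end Progress

theorem gapBound_le (hd : 0 < d) (θ : EuclideanSpace ℝ (Fin d)) {γ : ℝ} (hγ : 0 < γ) :
    d + 1 + 72 * gapBound A θ γ ≤ 512 * (d : ℝ) ^ 2 * (1 + Real.log (1 + γ * ‖θ‖)) := by
  have hx : 0 ≤ γ * ‖θ‖ := by positivity
  obtain ⟨x, hxe⟩ : ∃ x, x = γ * ‖θ‖ := ⟨_, rfl⟩
  unfold gapBound
  rw [← hxe] at hx ⊢
  have hl : 0 ≤ Real.log (1 + x) := Real.log_nonneg (by linarith)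
  have h6 : Real.log 6 ≤ 2 := by
    have : Real.log 6 ≤ Real.log (Real.exp 1 ^ 2) := by
      apply Real.log_le_log (by norm_num)
      nlinarith [Real.exp_one_gt_d9]
    simpa using this
  have h4 : Real.log (4 + x ^ 2) ≤ 2 + 2 * Real.log (1 + x) := by
    have h1 : Real.log (4 + x ^ 2) ≤ Real.log (6 * (1 + x) ^ 2) :=
      Real.log_le_log (by positivity) (by nlinarith)
    rw [Real.log_mul (by norm_num) (by positivity), Real.log_pow] at h1
    push_cast at h1
    linarith
  rw [Real.log_mul (by positivity) (by positivity), Real.log_pow]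
  have hmd : (A.dim : ℝ) ≤ d := by exact_mod_cast A.dim_le
  have hm0 : (0 : ℝ) ≤ A.dim := Nat.cast_nonneg _
  have hd1 : (1 : ℝ) ≤ d := by exact_mod_cast hd
  have e1 : (A.dim : ℝ) * (A.dim * Real.log 6 + Real.log (4 + x ^ 2))
      ≤ d * (d * 2 + (2 + 2 * Real.log (1 + x))) := by
    have : (0 : ℝ) ≤ Real.log 6 := Real.log_nonneg (by norm_num)
    have : (0 : ℝ) ≤ Real.log (4 + x ^ 2) := Real.log_nonneg (by nlinarith)
    gcongr
  have e2 : (d : ℝ) ≤ d ^ 2 := by nlinarith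
  have e3 : (d : ℝ) * Real.log (1 + x) ≤ d ^ 2 * Real.log (1 + x) := by gcongr
  nlinarith

end ActionSet

namespace RAM

variable {d : ℕ} {I : BarrierInput d}

/-! ### Determinism -/

theorem Exec.deterministic {P : Prog} {σ σ₁ σ₂ : State} {t₁ t₂ m₁ m₂ : ℕ}
    (h₁ : Exec I P σ σ₁ t₁ m₁) (h₂ : Exec I P σ σ₂ t₂ m₂) : σ₁ = σ₂ := by
  induction h₁ generalizing σ₂ t₂ m₂ with
  | skip => cases h₂; rfl
  | setNat => cases h₂; rfl
  | setReal => cases h₂; rfl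
  | seq _ _ ih ih' =>
    cases h₂ with
    | seq g g' =>
      have := ih g
      subst this
      exact ih' g'
  | iteTrue hb _ ih =>
    cases h₂ with
    | iteTrue _ g => exact ih g
    | iteFalse hb' _ => exact absurd hb hb'
  | iteFalse hb _ ih =>
    cases h₂ with
    | iteTrue hb' _ => exact absurd hb' hb
    | iteFalse _ g => exact ih g
  | loopTrue hb _ _ ih ih' =>
    cases h₂ with
    | loopTrue _ g g' =>
      have := ih g
      subst this
      exact ih' g'
    | loopFalse hb' => exact absurd hb hb'
  | loopFalse hb =>
    cases h₂ with
    | loopTrue hb' _ _ => exact absurd hb' hb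
    | loopFalse _ => rfl

theorem Prog.Computes.unique {P : Prog} {p q : Fin I.A.card → ℝ} {t₁ t₂ m₁ m₂ : ℕ}
    (h₁ : P.Computes I p t₁ m₁) (h₂ : P.Computes I q t₂ m₂) : p = q := by
  obtain ⟨σ₁, g₁, rfl⟩ := h₁
  obtain ⟨σ₂, g₂, rfl⟩ := h₂
  rw [g₁.deterministic g₂]

/-! ### Bounds on the cost of expressions -/

/-- The bit length of the value of an expression, in units of the bit length of the cells. -/
def NExp.len : NExp → ℕ
  | const k => 1 + k.size
  | card => 1
  | dim => 1
  | cell _ => 1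
  | add e f => e.len + f.len + 1
  | sub e f => e.len + f.len + 1
  | mul e f => e.len + f.len + 1

/-- The cost of an expression, in units of the squared bit length of the cells. -/
def NExp.wt : NExp → ℕ
  | const k => 1 + k.size
  | card => 2
  | dim => 2
  | cell a => a.wt + 2 + a.len
  | add e f => e.wt + f.wt + (1 + e.len) * (1 + f.len)
  | sub e f => e.wt + f.wt + (1 + e.len) * (1 + f.len)
  | mul e f => e.wt + f.wt + (1 + e.len) * (1 + f.len)

def RExp.wt : RExp → ℕ
  | ofNat e => e.wt + 1 + e.len
  | cell a => a.wt + 1 + a.len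
  | action i j => i.wt + j.wt + 1 + i.len + j.len
  | theta j => j.wt + 1 + j.len
  | gamma => 1
  | add e f => e.wt + f.wt + 1
  | sub e f => e.wt + f.wt + 1
  | mul e f => e.wt + f.wt + 1
  | div e f => e.wt + f.wt + 1
  | sqrt e => e.wt + 1

def Test.wt : Test → ℕ
  | ltNat e f => e.wt + f.wt + 1 + e.len + f.len
  | ltReal e f => e.wt + f.wt + 1
  | not b => b.wt + 1
  | and b c => b.wt + c.wt + 1

def Prog.wt : Prog → ℕ
  | skip => 1
  | setNat a e => a.wt + e.wt + 1 + a.len + e.len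
  | setReal a e => a.wt + e.wt + 1 + a.len
  | seq P Q => P.wt + Q.wt
  | ite b P Q => b.wt + P.wt + Q.wt
  | loop b P => b.wt + P.wt

/-- The natural numbers in the input and in the working memory have at most `S` bits. -/
structure Bits (I : BarrierInput d) (S : ℕ) (σ : State) : Prop where
  one_le : 1 ≤ S
  card : I.A.card.size ≤ S
  dim : d.size ≤ S
  cell : ∀ a, (σ.nat a).size ≤ S

theorem _root_.Nat.size_add_le (a b : ℕ) : (a + b).size ≤ a.size + b.size + 1 := by
  rw [Nat.size_le]
  have ha := Nat.lt_size_self a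
  have hb := Nat.lt_size_self b
  have h1 : 2 ^ a.size ≤ 2 ^ (a.size + b.size) := Nat.pow_le_pow_right (by norm_num) (by omega)
  have h2 : 2 ^ b.size ≤ 2 ^ (a.size + b.size) := Nat.pow_le_pow_right (by norm_num) (by omega)
  rw [pow_succ]
  omega

theorem _root_.Nat.size_mul_le (a b : ℕ) : (a * b).size ≤ a.size + b.size := by
  rw [Nat.size_le, pow_add]
  exact Nat.mul_lt_mul'' (Nat.lt_size_self a) (Nat.lt_size_self b)

namespace Bits

variable {S : ℕ} {σ : State}

theorem size_val_le (h : Bits I S σ) (e : NExp) : (e.val I σ).size ≤ e.len * S := by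
  have h1 := h.one_le
  induction e with
  | const k => simp only [NExp.val, NExp.len]; nlinarith
  | card => simpa [NExp.val, NExp.len] using h.card
  | dim => simpa [NExp.val, NExp.len] using h.dim
  | cell a _ => simpa [NExp.val, NExp.len] using h.cell _
  | add e f he hf =>
    have := Nat.size_add_le (e.val I σ) (f.val I σ)
    simp only [NExp.val, NExp.len]; nlinarith
  | sub e f he hf =>
    have := Nat.size_le_size (Nat.sub_le (e.val I σ) (f.val I σ))
    simp only [NExp.val, NExp.len]; nlinarith
  | mul e f he hf =>
    have := Nat.size_mul_le (e.val I σ) (f.val I σ)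
    simp only [NExp.val, NExp.len]; nlinarith

theorem one_add_size_le (h : Bits I S σ) (e : NExp) :
    1 + (e.val I σ).size ≤ (1 + e.len) * S := by
  have h1 := h.one_le
  have := h.size_val_le e
  nlinarith

theorem prod_size_le (h : Bits I S σ) (e f : NExp) :
    (1 + (e.val I σ).size) * (1 + (f.val I σ).size) ≤ (1 + e.len) * (1 + f.len) * S ^ 2 := by
  calc _ ≤ ((1 + e.len) * S) * ((1 + f.len) * S) :=
        Nat.mul_le_mul (h.one_add_size_le e) (h.one_add_size_le f)
    _ = _ := by ring

theorem size_le_sq (h : Bits I S σ) (e : NExp) : (e.val I σ).size ≤ e.len * S ^ 2 := by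
  have h1 := h.one_le
  refine (h.size_val_le e).trans (Nat.mul_le_mul_left _ ?_)
  nlinarith

theorem one_le_sq (h : Bits I S σ) : 1 ≤ S ^ 2 := Nat.one_le_pow _ _ h.one_le

theorem nexp_cost_le (h : Bits I S σ) (e : NExp) : e.cost I σ ≤ e.wt * S ^ 2 := by
  have h1 := h.one_le
  have h2 := h.one_le_sq
  have hS : S ≤ S ^ 2 := by nlinarith
  induction e with
  | const k => simp only [NExp.cost, NExp.wt]; nlinarith
  | card => have := h.card; simp only [NExp.cost, NExp.wt]; linarith
  | dim => have := h.dim; simp only [NExp.cost, NExp.wt]; linarith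
  | cell a ha =>
    have := h.size_le_sq a
    have := h.cell (a.val I σ)
    simp only [NExp.cost, NExp.wt]; linarith
  | add e f he hf =>
    have := h.prod_size_le e f
    simp only [NExp.cost, NExp.wt]; nlinarith
  | sub e f he hf =>
    have := h.prod_size_le e f
    simp only [NExp.cost, NExp.wt]; nlinarith
  | mul e f he hf =>
    have := h.prod_size_le e f
    simp only [NExp.cost, NExp.wt]; nlinarith

theorem rexp_cost_le (h : Bits I S σ) (e : RExp) : e.cost I σ ≤ e.wt * S ^ 2 := by
  have h2 := h.one_le_sq
  induction e with
  | ofNat e =>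
    have := h.size_le_sq e
    have := h.nexp_cost_le e
    simp only [RExp.cost, RExp.wt]; linarith
  | cell e =>
    have := h.size_le_sq e
    have := h.nexp_cost_le e
    simp only [RExp.cost, RExp.wt]; linarith
  | action i j =>
    have := h.size_le_sq i
    have := h.nexp_cost_le i
    have := h.size_le_sq j
    have := h.nexp_cost_le j
    simp only [RExp.cost, RExp.wt]; linarith
  | theta e =>
    have := h.size_le_sq e
    have := h.nexp_cost_le e
    simp only [RExp.cost, RExp.wt]; linarith
  | gamma => simp only [RExp.cost, RExp.wt]; linarith
  | add e f he hf => simp only [RExp.cost, RExp.wt]; linarith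
  | sub e f he hf => simp only [RExp.cost, RExp.wt]; linarith
  | mul e f he hf => simp only [RExp.cost, RExp.wt]; linarith
  | div e f he hf => simp only [RExp.cost, RExp.wt]; linarith
  | sqrt e he => simp only [RExp.cost, RExp.wt]; linarith

theorem test_cost_le (h : Bits I S σ) (b : Test) : b.cost I σ ≤ b.wt * S ^ 2 := by
  have h2 := h.one_le_sq
  induction b with
  | ltNat e f =>
    have := h.size_le_sq e
    have := h.nexp_cost_le e
    have := h.size_le_sq f
    have := h.nexp_cost_le f
    simp only [Test.cost, Test.wt]; linarith
  | ltReal e f =>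
    have := h.rexp_cost_le e
    have := h.rexp_cost_le f
    simp only [Test.cost, Test.wt]; linarith
  | not b hb => simp only [Test.cost, Test.wt]; linarith
  | and b c hb hc => simp only [Test.cost, Test.wt]; linarith

end Bits

/-! ### States within given limits -/

/-- Limits on the working memory: the bit length of the scalars, and the numbers of natural number
cells and of real cells. -/
structure Limits where
  bits : ℕ
  nats : ℕ
  reals : ℕ

/-- The limits are large enough for the input. -/
structure Limits.Fit (L : Limits) (I : BarrierInput d) : Prop where
  one_le : 1 ≤ L.bits
  card : I.A.card.size ≤ L.bits
  dim : d.size ≤ L.bits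
  nats : 10 ≤ L.nats

/-- A state within limits: the first ten natural number cells are scalars, the other ones hold
indices of actions. -/
structure Limits.Holds (L : Limits) (I : BarrierInput d) (σ : State) : Prop where
  scalar : ∀ a, a < 10 → (σ.nat a).size ≤ L.bits
  key : ∀ a, 10 ≤ a → σ.nat a ≤ I.A.card
  nat_eq_zero : ∀ a, L.nats ≤ a → σ.nat a = 0
  real_eq_zero : ∀ a, L.reals ≤ a → σ.real a = 0

/-- The memory taken by states within limits. -/
def Limits.memory (L : Limits) (I : BarrierInput d) : ℕ :=
  10 * (1 + L.bits) + L.nats * (1 + I.A.card.size) + L.reals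

variable {L : Limits}

theorem Limits.Holds.bits (hL : L.Fit I) {σ : State} (h : L.Holds I σ) : Bits I L.bits σ where
  one_le := hL.one_le
  card := hL.card
  dim := hL.dim
  cell a := by
    rcases lt_or_ge a 10 with ha | ha
    · exact h.scalar a ha
    · exact (Nat.size_le_size (h.key a ha)).trans hL.card

theorem Limits.Holds.memory_le {σ : State} (h : L.Holds I σ) : σ.memory ≤ L.memory I := by
  have h1 : σ.nat.support.sup Nat.succ ≤ L.nats := by
    refine Finset.sup_le fun a ha => ?_
    by_contra hc
    exact (Finsupp.mem_support_iff.mp ha) (h.nat_eq_zero a (by omega))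
  have h2 : σ.real.support.sup Nat.succ ≤ L.reals := by
    refine Finset.sup_le fun a ha => ?_
    by_contra hc
    exact (Finsupp.mem_support_iff.mp ha) (h.real_eq_zero a (by omega))
  unfold State.memory Limits.memory
  have h3 : ∑ a ∈ Finset.range (σ.nat.support.sup Nat.succ), (1 + (σ.nat a).size)
      ≤ ∑ a ∈ Finset.range L.nats, ((if a < 10 then 1 + L.bits else 0) + (1 + I.A.card.size)) := by
    refine (Finset.sum_le_sum_of_subset (Finset.range_mono h1)).trans ?_
    refine Finset.sum_le_sum fun a _ => ?_
    split_ifs with ha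
    · have := h.scalar a ha; omega
    · have := Nat.size_le_size (h.key a (by omega)); omega
  have h4 : ∑ a ∈ Finset.range L.nats, (if a < 10 then 1 + L.bits else 0) ≤ 10 * (1 + L.bits) := by
    rw [← Finset.sum_filter, Finset.sum_const, smul_eq_mul]
    refine Nat.mul_le_mul_right _ ?_
    calc _ ≤ (Finset.range 10).card := Finset.card_le_card fun a ha => by
          simp only [Finset.mem_filter, Finset.mem_range] at ha ⊢; exact ha.2
      _ = 10 := Finset.card_range 10
  have h5 : ∑ a ∈ Finset.range L.nats, ((if a < 10 then 1 + L.bits else 0) + (1 + I.A.card.size))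
      = (∑ a ∈ Finset.range L.nats, if a < 10 then 1 + L.bits else 0)
        + L.nats * (1 + I.A.card.size) := by
    rw [Finset.sum_add_distrib, Finset.sum_const, Finset.card_range, smul_eq_mul]
  rw [h5] at h3
  exact Nat.add_le_add (h3.trans (Nat.add_le_add_right h4 _)) h2

@[simp] theorem State.setNat_nat (σ : State) (a e : NExp) (x : ℕ) :
    (σ.setNat I a e).nat x = if x = a.val I σ then e.val I σ else σ.nat x := by
  simp [State.setNat, Finsupp.update, Function.update_apply]

@[simp] theorem State.setNat_real (σ : State) (a e : NExp) :
    (σ.setNat I a e).real = σ.real := rfl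

@[simp] theorem State.setReal_nat (σ : State) (a : NExp) (e : RExp) :
    (σ.setReal I a e).nat = σ.nat := rfl

@[simp] theorem State.setReal_real (σ : State) (a : NExp) (e : RExp) (x : ℕ) :
    (σ.setReal I a e).real x = if x = a.val I σ then e.val I σ else σ.real x := by
  simp [State.setReal, Finsupp.update, Function.update_apply]

/-! ### Total correctness with time and memory bounds -/

/-- From the state `σ`, if it is within the limits, `P` halts within the limits in a state with
property `φ`, after time at most `N * P.wt * L.bits ^ 2`. -/
def Run (L : Limits) (I : BarrierInput d) (P : Prog) (σ : State) (N : ℕ) (φ : State → Prop) :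
    Prop :=
  L.Holds I σ → ∃ σ' t m, Exec I P σ σ' t m ∧ t ≤ N * P.wt * L.bits ^ 2 ∧ m ≤ L.memory I ∧
    L.Holds I σ' ∧ φ σ'

namespace Run

variable {P Q : Prog} {σ : State} {N : ℕ} {φ ψ : State → Prop}

theorem mono (h : Run L I P σ N φ) {N' : ℕ} (hN : N ≤ N') (hφ : ∀ σ, φ σ → ψ σ) :
    Run L I P σ N' ψ := by
  intro hσ
  obtain ⟨σ', t, m, h1, h2, h3, h4, h5⟩ := h hσ
  exact ⟨σ', t, m, h1, h2.trans (by gcongr), h3, h4, hφ _ h5⟩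

theorem skip (hL : L.Fit I) (hN : 1 ≤ N) (h : φ σ) : Run L I .skip σ N φ := by
  intro hσ
  refine ⟨σ, _, _, Exec.skip σ, ?_, hσ.memory_le, hσ, h⟩
  have := (hσ.bits hL).one_le_sq
  simp only [Prog.wt]
  nlinarith

theorem setNat (hL : L.Fit I) (hN : 1 ≤ N) {a e : NExp}
    (ha : a.val I σ < 10 ∧ (e.val I σ).size ≤ L.bits ∨
      10 ≤ a.val I σ ∧ a.val I σ < L.nats ∧ e.val I σ ≤ I.A.card)
    (h : φ (σ.setNat I a e)) : Run L I (.setNat a e) σ N φ := by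
  intro hσ
  have hn := hL.nats
  have h' : L.Holds I (σ.setNat I a e) := by
    refine ⟨fun x hx => ?_, fun x hx => ?_, fun x hx => ?_, hσ.real_eq_zero⟩
    · rw [State.setNat_nat]
      split_ifs with hxa
      · rcases ha with ha | ha
        · exact ha.2
        · omega
      · exact hσ.scalar x hx
    · rw [State.setNat_nat]
      split_ifs with hxa
      · rcases ha with ha | ha
        · omega
        · exact ha.2.2
      · exact hσ.key x hx
    · rw [State.setNat_nat]
      split_ifs with hxa
      · omega
      · exact hσ.nat_eq_zero x hx
  refine ⟨_, _, _, Exec.setNat a e σ, ?_, max_le hσ.memory_le h'.memory_le, h', h⟩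
  have hb := hσ.bits hL
  have h1 := hb.nexp_cost_le a
  have h2 := hb.nexp_cost_le e
  have h3 := hb.size_le_sq a
  have h4 := hb.size_le_sq e
  have h5 := hb.one_le_sq
  calc _ ≤ 1 * Prog.wt (.setNat a e) * L.bits ^ 2 := by simp only [Prog.wt]; linarith
    _ ≤ _ := by gcongr

theorem setReal (hL : L.Fit I) (hN : 1 ≤ N) {a : NExp} {e : RExp} (ha : a.val I σ < L.reals)
    (h : φ (σ.setReal I a e)) : Run L I (.setReal a e) σ N φ := by
  intro hσ
  have h' : L.Holds I (σ.setReal I a e) := by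
    refine ⟨hσ.scalar, hσ.key, hσ.nat_eq_zero, fun x hx => ?_⟩
    rw [State.setReal_real, if_neg (by omega)]
    exact hσ.real_eq_zero x hx
  refine ⟨_, _, _, Exec.setReal a e σ, ?_, max_le hσ.memory_le h'.memory_le, h', h⟩
  have hb := hσ.bits hL
  have h1 := hb.nexp_cost_le a
  have h2 := hb.rexp_cost_le e
  have h3 := hb.size_le_sq a
  have h5 := hb.one_le_sq
  calc _ ≤ 1 * Prog.wt (.setReal a e) * L.bits ^ 2 := by simp only [Prog.wt]; linarith
    _ ≤ _ := by gcongr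

theorem seq (h : Run L I P σ N fun σ' => Run L I Q σ' N φ) : Run L I (.seq P Q) σ N φ := by
  intro hσ
  obtain ⟨σ', t, m, h1, h2, h3, h4, h5⟩ := h hσ
  obtain ⟨σ'', t', m', g1, g2, g3, g4, g5⟩ := h5 h4
  refine ⟨σ'', _, _, h1.seq g1, ?_, max_le h3 g3, g4, g5⟩
  calc _ ≤ _ := Nat.add_le_add h2 g2
    _ = _ := by simp only [Prog.wt]; ring

theorem ite (hL : L.Fit I) (hN : 1 ≤ N) {b : Test} (h₁ : b.holds I σ → Run L I P σ N φ)
    (h₂ : ¬ b.holds I σ → Run L I Q σ N φ) : Run L I (.ite b P Q) σ N φ := by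
  intro hσ
  have hb := (hσ.bits hL).test_cost_le b
  have hb' : b.cost I σ ≤ N * b.wt * L.bits ^ 2 :=
    hb.trans (Nat.mul_le_mul_right _ (Nat.le_mul_of_pos_left _ hN))
  by_cases hbt : b.holds I σ
  · obtain ⟨σ', t, m, g1, g2, g3, g4, g5⟩ := h₁ hbt hσ
    refine ⟨σ', _, _, Exec.iteTrue hbt g1, ?_, g3, g4, g5⟩
    simp only [Prog.wt]
    nlinarith [Nat.zero_le (N * Q.wt * L.bits ^ 2)]
  · obtain ⟨σ', t, m, g1, g2, g3, g4, g5⟩ := h₂ hbt hσ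
    refine ⟨σ', _, _, Exec.iteFalse hbt g1, ?_, g3, g4, g5⟩
    simp only [Prog.wt]
    nlinarith [Nat.zero_le (N * P.wt * L.bits ^ 2)]

theorem loop (hL : L.Fit I) (hN : 1 ≤ N) {b : Test} (Inv : ℕ → State → Prop) (K : ℕ)
    (h0 : Inv 0 σ)
    (hstep : ∀ k σ, L.Holds I σ → Inv k σ → b.holds I σ → k < K ∧ Run L I P σ N (Inv (k + 1)))
    (hexit : ∀ k σ, Inv k σ → ¬ b.holds I σ → φ σ) :
    Run L I (.loop b P) σ (N * (K + 1)) φ := by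
  have key : ∀ n k σ, k + n = K → L.Holds I σ → Inv k σ → ∃ σ' t m, Exec I (.loop b P) σ σ' t m ∧
      t ≤ n * (N * (b.wt + P.wt) * L.bits ^ 2) + b.wt * L.bits ^ 2 ∧ m ≤ L.memory I ∧
      L.Holds I σ' ∧ φ σ' := by
    intro n
    induction n with
    | zero =>
      intro k σ hk hσ hInv
      by_cases hbt : b.holds I σ
      · have := (hstep k σ hσ hInv hbt).1; omega
      · refine ⟨σ, _, _, Exec.loopFalse hbt, ?_, hσ.memory_le, hσ, hexit k σ hInv hbt⟩
        have := (hσ.bits hL).test_cost_le b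
        omega
    | succ n ih =>
      intro k σ hk hσ hInv
      have hb := (hσ.bits hL).test_cost_le b
      by_cases hbt : b.holds I σ
      · obtain ⟨σ', t, m, g1, g2, g3, g4, g5⟩ := (hstep k σ hσ hInv hbt).2 hσ
        obtain ⟨σ'', t', m', f1, f2, f3, f4, f5⟩ := ih (k + 1) σ' (by omega) g4 g5
        refine ⟨σ'', _, _, Exec.loopTrue hbt g1 f1, ?_, max_le g3 f3, f4, f5⟩
        have : b.wt * L.bits ^ 2 ≤ N * b.wt * L.bits ^ 2 :=
          Nat.mul_le_mul_right _ (Nat.le_mul_of_pos_left _ hN)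
        have e : (n + 1) * (N * (b.wt + P.wt) * L.bits ^ 2)
          = n * (N * (b.wt + P.wt) * L.bits ^ 2) + N * b.wt * L.bits ^ 2
            + N * P.wt * L.bits ^ 2 := by ring
        omega
      · refine ⟨σ, _, _, Exec.loopFalse hbt, ?_, hσ.memory_le, hσ, hexit k σ hInv hbt⟩
        omega
  intro hσ
  obtain ⟨σ', t, m, g1, g2, g3⟩ := key K 0 σ (by omega) hσ h0
  refine ⟨σ', t, m, g1, g2.trans ?_, g3⟩
  simp only [Prog.wt]
  have : b.wt * L.bits ^ 2 ≤ N * (b.wt + P.wt) * L.bits ^ 2 := by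
    refine Nat.mul_le_mul_right _ ?_
    nlinarith [Nat.zero_le P.wt, Nat.zero_le b.wt]
  calc _ ≤ K * (N * (b.wt + P.wt) * L.bits ^ 2) + N * (b.wt + P.wt) * L.bits ^ 2 := by omega
    _ = _ := by ring

end Run

/-- The loop that runs `P` with the natural number cell `c` from `0` to `e - 1`. -/
def Prog.forTo (c : ℕ) (e : NExp) (P : Prog) : Prog :=
  .seq (.setNat (.const c) (.const 0))
    (.loop (.ltNat (.cell (.const c)) e)
      (.seq P (.setNat (.const c) (.add (.cell (.const c)) (.const 1)))))

/-- Overwriting a natural number cell. -/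
noncomputable def State.put (σ : State) (c v : ℕ) : State := { σ with nat := σ.nat.update c v }

@[simp] theorem State.put_nat (σ : State) (c v x : ℕ) :
    (σ.put c v).nat x = if x = c then v else σ.nat x := by
  simp [State.put, Finsupp.update, Function.update_apply]

@[simp] theorem State.put_real (σ : State) (c v : ℕ) : (σ.put c v).real = σ.real := rfl

theorem Run.forTo (hL : L.Fit I) {c : ℕ} (hc : c < 10) {e : NExp} {P : Prog} {σ : State} {N : ℕ}
    (hN : 1 ≤ N) {φ : State → Prop} (K : ℕ) (hK : K.size ≤ L.bits) (Inv : ℕ → State → Prop)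
    (he : ∀ k σ, Inv k σ → e.val I σ = K) (h0 : Inv 0 (σ.put c 0))
    (hstep : ∀ k σ, k < K → σ.nat c = k → Inv k σ →
      Run L I P σ N fun σ' => σ'.nat c = k ∧ Inv (k + 1) (σ'.put c (k + 1)))
    (hexit : ∀ σ, σ.nat c = K → Inv K σ → φ σ) :
    Run L I (.forTo c e P) σ (N * (K + 1)) φ := by
  have hN' : 1 ≤ N * (K + 1) := Nat.mul_pos hN K.succ_pos
  refine Run.seq (Run.setNat hL hN' (Or.inl ⟨hc, by simp [NExp.val]⟩) ?_)
  refine Run.loop hL hN (fun k σ => k ≤ K ∧ σ.nat c = k ∧ Inv k σ) K ⟨Nat.zero_le _, ?_, h0⟩ ?_ ?_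
  · simp [NExp.val]
  · rintro k σ - ⟨hk, hck, hI⟩ hb
    simp only [Test.holds, NExp.val, hck, he k σ hI] at hb
    refine ⟨hb, Run.seq ((hstep k σ hb hck hI).mono le_rfl ?_)⟩
    rintro σ' ⟨h1, h2⟩
    refine Run.setNat hL hN (Or.inl ⟨hc, ?_⟩) ⟨hb, ?_, ?_⟩
    · simp only [NExp.val, h1]
      exact (Nat.size_le_size (show k + 1 ≤ K from hb)).trans hK
    · simp [NExp.val, h1]
    · have : σ'.setNat I (.const c) (.add (.cell (.const c)) (.const 1)) = σ'.put c (k + 1) := by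
        simp [State.setNat, State.put, NExp.val, h1]
      rw [this]; exact h2
  · rintro k σ ⟨hk, hck, hI⟩ hb
    simp only [Test.holds, NExp.val, hck, he k σ hI, not_lt] at hb
    obtain rfl : k = K := le_antisymm hk hb
    exact hexit σ hck hI

end RAM

namespace RAM

variable {d : ℕ} {I : BarrierInput d} {L : Limits}

/-! ### Memory layout -/

/-- The address of the entry `j` of the row `r` of the array area.  Row `0` holds the mean, rows
`1` and `2` two auxiliary vectors, the rows from `3` a projection and the rows from `3 + d` a
pseudo-inverse. -/
def addr (d r j : ℕ) : ℕ := 12 + (d * r + j)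

/-- The end of the array area, where the list of weights starts. -/
def base (d : ℕ) : ℕ := 12 + d * (3 + 2 * d)

theorem addr_lt {r j : ℕ} (hr : r < 3 + 2 * d) (hj : j < d) : addr d r j < base d := by
  have : d * (r + 1) ≤ d * (3 + 2 * d) := Nat.mul_le_mul_left _ hr
  rw [mul_add] at this
  unfold addr base
  omega

theorem addr_inj {r j r' j' : ℕ} (hj : j < d) (hj' : j' < d) :
    addr d r j = addr d r' j' ↔ r = r' ∧ j = j' := by
  constructor
  · intro h
    unfold addr at h
    have h1 : d * r + j = d * r' + j' := by omega
    have h2 := congrArg (· / d) h1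
    have h3 := congrArg (· % d) h1
    have hd : 0 < d := by omega
    simp only [Nat.mul_add_div hd, Nat.div_eq_of_lt hj, Nat.div_eq_of_lt hj', add_zero] at h2
    simp only [Nat.mul_add_mod, Nat.mod_eq_of_lt hj, Nat.mod_eq_of_lt hj'] at h3
    exact ⟨h2, h3⟩
  · rintro ⟨rfl, rfl⟩; rfl

theorem le_addr (d r j : ℕ) : 12 ≤ addr d r j := Nat.le_add_right _ _

/-- The limits leave room for a list of length `M`. -/
structure Limits.Room (L : Limits) (I : BarrierInput d) (M : ℕ) : Prop where
  fit : L.Fit I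
  nats : L.nats = base d + M + 2
  reals : L.reals = base d + M + 1
  size_nats : L.nats.size ≤ L.bits

theorem Limits.Room.size_le {M : ℕ} (h : L.Room I M) {x : ℕ} (hx : x ≤ base d + M + 2) :
    x.size ≤ L.bits :=
  (Nat.size_le_size (hx.trans_eq h.nats.symm)).trans h.size_nats

theorem le_base (d : ℕ) : d ≤ base d := by unfold base; nlinarith

/-- The coordinate `j` of the action `a`. -/
noncomputable def actN (I : BarrierInput d) (a j : ℕ) : ℝ :=
  if hi : a < I.A.card then if hj : j < d then I.A.action ⟨a, hi⟩ ⟨j, hj⟩ else 0 else 0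

/-- The coordinate `j` of the loss parameter. -/
noncomputable def thetaN (I : BarrierInput d) (j : ℕ) : ℝ := if hj : j < d then I.θ ⟨j, hj⟩ else 0

/-- The coordinate `j` of the deviation of the action `a` from the mean. -/
noncomputable def devN (I : BarrierInput d) (σ : State) (a j : ℕ) : ℝ :=
  actN I a j - σ.real (addr d 0 j)

/-- The entry `(i, j)` of the projection. -/
noncomputable def projN (d : ℕ) (σ : State) (i j : ℕ) : ℝ := σ.real (addr d (3 + i) j)

/-- The entry `(i, j)` of the pseudo-inverse. -/
noncomputable def pinvN (d : ℕ) (σ : State) (i j : ℕ) : ℝ := σ.real (addr d (3 + (d + i)) j)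

namespace NExp

abbrev nat (n : ℕ) : NExp := .cell (.const n)

/-- The address of an array entry. -/
def entry (r j : NExp) : NExp := .add (.const 12) (.add (.mul .dim r) j)

@[simp] theorem entry_val (σ : State) (r j : NExp) :
    (entry r j).val I σ = addr d (r.val I σ) (j.val I σ) := rfl

@[simp] theorem const_val (σ : State) (n : ℕ) : (const n).val I σ = n := rfl
@[simp] theorem card_val (σ : State) : NExp.card.val I σ = I.A.card := rfl
@[simp] theorem dim_val (σ : State) : NExp.dim.val I σ = d := rfl
@[simp] theorem cell_val (σ : State) (a : NExp) : (cell a).val I σ = σ.nat (a.val I σ) := rfl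
@[simp] theorem add_val (σ : State) (e f : NExp) :
    (add e f).val I σ = e.val I σ + f.val I σ := rfl
@[simp] theorem mul_val (σ : State) (e f : NExp) :
    (mul e f).val I σ = e.val I σ * f.val I σ := rfl

end NExp

namespace RExp

abbrev real (n : ℕ) : RExp := .cell (.const n)

abbrev arr (r j : NExp) : RExp := .cell (.entry r j)

/-- The coordinate `j` of the deviation of the action `a` from the mean. -/
def dev (a j : NExp) : RExp := .sub (.action a j) (.arr (.const 0) j)

/-- The entry `(i, j)` of the projection. -/
def proj (i j : NExp) : RExp := .arr (.add (.const 3) i) j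

/-- The entry `(i, j)` of the pseudo-inverse. -/
def pinv (i j : NExp) : RExp := .arr (.add (.const 3) (.add .dim i)) j

@[simp] theorem dev_val (σ : State) (a j : NExp) :
    (dev a j).val I σ = devN I σ (a.val I σ) (j.val I σ) := rfl
@[simp] theorem proj_val (σ : State) (i j : NExp) :
    (proj i j).val I σ = projN d σ (i.val I σ) (j.val I σ) := rfl
@[simp] theorem pinv_val (σ : State) (i j : NExp) :
    (pinv i j).val I σ = pinvN d σ (i.val I σ) (j.val I σ) := rfl
@[simp] theorem ofNat_val (σ : State) (e : NExp) : (ofNat e).val I σ = (e.val I σ : ℝ) := rfl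
@[simp] theorem cell_val (σ : State) (a : NExp) : (cell a).val I σ = σ.real (a.val I σ) := rfl
@[simp] theorem action_val (σ : State) (i j : NExp) :
    (action i j).val I σ = actN I (i.val I σ) (j.val I σ) := rfl
@[simp] theorem theta_val (σ : State) (j : NExp) :
    (theta j).val I σ = thetaN I (j.val I σ) := rfl
@[simp] theorem gamma_val (σ : State) : gamma.val I σ = I.γ := rfl
@[simp] theorem add_val (σ : State) (e f : RExp) :
    (add e f).val I σ = e.val I σ + f.val I σ := rfl
@[simp] theorem sub_val (σ : State) (e f : RExp) :
    (sub e f).val I σ = e.val I σ - f.val I σ := rfl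
@[simp] theorem mul_val (σ : State) (e f : RExp) :
    (mul e f).val I σ = e.val I σ * f.val I σ := rfl
@[simp] theorem div_val (σ : State) (e f : RExp) :
    (div e f).val I σ = e.val I σ / f.val I σ := rfl

end RExp

/-- The arrays of two states agree. -/
structure SameArrays (d : ℕ) (σ σ' : State) : Prop where
  real : ∀ x, 12 ≤ x → σ'.real x = σ.real x

theorem SameArrays.dev {σ σ' : State} (h : SameArrays d σ σ') (a j : ℕ) :
    devN I σ' a j = devN I σ a j := by
  rw [devN, h.real _ (le_addr _ _ _), devN]

theorem SameArrays.proj {σ σ' : State} (h : SameArrays d σ σ') (i j : ℕ) :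
    projN d σ' i j = projN d σ i j := h.real _ (le_addr _ _ _)

theorem SameArrays.pinv {σ σ' : State} (h : SameArrays d σ σ') (i j : ℕ) :
    pinvN d σ' i j = pinvN d σ i j := h.real _ (le_addr _ _ _)

open NExp RExp Prog

/-! ### Evaluating the score of all actions -/

/-- Adds the terms of row `nat 2` of the two quadratic forms. -/
def formRow : Prog :=
  forTo 3 dim
    (.seq (.setReal (.const 0) (.add (.real 0)
        (.mul (.pinv (.nat 2) (.nat 3)) (.mul (.dev (.nat 1) (.nat 2)) (.dev (.nat 1) (.nat 3))))))
      (.setReal (.const 1) (.add (.real 1)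
        (.mul (.proj (.nat 2) (.nat 3)) (.mul (.dev (.nat 1) (.nat 2)) (.dev (.nat 1) (.nat 3)))))))

theorem formRow_run {M : ℕ} (hL : L.Room I M) {σ : State} {φ : State → Prop}
    (h : ∀ σ', (∀ x, x ≠ 3 → σ'.nat x = σ.nat x) → (∀ x, 2 ≤ x → σ'.real x = σ.real x) →
      σ'.real 0 = σ.real 0 + ∑ j ∈ Finset.range d, pinvN d σ (σ.nat 2) j *
        (devN I σ (σ.nat 1) (σ.nat 2) * devN I σ (σ.nat 1) j) →
      σ'.real 1 = σ.real 1 + ∑ j ∈ Finset.range d, projN d σ (σ.nat 2) j *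
        (devN I σ (σ.nat 1) (σ.nat 2) * devN I σ (σ.nat 1) j) → φ σ') :
    Run L I formRow σ (d + 1) φ := by
  have hreal : 12 < L.reals := by rw [hL.reals]; unfold base; omega
  rw [← one_mul (d + 1)]
  refine Run.forTo hL.fit (by norm_num) le_rfl d hL.fit.dim
    (fun k σ' => (∀ x, x ≠ 3 → σ'.nat x = σ.nat x) ∧ (∀ x, 2 ≤ x → σ'.real x = σ.real x) ∧
      σ'.real 0 = σ.real 0 + ∑ j ∈ Finset.range k, pinvN d σ (σ.nat 2) j *
        (devN I σ (σ.nat 1) (σ.nat 2) * devN I σ (σ.nat 1) j) ∧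
      σ'.real 1 = σ.real 1 + ∑ j ∈ Finset.range k, projN d σ (σ.nat 2) j *
        (devN I σ (σ.nat 1) (σ.nat 2) * devN I σ (σ.nat 1) j))
    (fun k σ' _ => rfl) ?_ ?_ ?_
  · refine ⟨fun x hx => by simp [hx], fun x _ => rfl, by simp, by simp⟩
  · rintro k σ' hk h3 ⟨i1, i2, i3, i4⟩
    have hs : SameArrays d σ σ' := ⟨fun x hx => i2 x (by omega)⟩
    refine Run.seq (Run.setReal hL.fit le_rfl (by simp; omega) ?_)
    refine Run.setReal hL.fit le_rfl (by simp; omega) ?_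
    have hs1 : SameArrays d σ (σ'.setReal I (.const 0) (.add (.real 0)
        (.mul (.pinv (.nat 2) (.nat 3)) (.mul (.dev (.nat 1) (.nat 2)) (.dev (.nat 1) (.nat 3)))))) :=
      ⟨fun x hx => by rw [State.setReal_real, if_neg (by simp; omega), hs.real x hx]⟩
    refine ⟨by simpa using h3, fun x hx => ?_, fun x hx => ?_, ?_, ?_⟩
    · simpa [hx] using i1 x hx
    · rw [State.put_real, State.setReal_real, if_neg (by simp; omega), State.setReal_real,
        if_neg (by simp; omega), i2 x hx]
    · rw [State.put_real, State.setReal_real, if_neg (by simp), State.setReal_real]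
      simp [i3, h3, hs.dev, hs.pinv, i1, Finset.sum_range_succ, add_assoc]
    · rw [State.put_real, State.setReal_real, if_pos (by simp)]
      simp [i4, h3, hs1.dev, hs1.proj, i1, Finset.sum_range_succ, add_assoc]
  · rintro σ' - ⟨i1, i2, i3, i4⟩
    exact h σ' i1 i2 i3 i4

end RAM

namespace RAM

variable {d : ℕ} {I : BarrierInput d} {L : Limits}

open NExp RExp Prog

/-- The form of the projection at the deviation of the action `a`. -/
noncomputable def projForm (I : BarrierInput d) (σ : State) (a : ℕ) : ℝ :=
  ∑ i ∈ Finset.range d, ∑ j ∈ Finset.range d, projN d σ i j * (devN I σ a i * devN I σ a j)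

/-- The form of the pseudo-inverse at the deviation of the action `a`, minus the scaled excess
loss of this action. -/
noncomputable def pinvForm (I : BarrierInput d) (σ : State) (a : ℕ) : ℝ :=
  ∑ i ∈ Finset.range d, (-(I.γ * (devN I σ a i * thetaN I i)) +
    ∑ j ∈ Finset.range d, pinvN d σ i j * (devN I σ a i * devN I σ a j))

theorem SameArrays.projForm {σ σ' : State} (h : SameArrays d σ σ') (a : ℕ) :
    RAM.projForm I σ' a = RAM.projForm I σ a := by
  simp only [RAM.projForm, h.dev, h.proj]

theorem SameArrays.pinvForm {σ σ' : State} (h : SameArrays d σ σ') (a : ℕ) :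
    RAM.pinvForm I σ' a = RAM.pinvForm I σ a := by
  simp only [RAM.pinvForm, h.dev, h.pinv]

/-- Computes the two scores of the action `nat 1`. -/
def score : Prog :=
  .seq (.setReal (.const 0) (.ofNat (.const 0))) (.seq (.setReal (.const 1) (.ofNat (.const 0)))
    (forTo 2 dim
      (.seq (.setReal (.const 0) (.sub (.real 0)
        (.mul .gamma (.mul (.dev (.nat 1) (.nat 2)) (.theta (.nat 2)))))) formRow)))

theorem Limits.Room.reals_gt {M : ℕ} (hL : L.Room I M) : 12 < L.reals := by
  rw [hL.reals]; unfold base; omega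

theorem score_run {M : ℕ} (hL : L.Room I M) {σ : State} {φ : State → Prop}
    (h : ∀ σ', (∀ x, x ≠ 2 → x ≠ 3 → σ'.nat x = σ.nat x) →
      (∀ x, 2 ≤ x → σ'.real x = σ.real x) → σ'.real 0 = pinvForm I σ (σ.nat 1) →
      σ'.real 1 = projForm I σ (σ.nat 1) → φ σ') :
    Run L I score σ ((d + 1) * (d + 1)) φ := by
  have hreal := hL.reals_gt
  have hN : 1 ≤ (d + 1) * (d + 1) := Nat.mul_pos d.succ_pos d.succ_pos
  refine Run.seq (Run.setReal hL.fit hN (by simp; omega) ?_)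
  refine Run.seq (Run.setReal hL.fit hN (by simp; omega) ?_)
  refine Run.forTo hL.fit (by norm_num) (by omega) d hL.fit.dim
    (fun k σ' => (∀ x, x ≠ 2 → x ≠ 3 → σ'.nat x = σ.nat x) ∧
      (∀ x, 2 ≤ x → σ'.real x = σ.real x) ∧
      σ'.real 0 = ∑ i ∈ Finset.range k, (-(I.γ * (devN I σ (σ.nat 1) i * thetaN I i)) +
        ∑ j ∈ Finset.range d, pinvN d σ i j * (devN I σ (σ.nat 1) i * devN I σ (σ.nat 1) j)) ∧
      σ'.real 1 = ∑ i ∈ Finset.range k, ∑ j ∈ Finset.range d,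
        projN d σ i j * (devN I σ (σ.nat 1) i * devN I σ (σ.nat 1) j))
    (fun k σ' _ => rfl) ?_ ?_ ?_
  · refine ⟨fun x hx _ => by simp [hx], fun x hx => ?_, by simp, by simp⟩
    rw [State.put_real, State.setReal_real, if_neg (by simp; omega), State.setReal_real,
      if_neg (by simp; omega)]
  · rintro k σ' hk h2 ⟨i1, i2, i3, i4⟩
    have hs : SameArrays d σ σ' := ⟨fun x hx => i2 x (by omega)⟩
    refine Run.seq (Run.setReal hL.fit (by omega) (by simp; omega) ?_)
    have hs1 : SameArrays d σ (σ'.setReal I (.const 0) (.sub (.real 0)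
        (.mul .gamma (.mul (.dev (.nat 1) (.nat 2)) (.theta (.nat 2)))))) :=
      ⟨fun x hx => by rw [State.setReal_real, if_neg (by simp; omega), hs.real x hx]⟩
    refine formRow_run hL fun σ'' j1 j2 j3 j4 => ?_
    refine ⟨by simp [j1, h2], fun x hx hx' => ?_, fun x hx => ?_, ?_, ?_⟩
    · simp [hx, j1 x hx', i1 x hx hx']
    · rw [State.put_real, j2 x hx, State.setReal_real, if_neg (by simp; omega), i2 x hx]
    · rw [State.put_real, j3, State.setReal_real, if_pos (by simp)]
      simp [i3, h2, hs.dev, hs1.dev, hs1.pinv, i1, Finset.sum_range_succ]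
      ring
    · rw [State.put_real, j4, State.setReal_real, if_neg (by simp)]
      simp [i4, h2, hs1.dev, hs1.proj, i1, Finset.sum_range_succ]
  · rintro σ' - ⟨i1, i2, i3, i4⟩
    exact h σ' i1 i2 i3 i4

/-- Keeps in `real t` and `nat b` the largest value of `real s` and the index of its action. -/
def keepMax (t b s : ℕ) : Prog :=
  .ite (.and (.ltNat (.const 0) (.nat 1)) (.not (.ltReal (.real t) (.real s)))) .skip
    (.seq (.setReal (.const t) (.real s)) (.setNat (.const b) (.nat 1)))

theorem keepMax_run {M : ℕ} (hL : L.Room I M) {t b s : ℕ} (ht : t < 12) (hb : b < 10)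
    {N : ℕ} (hN : 1 ≤ N) {σ : State} {φ : State → Prop} {f : ℕ → ℝ}
    (ha : σ.nat 1 < I.A.card) (hs : σ.real s = f (σ.nat 1))
    (hI : 0 < σ.nat 1 → σ.nat b < σ.nat 1 ∧ σ.real t = f (σ.nat b) ∧
      ∀ a < σ.nat 1, f a ≤ σ.real t)
    (h : ∀ σ', (∀ x, x ≠ b → σ'.nat x = σ.nat x) → (∀ x, x ≠ t → σ'.real x = σ.real x) →
      (σ'.nat b < σ.nat 1 + 1 ∧ σ'.real t = f (σ'.nat b) ∧
        ∀ a < σ.nat 1 + 1, f a ≤ σ'.real t) → φ σ') :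
    Run L I (keepMax t b s) σ N φ := by
  have hreal := hL.reals_gt
  refine Run.ite hL.fit hN (fun hb => ?_) (fun hb' => ?_)
  · simp only [Test.holds, const_val, NExp.cell_val, RExp.cell_val, not_lt] at hb
    obtain ⟨g1, g2, g3⟩ := hI hb.1
    refine Run.skip hL.fit hN (h σ (fun _ _ => rfl) (fun _ _ => rfl) ⟨by omega, g2, ?_⟩)
    intro a ha
    rcases Nat.lt_succ_iff_lt_or_eq.mp ha with h' | rfl
    · exact g3 a h'
    · rw [← hs]; exact hb.2
  · simp only [Test.holds, const_val, NExp.cell_val, RExp.cell_val, not_and, not_not] at hb'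
    refine Run.seq (Run.setReal hL.fit hN (by simp; omega) ?_)
    refine Run.setNat hL.fit hN (Or.inl ⟨hb, ?_⟩) ?_
    · exact (Nat.size_le_size (by simpa using ha.le)).trans hL.fit.card
    · refine h _ (fun x hx => by simp [hx]) (fun x hx => by simp [hx]) ⟨by simp, by simp [hs], ?_⟩
      intro a ha
      simp only [State.setNat_real, State.setReal_real, const_val, if_true, RExp.cell_val]
      rcases Nat.lt_succ_iff_lt_or_eq.mp ha with h' | rfl
      · have h0 : 0 < σ.nat 1 := by omega
        exact ((hI h0).2.2 a h').trans (hb' h0).le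
      · rw [hs]

/-- Finds the actions with the largest scores. -/
def scan : Prog := forTo 1 card (.seq score (.seq (keepMax 3 4 1) (keepMax 2 5 0)))

theorem scan_run {M : ℕ} (hL : L.Room I M) {σ : State} {φ : State → Prop}
    (h : ∀ σ', (∀ x, x = 0 ∨ 6 ≤ x → σ'.nat x = σ.nat x) →
      (∀ x, 4 ≤ x → σ'.real x = σ.real x) →
      (σ'.nat 4 < I.A.card ∧ σ'.real 3 = projForm I σ (σ'.nat 4) ∧
        ∀ a < I.A.card, projForm I σ a ≤ σ'.real 3) →
      (σ'.nat 5 < I.A.card ∧ σ'.real 2 = pinvForm I σ (σ'.nat 5) ∧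
        ∀ a < I.A.card, pinvForm I σ a ≤ σ'.real 2) → φ σ') :
    Run L I scan σ ((d + 1) * (d + 1) * (I.A.card + 1)) φ := by
  have hN : 1 ≤ (d + 1) * (d + 1) := Nat.mul_pos d.succ_pos d.succ_pos
  refine Run.forTo hL.fit (by norm_num) hN I.A.card hL.fit.card
    (fun k σ' => (∀ x, x = 0 ∨ 6 ≤ x → σ'.nat x = σ.nat x) ∧
      (∀ x, 4 ≤ x → σ'.real x = σ.real x) ∧
      (0 < k → σ'.nat 4 < k ∧ σ'.real 3 = projForm I σ (σ'.nat 4) ∧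
        ∀ a < k, projForm I σ a ≤ σ'.real 3) ∧
      (0 < k → σ'.nat 5 < k ∧ σ'.real 2 = pinvForm I σ (σ'.nat 5) ∧
        ∀ a < k, pinvForm I σ a ≤ σ'.real 2))
    (fun k σ' _ => rfl) ?_ ?_ ?_
  · refine ⟨fun x hx => ?_, fun x _ => rfl, by simp, by simp⟩
    rw [State.put_nat, if_neg (by omega)]
  · rintro k σ' hk h1 ⟨i1, i2, i3, i4⟩
    have hs : SameArrays d σ σ' := ⟨fun x hx => i2 x (by omega)⟩
    refine Run.seq (score_run hL fun σ₁ a1 a2 a3 a4 => ?_)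
    rw [hs.pinvForm] at a3
    rw [hs.projForm] at a4
    have a1' : σ₁.nat 1 = k := by rw [a1 1 (by norm_num) (by norm_num), h1]
    refine Run.seq (keepMax_run hL (by norm_num) (by norm_num) hN (f := projForm I σ)
      (by rw [a1']; exact hk) (by rw [a4, a1', h1]) ?_ fun σ₂ b1 b2 b3 => ?_)
    · rw [a1', a1 4 (by norm_num) (by norm_num), a2 3 (by norm_num)]
      exact i3
    have b1' : σ₂.nat 1 = k := by rw [b1 1 (by norm_num), a1']
    refine keepMax_run hL (by norm_num) (by norm_num) hN (f := pinvForm I σ)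
      (by rw [b1']; exact hk) (by rw [b2 0 (by norm_num), a3, b1', h1]) ?_ fun σ₃ c1 c2 c3 => ?_
    · rw [b1', b1 5 (by norm_num), a1 5 (by norm_num) (by norm_num), b2 2 (by norm_num),
        a2 2 le_rfl]
      exact i4
    rw [a1'] at b3
    rw [b1'] at c3
    refine ⟨by rw [c1 1 (by norm_num), b1'], fun x hx => ?_, fun x hx => ?_, fun _ => ?_,
      fun _ => ?_⟩
    · rw [State.put_nat, if_neg (by omega), c1 x (by omega), b1 x (by omega),
        a1 x (by omega) (by omega), i1 x hx]
    · rw [State.put_real, c2 x (by omega), b2 x (by omega), a2 x (by omega), i2 x hx]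
    · rw [State.put_nat, if_neg (by norm_num), State.put_real, c1 4 (by norm_num),
        c2 3 (by norm_num)]
      exact b3
    · rw [State.put_nat, if_neg (by norm_num), State.put_real]
      exact c3
  · rintro σ' - ⟨i1, i2, i3, i4⟩
    exact h σ' i1 i2 (i3 I.A.card_pos) (i4 I.A.card_pos)

end RAM

namespace RAM

variable {d : ℕ} {I : BarrierInput d} {L : Limits}

open NExp RExp Prog

/-! ### Moving mass to an action -/

theorem addr_ne_of_row {r j r' j' : ℕ} (hj : j < d) (hj' : j' < d) (hr : r ≠ r') :
    addr d r j ≠ addr d r' j' := fun h => hr ((addr_inj hj hj').mp h).1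

/-- The coordinate `i` of the product of the pseudo-inverse and the deviation of the action `a`. -/
noncomputable def pinvDev (I : BarrierInput d) (σ : State) (a i : ℕ) : ℝ :=
  ∑ j ∈ Finset.range d, pinvN d σ i j * devN I σ a j

/-- The coordinate `i` of the product of the projection and the deviation of the action `a`. -/
noncomputable def projDev (I : BarrierInput d) (σ : State) (a i : ℕ) : ℝ :=
  ∑ j ∈ Finset.range d, projN d σ i j * devN I σ a j

/-- Adds the products of row `nat 2` of the two matrices with the deviation of `nat 8`. -/
def productRow : Prog :=
  forTo 3 dim
    (.seq (.setReal (.const 0) (.add (.real 0)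
        (.mul (.pinv (.nat 2) (.nat 3)) (.dev (.nat 8) (.nat 3)))))
      (.setReal (.const 1) (.add (.real 1)
        (.mul (.proj (.nat 2) (.nat 3)) (.dev (.nat 8) (.nat 3))))))

theorem productRow_run {M : ℕ} (hL : L.Room I M) {σ : State} {φ : State → Prop}
    (h : ∀ σ', (∀ x, x ≠ 3 → σ'.nat x = σ.nat x) → (∀ x, 2 ≤ x → σ'.real x = σ.real x) →
      σ'.real 0 = σ.real 0 + pinvDev I σ (σ.nat 8) (σ.nat 2) →
      σ'.real 1 = σ.real 1 + projDev I σ (σ.nat 8) (σ.nat 2) → φ σ') :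
    Run L I productRow σ (d + 1) φ := by
  have hreal := hL.reals_gt
  rw [← one_mul (d + 1)]
  refine Run.forTo hL.fit (by norm_num) le_rfl d hL.fit.dim
    (fun k σ' => (∀ x, x ≠ 3 → σ'.nat x = σ.nat x) ∧ (∀ x, 2 ≤ x → σ'.real x = σ.real x) ∧
      σ'.real 0 = σ.real 0 + ∑ j ∈ Finset.range k,
        pinvN d σ (σ.nat 2) j * devN I σ (σ.nat 8) j ∧
      σ'.real 1 = σ.real 1 + ∑ j ∈ Finset.range k,
        projN d σ (σ.nat 2) j * devN I σ (σ.nat 8) j)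
    (fun k σ' _ => rfl) ?_ ?_ ?_
  · refine ⟨fun x hx => by simp [hx], fun x _ => rfl, by simp, by simp⟩
  · rintro k σ' hk h3 ⟨i1, i2, i3, i4⟩
    have hs : SameArrays d σ σ' := ⟨fun x hx => i2 x (by omega)⟩
    refine Run.seq (Run.setReal hL.fit le_rfl (by simp; omega) ?_)
    refine Run.setReal hL.fit le_rfl (by simp; omega) ?_
    have hs1 : SameArrays d σ (σ'.setReal I (.const 0) (.add (.real 0)
        (.mul (.pinv (.nat 2) (.nat 3)) (.dev (.nat 8) (.nat 3))))) :=
      ⟨fun x hx => by rw [State.setReal_real, if_neg (by simp; omega), hs.real x hx]⟩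
    refine ⟨by simpa using h3, fun x hx => ?_, fun x hx => ?_, ?_, ?_⟩
    · simpa [hx] using i1 x hx
    · rw [State.put_real, State.setReal_real, if_neg (by simp; omega), State.setReal_real,
        if_neg (by simp; omega), i2 x hx]
    · rw [State.put_real, State.setReal_real, if_neg (by simp), State.setReal_real]
      simp [i3, h3, hs.dev, hs.pinv, i1, Finset.sum_range_succ, add_assoc]
    · rw [State.put_real, State.setReal_real, if_pos (by simp)]
      simp [i4, h3, hs1.dev, hs1.proj, i1, Finset.sum_range_succ, add_assoc]
  · rintro σ' - ⟨i1, i2, i3, i4⟩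
    exact h σ' i1 i2 i3 i4

/-- Stores the products in the rows `1` and `2` and the forms in `real 6` and `real 7`. -/
def products : Prog :=
  .seq (.setReal (.const 6) (.ofNat (.const 0))) (.seq (.setReal (.const 7) (.ofNat (.const 0)))
    (forTo 2 dim
      (.seq (.setReal (.const 0) (.ofNat (.const 0)))
      (.seq (.setReal (.const 1) (.ofNat (.const 0)))
      (.seq productRow
      (.seq (.setReal (.entry (.const 1) (.nat 2)) (.real 0))
      (.seq (.setReal (.entry (.const 2) (.nat 2)) (.real 1))
      (.seq (.setReal (.const 6) (.add (.real 6) (.mul (.dev (.nat 8) (.nat 2)) (.real 0))))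
        (.setReal (.const 7) (.add (.real 7) (.mul (.dev (.nat 8) (.nat 2)) (.real 1))))))))))))

/-- The rows other than `1` and `2` agree, and so do the lists. -/
structure SameMain (d : ℕ) (σ σ' : State) : Prop where
  row : ∀ r j, j < d → r ≠ 1 → r ≠ 2 → σ'.real (addr d r j) = σ.real (addr d r j)
  list : ∀ x, base d ≤ x → σ'.real x = σ.real x

theorem SameMain.dev {σ σ' : State} (h : SameMain d σ σ') (a : ℕ) {j : ℕ} (hj : j < d) :
    devN I σ' a j = devN I σ a j := by
  rw [devN, h.row 0 j hj (by norm_num) (by norm_num), devN]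

theorem SameMain.pinv {σ σ' : State} (h : SameMain d σ σ') (i : ℕ) {j : ℕ} (hj : j < d) :
    pinvN d σ' i j = pinvN d σ i j := h.row _ _ hj (by omega) (by omega)

theorem SameMain.proj {σ σ' : State} (h : SameMain d σ σ') (i : ℕ) {j : ℕ} (hj : j < d) :
    projN d σ' i j = projN d σ i j := h.row _ _ hj (by omega) (by omega)

theorem SameMain.pinvDev {σ σ' : State} (h : SameMain d σ σ') (a i : ℕ) :
    RAM.pinvDev I σ' a i = RAM.pinvDev I σ a i :=
  Finset.sum_congr rfl fun j hj => by
    rw [h.pinv i (Finset.mem_range.mp hj), h.dev a (Finset.mem_range.mp hj)]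

theorem SameMain.projDev {σ σ' : State} (h : SameMain d σ σ') (a i : ℕ) :
    RAM.projDev I σ' a i = RAM.projDev I σ a i :=
  Finset.sum_congr rfl fun j hj => by
    rw [h.proj i (Finset.mem_range.mp hj), h.dev a (Finset.mem_range.mp hj)]

theorem le_base' : 12 ≤ base d := Nat.le_add_right _ _

theorem Limits.Room.addr_lt {M : ℕ} (hL : L.Room I M) {r j : ℕ} (hr : r < 3 + 2 * d)
    (hj : j < d) : addr d r j < L.reals := by
  have := RAM.addr_lt hr hj
  rw [hL.reals]; omega

theorem products_run {M : ℕ} (hL : L.Room I M) {σ : State} {φ : State → Prop}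
    (h : ∀ σ', (∀ x, x ≠ 2 → x ≠ 3 → σ'.nat x = σ.nat x) →
      SameMain d σ σ' → (∀ x, 2 ≤ x → x < 12 → x ≠ 6 → x ≠ 7 → σ'.real x = σ.real x) →
      (∀ i < d, σ'.real (addr d 1 i) = pinvDev I σ (σ.nat 8) i) →
      (∀ i < d, σ'.real (addr d 2 i) = projDev I σ (σ.nat 8) i) →
      σ'.real 6 = ∑ i ∈ Finset.range d, devN I σ (σ.nat 8) i * pinvDev I σ (σ.nat 8) i →
      σ'.real 7 = ∑ i ∈ Finset.range d, devN I σ (σ.nat 8) i * projDev I σ (σ.nat 8) i → φ σ') :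
    Run L I products σ ((d + 1) * (d + 1)) φ := by
  have hreal := hL.reals_gt
  have hN : 1 ≤ (d + 1) * (d + 1) := Nat.mul_pos d.succ_pos d.succ_pos
  refine Run.seq (Run.setReal hL.fit hN (by simp; omega) ?_)
  refine Run.seq (Run.setReal hL.fit hN (by simp; omega) ?_)
  have hb := le_base' (d := d)
  refine Run.forTo hL.fit (by norm_num) (by omega) d hL.fit.dim
    (fun k σ' => (∀ x, x ≠ 2 → x ≠ 3 → σ'.nat x = σ.nat x) ∧
      SameMain d σ σ' ∧ (∀ x, 2 ≤ x → x < 12 → x ≠ 6 → x ≠ 7 → σ'.real x = σ.real x) ∧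
      (∀ i < d, i < k → σ'.real (addr d 1 i) = pinvDev I σ (σ.nat 8) i) ∧
      (∀ i < d, i < k → σ'.real (addr d 2 i) = projDev I σ (σ.nat 8) i) ∧
      σ'.real 6 = ∑ i ∈ Finset.range k, devN I σ (σ.nat 8) i * pinvDev I σ (σ.nat 8) i ∧
      σ'.real 7 = ∑ i ∈ Finset.range k, devN I σ (σ.nat 8) i * projDev I σ (σ.nat 8) i)
    (fun k σ' _ => rfl) ?_ ?_ ?_
  · have hfr : ∀ x, x ≠ 6 → x ≠ 7 → (((σ.setReal I (.const 6) (.ofNat (.const 0))).setReal I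
        (.const 7) (.ofNat (.const 0))).put 2 0).real x = σ.real x := by
      intro x h6 h7
      simp [h6, h7]
    refine ⟨fun x hx _ => by simp [hx], ⟨fun r j _ _ _ => hfr _ ?_ ?_, fun x hx => hfr x ?_ ?_⟩,
      fun x _ _ h6 h7 => hfr x h6 h7, by simp, by simp, by simp, by simp⟩
    · have := le_addr d r j; omega
    · have := le_addr d r j; omega
    · omega
    · omega
  · rintro k σ' hk h2 ⟨i1, i2, i3, i4, i5, i6, i7⟩
    refine Run.seq (Run.setReal hL.fit (by omega) (by simp; omega) ?_)
    refine Run.seq (Run.setReal hL.fit (by omega) (by simp; omega) ?_)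
    obtain ⟨σ₀, hσ₀⟩ : ∃ σ₀, σ₀ = (σ'.setReal I (.const 0) (.ofNat (.const 0))).setReal I
        (.const 1) (.ofNat (.const 0)) := ⟨_, rfl⟩
    rw [← hσ₀]
    have e0 : ∀ x, 2 ≤ x → σ₀.real x = σ'.real x := fun x hx => by
      rw [hσ₀, State.setReal_real, if_neg (by simp; omega), State.setReal_real,
        if_neg (by simp; omega)]
    have en : σ₀.nat = σ'.nat := by rw [hσ₀]; rfl
    have e1 : σ₀.real 0 = 0 := by rw [hσ₀]; simp
    have e2 : σ₀.real 1 = 0 := by rw [hσ₀]; simp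
    have m0 : SameMain d σ σ₀ :=
      ⟨fun r j hj h1 h2 => by rw [e0 _ ((by norm_num : 2 ≤ 12).trans (le_addr _ _ _)),
        i2.row r j hj h1 h2], fun x hx => by rw [e0 x (by omega), i2.list x hx]⟩
    refine Run.seq (productRow_run hL fun σ₁ j1 j2 j3 j4 => ?_)
    have n8 : σ₀.nat 8 = σ.nat 8 := by rw [en, i1 8 (by norm_num) (by norm_num)]
    rw [en, h2, ← en, n8, m0.pinvDev, e1, zero_add] at j3
    rw [en, h2, ← en, n8, m0.projDev, e2, zero_add] at j4
    have k2 : σ₁.nat 2 = k := by rw [j1 2 (by norm_num), en, h2]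
    have k8 : σ₁.nat 8 = σ.nat 8 := by rw [j1 8 (by norm_num), n8]
    have hd1 : devN I σ₁ (σ.nat 8) k = devN I σ (σ.nat 8) k := by
      rw [devN, j2 _ ((by norm_num : 2 ≤ 12).trans (le_addr _ _ _)), ← devN, m0.dev _ hk]
    refine Run.seq (Run.setReal hL.fit (by omega)
      (by simpa [k2] using hL.addr_lt (by omega) hk) ?_)
    refine Run.seq (Run.setReal hL.fit (by omega)
      (by simpa [k2] using hL.addr_lt (by omega) hk) ?_)
    refine Run.seq (Run.setReal hL.fit (by omega) (by simp; omega) ?_)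
    refine Run.setReal hL.fit (by omega) (by simp; omega) ?_
    obtain ⟨σ₂, hσ₂⟩ : ∃ σ₂, σ₂ = (σ₁.setReal I (.entry (.const 1) (.nat 2)) (.real 0)).setReal I
      (.entry (.const 2) (.nat 2)) (.real 1) := ⟨_, rfl⟩
    rw [← hσ₂]
    have f1 : ∀ x, σ₂.real x = if x = addr d 2 k then projDev I σ (σ.nat 8) k else
        if x = addr d 1 k then pinvDev I σ (σ.nat 8) k else σ₁.real x := by
      intro x
      rw [hσ₂, State.setReal_real]
      have h1 : (1 : ℕ) ≠ addr d 1 k := by have := le_addr d 1 k; omega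
      simp [k2, j3, j4, h1]
    have fs : ∀ x, x < 12 → σ₂.real x = σ₁.real x := by
      intro x hx
      have h1 := le_addr d 1 k
      have h2 := le_addr d 2 k
      rw [f1, if_neg (by omega), if_neg (by omega)]
    have fn : σ₂.nat = σ₁.nat := by rw [hσ₂]; rfl
    have hd2 : devN I σ₂ (σ.nat 8) k = devN I σ (σ.nat 8) k := by
      rw [devN, f1, if_neg (addr_ne_of_row hk hk (by norm_num)),
        if_neg (addr_ne_of_row hk hk (by norm_num)), ← devN, hd1]
    obtain ⟨σ₃, hσ₃⟩ : ∃ σ₃, σ₃ = (σ₂.setReal I (.const 6) (.add (.real 6)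
      (.mul (.dev (.nat 8) (.nat 2)) (.real 0)))).setReal I (.const 7) (.add (.real 7)
      (.mul (.dev (.nat 8) (.nat 2)) (.real 1))) := ⟨_, rfl⟩
    rw [← hσ₃]
    have g1 : ∀ x, x ≠ 6 → x ≠ 7 → σ₃.real x = σ₂.real x := by
      intro x h6 h7
      rw [hσ₃]
      simp [h6, h7]
    have g6 : σ₃.real 6 = σ'.real 6 + devN I σ (σ.nat 8) k * pinvDev I σ (σ.nat 8) k := by
      rw [hσ₃]
      simp only [State.setReal_real, const_val, Nat.reduceEqDiff, if_false,
        if_true, RExp.add_val, RExp.cell_val, RExp.mul_val, RExp.dev_val, NExp.cell_val, fn, k2,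
        k8, hd2, fs 6 (by norm_num), fs 0 (by norm_num), j3, j2 6 (by norm_num),
        e0 6 (by norm_num)]
    have g7 : σ₃.real 7 = σ'.real 7 + devN I σ (σ.nat 8) k * projDev I σ (σ.nat 8) k := by
      have hd3 : devN I (σ₂.setReal I (.const 6) (.add (.real 6)
          (.mul (.dev (.nat 8) (.nat 2)) (.real 0)))) (σ.nat 8) k = devN I σ (σ.nat 8) k := by
        have := le_addr d 0 k
        rw [devN, State.setReal_real, if_neg (by simp; omega), ← devN, hd2]
      rw [hσ₃, State.setReal_real, if_pos (by simp)]
      simp [fn, k2, k8, hd3, fs 7 (by norm_num), fs 1 (by norm_num), j4, j2 7 (by norm_num),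
        e0 7 (by norm_num)]
    have gn : σ₃.nat = σ₁.nat := by rw [hσ₃]; exact fn
    have hmain : SameMain d σ σ₃ := by
      refine ⟨fun r j hj hr1 hr2 => ?_, fun x hx => ?_⟩
      · have := le_addr d r j
        rw [g1 _ (by omega) (by omega), f1, if_neg (addr_ne_of_row hj hk hr2),
          if_neg (addr_ne_of_row hj hk hr1), j2 _ (by omega), m0.row r j hj hr1 hr2]
      · have h1 := RAM.addr_lt (d := d) (r := 1) (j := k) (by omega) hk
        have h2 := RAM.addr_lt (d := d) (r := 2) (j := k) (by omega) hk
        rw [g1 _ (by omega) (by omega), f1, if_neg (by omega), if_neg (by omega), j2 _ (by omega),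
          m0.list x hx]
    refine ⟨by rw [gn, k2], fun x hx2 hx3 => ?_, ⟨hmain.row, hmain.list⟩,
      fun x hx hx' h6 h7 => ?_, fun i hi hik => ?_, fun i hi hik => ?_, ?_, ?_⟩
    · rw [State.put_nat, if_neg hx2, gn, j1 x hx3, en, i1 x hx2 hx3]
    · rw [State.put_real, g1 x h6 h7, fs x hx', j2 x hx, e0 x hx, i3 x hx hx' h6 h7]
    · have := le_addr d 1 i
      rw [State.put_real, g1 _ (by omega) (by omega), f1,
        if_neg (addr_ne_of_row hi hk (by norm_num))]
      rcases Nat.lt_succ_iff_lt_or_eq.mp hik with h' | rfl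
      · rw [if_neg fun h => h'.ne ((addr_inj hi hk).mp h).2, j2 _ (by omega), e0 _ (by omega),
          i4 i hi h']
      · rw [if_pos rfl]
    · have := le_addr d 2 i
      rw [State.put_real, g1 _ (by omega) (by omega), f1]
      rcases Nat.lt_succ_iff_lt_or_eq.mp hik with h' | rfl
      · rw [if_neg fun h => h'.ne ((addr_inj hi hk).mp h).2,
          if_neg (addr_ne_of_row hi hk (by norm_num)), j2 _ (by omega), e0 _ (by omega),
          i5 i hi h']
      · rw [if_pos rfl]
    · rw [State.put_real, g6, i6, Finset.sum_range_succ]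
    · rw [State.put_real, g7, i7, Finset.sum_range_succ]
  · rintro σ' - ⟨i1, i2, i3, i4, i5, i6, i7⟩
    exact h σ' i1 i2 i3 (fun i hi => i4 i hi hi) (fun i hi => i5 i hi hi) i6 i7

end RAM

namespace RAM

variable {d : ℕ} {I : BarrierInput d} {L : Limits}

open NExp RExp Prog

/-- Sets the step size and the coefficients of the updates. -/
def coeffs : Prog :=
  .ite (.ltReal (.ofNat (.const 0)) (.real 7))
    (.seq (.setReal (.const 4) (.real 5))
    (.seq (.setReal (.const 8) (.ofNat (.const 0)))
    (.seq (.setReal (.const 9) (.sub (.ofNat (.const 0)) (.div (.ofNat (.const 1)) (.real 7))))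
    (.seq (.setReal (.const 10) (.div (.add (.div (.ofNat (.const 1)) (.real 4)) (.real 6))
      (.mul (.real 7) (.real 7))))
    (.seq (.setReal (.const 11) (.div (.ofNat (.const 1)) (.real 7)))
      (.setNat (.const 6) (.add (.nat 6) (.const 1))))))))
    (.seq (.setReal (.const 4) (.div (.ofNat (.const 1))
      (.add (.mul (.ofNat (.const 3)) (.real 6)) (.ofNat (.const 6)))))
    (.seq (.setReal (.const 8) (.sub (.ofNat (.const 0)) (.div (.real 4)
      (.add (.ofNat (.const 1)) (.mul (.real 4) (.real 6))))))
    (.seq (.setReal (.const 9) (.ofNat (.const 0)))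
    (.seq (.setReal (.const 10) (.ofNat (.const 0)))
      (.setReal (.const 11) (.ofNat (.const 0)))))))

theorem coeffs_run {M : ℕ} (hL : L.Room I M) {N : ℕ} (hN : 1 ≤ N) {σ : State} {φ : State → Prop}
    (h6 : σ.nat 6 < d + 1)
    (h : ∀ σ', (∀ x, x ≠ 6 → σ'.nat x = σ.nat x) →
      (∀ x, x < 4 ∨ 5 ≤ x ∧ x < 8 ∨ 12 ≤ x → σ'.real x = σ.real x) →
      (0 < σ.real 7 → σ'.nat 6 = σ.nat 6 + 1 ∧ σ'.real 4 = σ.real 5 ∧ σ'.real 8 = 0 ∧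
        σ'.real 9 = - (1 / σ.real 7) ∧
        σ'.real 10 = (1 / σ.real 5 + σ.real 6) / (σ.real 7 * σ.real 7) ∧
        σ'.real 11 = 1 / σ.real 7) →
      (¬ 0 < σ.real 7 → σ'.nat 6 = σ.nat 6 ∧ σ'.real 4 = 1 / (3 * σ.real 6 + 6) ∧
        σ'.real 8 = - (σ'.real 4 / (1 + σ'.real 4 * σ.real 6)) ∧ σ'.real 9 = 0 ∧
        σ'.real 10 = 0 ∧ σ'.real 11 = 0) → φ σ') :
    Run L I coeffs σ N φ := by
  have hreal := hL.reals_gt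
  refine Run.ite hL.fit hN (fun hb => ?_) (fun hb => ?_)
  · simp only [Test.holds, RExp.ofNat_val, const_val, RExp.cell_val, Nat.cast_zero] at hb
    refine Run.seq (Run.setReal hL.fit hN (by simp; omega) ?_)
    refine Run.seq (Run.setReal hL.fit hN (by simp; omega) ?_)
    refine Run.seq (Run.setReal hL.fit hN (by simp; omega) ?_)
    refine Run.seq (Run.setReal hL.fit hN (by simp; omega) ?_)
    refine Run.seq (Run.setReal hL.fit hN (by simp; omega) ?_)
    refine Run.setNat hL.fit hN (Or.inl ⟨by simp, ?_⟩) ?_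
    · refine hL.size_le ?_
      have := le_base d
      simp
      omega
    · refine h _ (fun x hx => by simp [hx]) (fun x hx => ?_) (fun _ => ?_)
        (fun h' => absurd hb h')
      · rw [State.setNat_real]
        iterate 5 rw [State.setReal_real, if_neg (by simp; omega)]
      · simp
  · simp only [Test.holds, RExp.ofNat_val, const_val, RExp.cell_val, Nat.cast_zero] at hb
    refine Run.seq (Run.setReal hL.fit hN (by simp; omega) ?_)
    refine Run.seq (Run.setReal hL.fit hN (by simp; omega) ?_)
    refine Run.seq (Run.setReal hL.fit hN (by simp; omega) ?_)
    refine Run.seq (Run.setReal hL.fit hN (by simp; omega) ?_)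
    refine Run.setReal hL.fit hN (by simp; omega) ?_
    refine h _ (fun x hx => rfl) (fun x hx => ?_) (fun h' => absurd h' hb) (fun _ => ?_)
    · iterate 5 rw [State.setReal_real, if_neg (by simp; omega)]
    · simp

/-- The updated entry `(i, j)` of the pseudo-inverse. -/
noncomputable def newPinv (d : ℕ) (σ : State) (i j : ℕ) : ℝ :=
  (pinvN d σ i j + σ.real 8 * (σ.real (addr d 1 i) * σ.real (addr d 1 j))
    + σ.real 9 * (σ.real (addr d 1 i) * σ.real (addr d 2 j)
      + σ.real (addr d 2 i) * σ.real (addr d 1 j))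
    + σ.real 10 * (σ.real (addr d 2 i) * σ.real (addr d 2 j))) / (1 - σ.real 4)

/-- The updated entry `(i, j)` of the projection. -/
noncomputable def newProj (d : ℕ) (σ : State) (i j : ℕ) : ℝ :=
  projN d σ i j - σ.real 11 * (σ.real (addr d 2 i) * σ.real (addr d 2 j))

/-- Updates row `nat 2` of the two matrices. -/
def matrixRow : Prog :=
  forTo 3 dim
    (.seq (.setReal (.entry (.add (.const 3) (.add .dim (.nat 2))) (.nat 3))
      (.div (.add (.add (.add (.pinv (.nat 2) (.nat 3))
          (.mul (.real 8) (.mul (.arr (.const 1) (.nat 2)) (.arr (.const 1) (.nat 3)))))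
        (.mul (.real 9) (.add (.mul (.arr (.const 1) (.nat 2)) (.arr (.const 2) (.nat 3)))
          (.mul (.arr (.const 2) (.nat 2)) (.arr (.const 1) (.nat 3))))))
        (.mul (.real 10) (.mul (.arr (.const 2) (.nat 2)) (.arr (.const 2) (.nat 3)))))
        (.sub (.ofNat (.const 1)) (.real 4))))
      (.setReal (.entry (.add (.const 3) (.nat 2)) (.nat 3))
        (.sub (.proj (.nat 2) (.nat 3))
          (.mul (.real 11) (.mul (.arr (.const 2) (.nat 2)) (.arr (.const 2) (.nat 3)))))))

/-- The states agree except for the matrix entries that satisfy `D`, which have been updated. -/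
structure Updated (d : ℕ) (D : ℕ → ℕ → Prop) (σ σ' : State) : Prop where
  other : ∀ x, x < 12 ∨ base d ≤ x → σ'.real x = σ.real x
  row : ∀ r j, j < d → r < 3 → σ'.real (addr d r j) = σ.real (addr d r j)
  pinv_new : ∀ i j, i < d → j < d → D i j → pinvN d σ' i j = newPinv d σ i j
  pinv_old : ∀ i j, i < d → j < d → ¬ D i j → pinvN d σ' i j = pinvN d σ i j
  proj_new : ∀ i j, i < d → j < d → D i j → projN d σ' i j = newProj d σ i j
  proj_old : ∀ i j, i < d → j < d → ¬ D i j → projN d σ' i j = projN d σ i j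

theorem Updated.congr {D D' : ℕ → ℕ → Prop} {σ σ' σ'' : State} (h : Updated d D σ σ')
    (hD : ∀ i j, i < d → j < d → (D i j ↔ D' i j)) (hr : σ''.real = σ'.real) :
    Updated d D' σ σ'' := by
  obtain ⟨h1, h2, h3, h4, h5, h6⟩ := h
  refine ⟨by rwa [hr], by rwa [hr], ?_, ?_, ?_, ?_⟩
  · intro i j hi hj hd
    rw [← h3 i j hi hj ((hD i j hi hj).mpr hd), pinvN, pinvN, hr]
  · intro i j hi hj hd
    rw [← h4 i j hi hj fun h => hd ((hD i j hi hj).mp h), pinvN, pinvN, hr]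
  · intro i j hi hj hd
    rw [← h5 i j hi hj ((hD i j hi hj).mpr hd), projN, projN, hr]
  · intro i j hi hj hd
    rw [← h6 i j hi hj fun h => hd ((hD i j hi hj).mp h), projN, projN, hr]

theorem matrixRow_run {M : ℕ} (hL : L.Room I M) {σ₀ σ : State} {r : ℕ} (hr : r < d)
    (h2 : σ.nat 2 = r) (hU : Updated d (fun i _ => i < r) σ₀ σ) {φ : State → Prop}
    (h : ∀ σ', (∀ x, x ≠ 3 → σ'.nat x = σ.nat x) →
      Updated d (fun i _ => i < r + 1) σ₀ σ' → φ σ') :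
    Run L I matrixRow σ (d + 1) φ := by
  have hreal := hL.reals_gt
  rw [← one_mul (d + 1)]
  refine Run.forTo hL.fit (by norm_num) le_rfl d hL.fit.dim
    (fun k σ' => (∀ x, x ≠ 3 → σ'.nat x = σ.nat x) ∧
      Updated d (fun i j => i < r ∨ i = r ∧ j < k) σ₀ σ')
    (fun k σ' _ => rfl) ?_ ?_ ?_
  · exact ⟨fun x hx => by simp [hx], hU.congr (fun i j _ _ => by simp) rfl⟩
  · rintro k σ' hk h3 ⟨i1, i2⟩
    have k2 : σ'.nat 2 = r := by rw [i1 2 (by norm_num), h2]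
    refine Run.seq (Run.setReal hL.fit le_rfl
      (by simpa [k2, h3] using hL.addr_lt (by omega) hk) ?_)
    refine Run.setReal hL.fit le_rfl (by simpa [k2, h3] using hL.addr_lt (by omega) hk) ?_
    obtain ⟨σ₁, hσ₁⟩ : ∃ σ₁, σ₁ = (σ'.setReal I
      (.entry (.add (.const 3) (.add .dim (.nat 2))) (.nat 3))
      (.div (.add (.add (.add (.pinv (.nat 2) (.nat 3))
          (.mul (.real 8) (.mul (.arr (.const 1) (.nat 2)) (.arr (.const 1) (.nat 3)))))
        (.mul (.real 9) (.add (.mul (.arr (.const 1) (.nat 2)) (.arr (.const 2) (.nat 3)))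
          (.mul (.arr (.const 2) (.nat 2)) (.arr (.const 1) (.nat 3))))))
        (.mul (.real 10) (.mul (.arr (.const 2) (.nat 2)) (.arr (.const 2) (.nat 3)))))
        (.sub (.ofNat (.const 1)) (.real 4)))) := ⟨_, rfl⟩
    rw [← hσ₁]
    have nD : ¬ (r < r ∨ r = r ∧ k < k) := by omega
    have f1 : ∀ x, σ₁.real x = if x = addr d (3 + (d + r)) k then newPinv d σ₀ r k
        else σ'.real x := by
      intro x
      rw [hσ₁, State.setReal_real]
      simp only [entry_val, NExp.add_val, const_val, dim_val, NExp.cell_val, k2, h3, RExp.div_val,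
        RExp.add_val, RExp.mul_val, RExp.cell_val, RExp.sub_val, pinv_val, RExp.ofNat_val,
        Nat.cast_one, newPinv, i2.other 8 (by omega), i2.other 9 (by omega),
        i2.other 10 (by omega), i2.other 4 (by omega), i2.row 1 r hr (by norm_num),
        i2.row 1 k hk (by norm_num), i2.row 2 r hr (by norm_num),
        i2.row 2 k hk (by norm_num), i2.pinv_old r k hr hk nD]
    have n1 : σ₁.nat = σ'.nat := by rw [hσ₁]; rfl
    have hrow : ∀ r' j, j < d → r' < 3 → σ₁.real (addr d r' j) = σ₀.real (addr d r' j) := by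
      intro r' j hj hr'
      rw [f1, if_neg (addr_ne_of_row hj hk (by omega)), i2.row r' j hj hr']
    have hoth : ∀ x, x < 12 ∨ base d ≤ x → σ₁.real x = σ₀.real x := by
      intro x hx
      have h1 := RAM.addr_lt (d := d) (r := 3 + (d + r)) (j := k) (by omega) hk
      have h2 := le_addr d (3 + (d + r)) k
      rw [f1, if_neg (by omega), i2.other x hx]
    have hpr : projN d σ₁ r k = projN d σ₀ r k := by
      rw [projN, f1, if_neg (addr_ne_of_row hk hk (by omega)), ← projN, i2.proj_old r k hr hk nD]
    obtain ⟨σ₂, hσ₂⟩ : ∃ σ₂, σ₂ = (σ₁.setReal I (.entry (.add (.const 3) (.nat 2)) (.nat 3))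
        (.sub (.proj (.nat 2) (.nat 3))
          (.mul (.real 11) (.mul (.arr (.const 2) (.nat 2)) (.arr (.const 2) (.nat 3)))))) :=
      ⟨_, rfl⟩
    rw [← hσ₂]
    have f2 : ∀ x, σ₂.real x = if x = addr d (3 + r) k then newProj d σ₀ r k
        else σ₁.real x := by
      intro x
      rw [hσ₂, State.setReal_real]
      simp only [entry_val, NExp.add_val, const_val, NExp.cell_val, n1, k2, h3,
        RExp.mul_val, RExp.cell_val, RExp.sub_val, proj_val, newProj, hoth 11 (by omega),
        hrow 2 r hr (by norm_num), hrow 2 k hk (by norm_num), hpr]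
    have n2 : σ₂.nat = σ'.nat := by rw [hσ₂, ← n1]; rfl
    refine ⟨by rw [n2, h3], fun x hx => by simp [hx, n2, i1], ?_⟩
    have key : Updated d (fun i j => i < r ∨ i = r ∧ j < k + 1) σ₀ σ₂ := by
      have hp : ∀ i j, i < d → j < d → pinvN d σ₂ i j =
          if i = r ∧ j = k then newPinv d σ₀ r k else pinvN d σ' i j := by
        intro i j hi hj
        rw [pinvN, f2, if_neg (addr_ne_of_row hj hk (by omega)), f1, pinvN]
        refine if_congr ?_ rfl rfl
        rw [addr_inj hj hk]
        omega
      have hq : ∀ i j, i < d → j < d → projN d σ₂ i j =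
          if i = r ∧ j = k then newProj d σ₀ r k else projN d σ' i j := by
        intro i j hi hj
        rw [projN, f2, f1, if_neg (c := addr d (3 + i) j = addr d (3 + (d + r)) k)
          (addr_ne_of_row hj hk (by omega)), projN]
        refine if_congr ?_ rfl rfl
        rw [addr_inj hj hk]
        omega
      refine ⟨fun x hx => ?_, fun r' j hj hr' => ?_, ?_, ?_, ?_, ?_⟩
      · have h1 := RAM.addr_lt (d := d) (r := 3 + r) (j := k) (by omega) hk
        have h2 := le_addr d (3 + r) k
        rw [f2, if_neg (by omega), hoth x hx]
      · rw [f2, if_neg (addr_ne_of_row hj hk (by omega)), hrow r' j hj hr']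
      · intro i j hi hj hD
        rw [hp i j hi hj]
        split_ifs with hc
        · rw [hc.1, hc.2]
        · exact i2.pinv_new i j hi hj (by omega)
      · intro i j hi hj hD
        rw [hp i j hi hj, if_neg (by omega)]
        exact i2.pinv_old i j hi hj (by omega)
      · intro i j hi hj hD
        rw [hq i j hi hj]
        split_ifs with hc
        · rw [hc.1, hc.2]
        · exact i2.proj_new i j hi hj (by omega)
      · intro i j hi hj hD
        rw [hq i j hi hj, if_neg (by omega)]
        exact i2.proj_old i j hi hj (by omega)
    exact key.congr (fun i j _ _ => Iff.rfl) rfl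
  · rintro σ' - ⟨i1, i2⟩
    exact h σ' i1 (i2.congr (fun i j hi hj => by omega) rfl)

/-- Updates the two matrices. -/
def matrices : Prog := forTo 2 dim matrixRow

theorem matrices_run {M : ℕ} (hL : L.Room I M) {σ : State} {φ : State → Prop}
    (h : ∀ σ', (∀ x, x ≠ 2 → x ≠ 3 → σ'.nat x = σ.nat x) →
      Updated d (fun _ _ => True) σ σ' → φ σ') :
    Run L I matrices σ ((d + 1) * (d + 1)) φ := by
  refine Run.forTo hL.fit (by norm_num) (by omega) d hL.fit.dim
    (fun k σ' => (∀ x, x ≠ 2 → x ≠ 3 → σ'.nat x = σ.nat x) ∧ Updated d (fun i _ => i < k) σ σ')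
    (fun k σ' _ => rfl) ?_ ?_ ?_
  · refine ⟨fun x hx _ => by simp [hx], fun x _ => rfl, fun r j _ _ => rfl, ?_, ?_, ?_, ?_⟩
    · intro i j _ _ h; omega
    · intro i j _ _ _; rfl
    · intro i j _ _ h; omega
    · intro i j _ _ _; rfl
  · rintro k σ' hk h2 ⟨i1, i2⟩
    refine matrixRow_run hL hk h2 i2 fun σ₁ j1 j2 => ⟨by rw [j1 2 (by norm_num), h2],
      fun x hx hx' => by simp [hx, j1 x hx', i1 x hx hx'], j2.congr (fun _ _ _ _ => Iff.rfl) rfl⟩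
  · rintro σ' - ⟨i1, i2⟩
    exact h σ' i1 (i2.congr (fun i j hi _ => by simp [hi]) rfl)

/-- Updates the mean. -/
def means : Prog :=
  forTo 3 dim (.setReal (.entry (.const 0) (.nat 3))
    (.add (.arr (.const 0) (.nat 3)) (.mul (.real 4) (.dev (.nat 8) (.nat 3)))))

theorem means_run {M : ℕ} (hL : L.Room I M) {σ : State} {φ : State → Prop}
    (h : ∀ σ', (∀ x, x ≠ 3 → σ'.nat x = σ.nat x) →
      (∀ x, x < 12 ∨ base d ≤ x → σ'.real x = σ.real x) →
      (∀ r j, j < d → r ≠ 0 → σ'.real (addr d r j) = σ.real (addr d r j)) →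
      (∀ j < d, σ'.real (addr d 0 j) = σ.real (addr d 0 j)
        + σ.real 4 * devN I σ (σ.nat 8) j) → φ σ') :
    Run L I means σ (d + 1) φ := by
  rw [← one_mul (d + 1)]
  refine Run.forTo hL.fit (by norm_num) le_rfl d hL.fit.dim
    (fun k σ' => (∀ x, x ≠ 3 → σ'.nat x = σ.nat x) ∧
      (∀ x, x < 12 ∨ base d ≤ x → σ'.real x = σ.real x) ∧
      (∀ r j, j < d → r ≠ 0 → σ'.real (addr d r j) = σ.real (addr d r j)) ∧
      (∀ j < d, σ'.real (addr d 0 j) = if j < k then σ.real (addr d 0 j)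
        + σ.real 4 * devN I σ (σ.nat 8) j else σ.real (addr d 0 j)))
    (fun k σ' _ => rfl) ?_ ?_ ?_
  · exact ⟨fun x hx => by simp [hx], fun x _ => rfl, fun r j _ _ => rfl, fun j _ => by simp⟩
  · rintro k σ' hk h3 ⟨i1, i2, i3, i4⟩
    refine Run.setReal hL.fit le_rfl (by simpa [h3] using hL.addr_lt (by omega) hk) ?_
    have hdv : devN I σ' (σ.nat 8) k = devN I σ (σ.nat 8) k := by
      rw [devN, i4 k hk, if_neg (lt_irrefl k), ← devN]
    have f1 : ∀ x, (σ'.setReal I (.entry (.const 0) (.nat 3))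
        (.add (.arr (.const 0) (.nat 3)) (.mul (.real 4) (.dev (.nat 8) (.nat 3))))).real x =
        if x = addr d 0 k then σ.real (addr d 0 k) + σ.real 4 * devN I σ (σ.nat 8) k
        else σ'.real x := by
      intro x
      rw [State.setReal_real]
      simp only [entry_val, const_val, NExp.cell_val, h3, RExp.add_val, RExp.mul_val,
        RExp.cell_val, dev_val, i1 8 (by norm_num), hdv, i2 4 (by omega), i4 k hk,
        lt_irrefl, if_false]
    refine ⟨h3, fun x hx => by simp [hx, i1], fun x hx => ?_, fun r j hj hr => ?_, fun j hj => ?_⟩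
    · have h1 := RAM.addr_lt (d := d) (r := 0) (j := k) (by omega) hk
      have h2 := le_addr d 0 k
      rw [State.put_real, f1, if_neg (by omega), i2 x hx]
    · rw [State.put_real, f1, if_neg (addr_ne_of_row hj hk hr), i3 r j hj hr]
    · rw [State.put_real, f1, i4 j hj]
      rcases lt_trichotomy j k with h' | rfl | h'
      · rw [if_neg fun h => h'.ne ((addr_inj hj hk).mp h).2, if_pos h', if_pos (by omega)]
      · rw [if_pos rfl, if_pos (by omega)]
      · rw [if_neg fun h => h'.ne' ((addr_inj hj hk).mp h).2, if_neg (by omega),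
          if_neg (by omega)]
  · rintro σ' - ⟨i1, i2, i3, i4⟩
    exact h σ' i1 i2 i3 fun j hj => by rw [i4 j hj, if_pos hj]

end RAM

namespace RAM

variable {d : ℕ} {I : BarrierInput d} {L : Limits}

open NExp RExp Prog

/-- Multiplies the weights in the list by `1 - real 4`. -/
def rescale : Prog :=
  forTo 1 (.nat 0) (.setReal (.add (.nat 9) (.nat 1))
    (.mul (.cell (.add (.nat 9) (.nat 1))) (.sub (.ofNat (.const 1)) (.real 4))))

theorem rescale_run {M : ℕ} (hL : L.Room I M) {σ : State} {φ : State → Prop}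
    (h9 : σ.nat 9 = base d) (hn : σ.nat 0 ≤ M)
    (h : ∀ σ', (∀ x, x ≠ 1 → σ'.nat x = σ.nat x) → (∀ x, x < base d → σ'.real x = σ.real x) →
      (∀ t < σ.nat 0, σ'.real (base d + t) = σ.real (base d + t) * (1 - σ.real 4)) → φ σ') :
    Run L I rescale σ (σ.nat 0 + 1) φ := by
  have hb := le_base' (d := d)
  rw [← one_mul (σ.nat 0 + 1)]
  refine Run.forTo hL.fit (by norm_num) le_rfl (σ.nat 0) (hL.size_le (by omega))
    (fun k σ' => (∀ x, x ≠ 1 → σ'.nat x = σ.nat x) ∧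
      (∀ x, x < base d → σ'.real x = σ.real x) ∧
      ∀ t < σ.nat 0, σ'.real (base d + t) =
        if t < k then σ.real (base d + t) * (1 - σ.real 4) else σ.real (base d + t))
    (fun k σ' i => i.1 0 (by norm_num)) ?_ ?_ ?_
  · exact ⟨fun x hx => by simp [hx], fun x _ => rfl, fun t _ => by simp⟩
  · rintro k σ' hk h1 ⟨i1, i2, i3⟩
    have e9 : σ'.nat 9 = base d := by rw [i1 9 (by norm_num), h9]
    refine Run.setReal hL.fit le_rfl (by simp [e9, h1, hL.reals]; omega) ?_
    have f1 : ∀ x, (σ'.setReal I (.add (.nat 9) (.nat 1))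
        (.mul (.cell (.add (.nat 9) (.nat 1))) (.sub (.ofNat (.const 1)) (.real 4)))).real x =
        if x = base d + k then σ.real (base d + k) * (1 - σ.real 4) else σ'.real x := by
      intro x
      rw [State.setReal_real]
      simp [e9, h1, i2 4 (by omega), i3 k hk]
    refine ⟨h1, fun x hx => by simp [hx, i1], fun x hx => ?_, fun t ht => ?_⟩
    · rw [State.put_real, f1, if_neg (by omega), i2 x hx]
    · rw [State.put_real, f1, i3 t ht]
      rcases lt_trichotomy t k with h' | rfl | h'
      · rw [if_neg (by omega), if_pos h', if_pos (by omega)]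
      · rw [if_pos rfl, if_pos (by omega)]
      · rw [if_neg (by omega), if_neg (by omega), if_neg (by omega)]
  · rintro σ' - ⟨i1, i2, i3⟩
    exact h σ' i1 i2 fun t ht => by rw [i3 t ht, if_pos ht]

/-- Appends the action `nat 8` with the weight `real 4` to the list. -/
def push : Prog :=
  .seq (.setNat (.add (.add (.nat 9) (.const 1)) (.nat 0)) (.nat 8))
    (.seq (.setReal (.add (.nat 9) (.nat 0)) (.real 4))
      (.setNat (.const 0) (.add (.nat 0) (.const 1))))

/-- The total weight of the action `a` in the list. -/
noncomputable def weightN (d : ℕ) (σ : State) (a : ℕ) : ℝ :=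
  ∑ t ∈ Finset.range (σ.nat 0),
    if σ.nat (base d + 1 + t) = a then σ.real (base d + t) else 0

theorem push_run {M : ℕ} (hL : L.Room I M) {σ : State} {φ : State → Prop} {N : ℕ} (hN : 1 ≤ N)
    (h9 : σ.nat 9 = base d) (hn : σ.nat 0 ≤ M) (h8 : σ.nat 8 < I.A.card)
    (h : ∀ σ', (∀ x, x ≠ 0 → x < 10 → σ'.nat x = σ.nat x) → σ'.nat 0 = σ.nat 0 + 1 →
      (∀ x, x < base d → σ'.real x = σ.real x) →
      (∀ a, weightN d σ' a = weightN d σ a + if σ.nat 8 = a then σ.real 4 else 0) → φ σ') :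
    Run L I push σ N φ := by
  have hb := le_base' (d := d)
  refine Run.seq (Run.setNat hL.fit hN (Or.inr ⟨?_, ?_, ?_⟩) ?_)
  · simp [h9]; omega
  · simp [h9, hL.nats]; omega
  · simpa using h8.le
  obtain ⟨σ₁, hσ₁⟩ : ∃ σ₁, σ₁ = σ.setNat I (.add (.add (.nat 9) (.const 1)) (.nat 0)) (.nat 8) :=
    ⟨_, rfl⟩
  rw [← hσ₁]
  have f1 : ∀ x, σ₁.nat x = if x = base d + 1 + σ.nat 0 then σ.nat 8 else σ.nat x := by
    intro x
    rw [hσ₁, State.setNat_nat]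
    simp [h9]
  have r1 : σ₁.real = σ.real := by rw [hσ₁]; rfl
  have n0 : σ₁.nat 0 = σ.nat 0 := by rw [f1, if_neg (by omega)]
  have n9 : σ₁.nat 9 = base d := by rw [f1, if_neg (by omega), h9]
  refine Run.seq (Run.setReal hL.fit hN (by simp [n0, n9, hL.reals]; omega) ?_)
  obtain ⟨σ₂, hσ₂⟩ : ∃ σ₂, σ₂ = σ₁.setReal I (.add (.nat 9) (.nat 0)) (.real 4) := ⟨_, rfl⟩
  rw [← hσ₂]
  have f2 : ∀ x, σ₂.real x = if x = base d + σ.nat 0 then σ.real 4 else σ.real x := by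
    intro x
    rw [hσ₂, State.setReal_real]
    simp [n0, n9, r1]
  have e2 : σ₂.nat = σ₁.nat := by rw [hσ₂]; rfl
  refine Run.setNat hL.fit hN (Or.inl ⟨by simp, ?_⟩) ?_
  · refine hL.size_le ?_
    simp [e2, n0]; omega
  obtain ⟨σ₃, hσ₃⟩ : ∃ σ₃, σ₃ = σ₂.setNat I (.const 0) (.add (.nat 0) (.const 1)) := ⟨_, rfl⟩
  rw [← hσ₃]
  have f3 : ∀ x, σ₃.nat x = if x = 0 then σ.nat 0 + 1 else σ₁.nat x := by
    intro x
    rw [hσ₃, State.setNat_nat]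
    simp [e2, n0]
  have r3 : σ₃.real = σ₂.real := by rw [hσ₃]; rfl
  refine h σ₃ (fun x hx hx' => ?_) ?_ (fun x hx => ?_) fun a => ?_
  · rw [f3, if_neg hx, f1, if_neg (by omega)]
  · rw [f3, if_pos rfl]
  · rw [r3, f2, if_neg (by omega)]
  · have z3 : σ₃.nat 0 = σ.nat 0 + 1 := by rw [f3, if_pos rfl]
    rw [weightN, weightN, z3, Finset.sum_range_succ]
    congr 1
    · refine Finset.sum_congr rfl fun t ht => ?_
      have := Finset.mem_range.mp ht
      have e1 : σ₃.nat (base d + 1 + t) = σ.nat (base d + 1 + t) := by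
        rw [f3, if_neg (by omega), f1, if_neg (by omega)]
      have e2 : σ₃.real (base d + t) = σ.real (base d + t) := by
        rw [r3, f2, if_neg (by omega)]
      rw [e1, e2]
    · have e1 : σ₃.nat (base d + 1 + σ.nat 0) = σ.nat 8 := by
        rw [f3, if_neg (by omega), f1, if_pos rfl]
      have e2 : σ₃.real (base d + σ.nat 0) = σ.real 4 := by
        rw [r3, f2, if_pos rfl]
      rw [e1, e2]

/-- Moves mass to the action `nat 8`. -/
def update : Prog :=
  .seq products (.seq coeffs (.seq matrices (.seq means (.seq rescale push))))

/-- The state represents a distribution, a pseudo-inverse and a projection of corank `r`, and a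
list of length `n`. -/
structure Represents (I : BarrierInput d) (σ : State) (p : Fin I.A.card → ℝ)
    (K Q : Matrix (Fin d) (Fin d) ℝ) (r n : ℕ) : Prop where
  length : σ.nat 0 = n
  rank : σ.nat 6 = r
  start : σ.nat 9 = base d
  stepSize : σ.real 5 = 1 / (4 + (I.γ * ‖I.θ‖) ^ 2)
  mean : ∀ j : Fin d, σ.real (addr d 0 j) = I.A.mean p j
  pinv : ∀ i j : Fin d, pinvN d σ i j = K i j
  proj : ∀ i j : Fin d, projN d σ i j = Q i j
  weight : ∀ a : Fin I.A.card, weightN d σ a = p a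

namespace Represents

variable {σ : State} {p : Fin I.A.card → ℝ} {K Q : Matrix (Fin d) (Fin d) ℝ} {r n : ℕ}

open Matrix

theorem dev (h : Represents I σ p K Q r n) (a : Fin I.A.card) (j : Fin d) :
    devN I σ a j = I.A.dev p a j := by
  rw [devN, h.mean]
  simp [actN, ActionSet.dev]

theorem pinvDev (h : Represents I σ p K Q r n) (a : Fin I.A.card) (i : Fin d) :
    RAM.pinvDev I σ a i = (K *ᵥ I.A.dev p a) i := by
  simp only [RAM.pinvDev, Finset.sum_range, h.pinv, h.dev, mulVec, dotProduct]

theorem projDev (h : Represents I σ p K Q r n) (a : Fin I.A.card) (i : Fin d) :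
    RAM.projDev I σ a i = (Q *ᵥ I.A.dev p a) i := by
  simp only [RAM.projDev, Finset.sum_range, h.proj, h.dev, mulVec, dotProduct]

theorem projForm (h : Represents I σ p K Q r n) (a : Fin I.A.card) :
    RAM.projForm I σ a = I.A.dev p a ⬝ᵥ Q *ᵥ I.A.dev p a := by
  simp only [RAM.projForm, Finset.sum_range, h.proj, h.dev, mulVec, dotProduct, Finset.mul_sum]
  exact Finset.sum_congr rfl fun i _ => Finset.sum_congr rfl fun j _ => by ring

theorem pinvForm (h : Represents I σ p K Q r n) (a : Fin I.A.card) :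
    RAM.pinvForm I σ a = I.A.dev p a ⬝ᵥ K *ᵥ I.A.dev p a
      - I.γ * (I.A.dev p a ⬝ᵥ I.θ.ofLp) := by
  simp only [RAM.pinvForm, Finset.sum_range, h.pinv, h.dev, mulVec, dotProduct, Finset.mul_sum,
    thetaN, Fin.is_lt, dif_pos, Fin.eta]
  rw [← Finset.sum_sub_distrib]
  refine Finset.sum_congr rfl fun i _ => ?_
  rw [sub_eq_add_neg, add_comm]
  congr 1
  exact Finset.sum_congr rfl fun j _ => by ring

end Represents

open Matrix in
theorem update_run {M : ℕ} (hL : L.Room I M) {σ : State} {φ : State → Prop}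
    {p : Fin I.A.card → ℝ} {K Q : Matrix (Fin d) (Fin d) ℝ} {r n : ℕ}
    (hR : Represents I σ p K Q r n) (hn : n ≤ M) (hr : r ≤ d) (a : Fin I.A.card)
    (h8 : σ.nat 8 = a) {k z : Fin d → ℝ} {w ζ : ℝ} (hk : k = K *ᵥ I.A.dev p a)
    (hz : z = Q *ᵥ I.A.dev p a) (hw : w = I.A.dev p a ⬝ᵥ k) (hζ : ζ = I.A.dev p a ⬝ᵥ z)
    (h1 : 0 < ζ → ∀ σ', σ'.nat 7 = σ.nat 7 → (∀ s, s = 1 / (4 + (I.γ * ‖I.θ‖) ^ 2) →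
      Represents I σ' (I.A.mix p s a) (ActionSet.Design.extendK K k z s w ζ)
        (Q - ζ⁻¹ • vecMulVec z z) (r + 1) (n + 1)) → φ σ')
    (h2 : ¬ 0 < ζ → ∀ σ', σ'.nat 7 = σ.nat 7 → (∀ s, s = 1 / (3 * w + 6) →
      Represents I σ' (I.A.mix p s a) (ActionSet.Design.stepK K k s w) Q r (n + 1)) → φ σ') :
    Run L I update σ (L.nats * L.nats) φ := by
  have hZ : d + 1 ≤ L.nats := by rw [hL.nats]; have := le_base d; omega
  have hZ1 : 1 ≤ L.nats := by omega
  have hZZ : (d + 1) * (d + 1) ≤ L.nats * L.nats := Nat.mul_le_mul hZ hZ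
  have hZs : L.nats ≤ L.nats * L.nats := Nat.le_mul_of_pos_left _ hZ1
  have hN : 1 ≤ L.nats * L.nats := hZ1.trans hZs
  have hb := le_base' (d := d)
  refine Run.seq ((products_run hL fun σ₁ a1 a2 a3 a4 a5 a6 a7 => ?_).mono hZZ fun _ h => h)
  refine Run.seq (coeffs_run hL hN ?_ fun σ₂ b1 b2 b3 b4 => ?_)
  · rw [a1 6 (by norm_num) (by norm_num), hR.rank]; omega
  refine Run.seq ((matrices_run hL fun σ₃ c1 c2 => ?_).mono hZZ fun _ h => h)
  refine Run.seq ((means_run hL fun σ₄ d1 d2 d3 d4 => ?_).mono (hZ.trans hZs) fun _ h => h)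
  have n4 : ∀ x, x ≠ 2 → x ≠ 3 → x ≠ 6 → σ₄.nat x = σ.nat x := fun x h2 h3 h6 => by
    rw [d1 x h3, c1 x h2 h3, b1 x h6, a1 x h2 h3]
  have z4 : σ₄.nat 0 = n := by rw [n4 0 (by norm_num) (by norm_num) (by norm_num), hR.length]
  have s4 : σ₄.nat 9 = base d := by rw [n4 9 (by norm_num) (by norm_num) (by norm_num), hR.start]
  refine Run.seq ((rescale_run hL s4 (by omega) fun σ₅ e1 e2 e3 => ?_).mono ?_ fun _ h => h)
  swap
  · rw [z4]
    have : n + 1 ≤ L.nats := by rw [hL.nats]; omega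
    exact this.trans hZs
  have z5 : σ₅.nat 0 = n := by rw [e1 0 (by norm_num), z4]
  have i5 : σ₅.nat 8 = a := by
    rw [e1 8 (by norm_num), n4 8 (by norm_num) (by norm_num) (by norm_num), h8]
  refine push_run hL hN (by rw [e1 9 (by norm_num), s4]) (by omega) (by rw [i5]; exact a.2)
    fun σ₆ f1 f2 f3 f4 => ?_
  rw [h8] at a4 a5 a6 a7
  have hk' : ∀ i : Fin d, σ₁.real (addr d 1 i) = k i := fun i => by
    rw [a4 i i.2, hR.pinvDev, hk]
  have hz' : ∀ i : Fin d, σ₁.real (addr d 2 i) = z i := fun i => by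
    rw [a5 i i.2, hR.projDev, hz]
  have hw' : σ₁.real 6 = w := by
    rw [a6, Finset.sum_range, hw, hk]
    simp only [hR.pinvDev, hR.dev, dotProduct]
  have hζ' : σ₁.real 7 = ζ := by
    rw [a7, Finset.sum_range, hζ, hz]
    simp only [hR.projDev, hR.dev, dotProduct]
  have h5 : σ₁.real 5 = 1 / (4 + (I.γ * ‖I.θ‖) ^ 2) := by
    rw [a3 5 (by norm_num) (by norm_num) (by norm_num) (by norm_num), hR.stepSize]
  rw [hζ', hw', h5] at b3
  rw [hζ', hw'] at b4
  have r2 : ∀ x, 12 ≤ x → σ₂.real x = σ₁.real x := fun x hx => b2 x (Or.inr (Or.inr hx))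
  -- the values that do not depend on the kind of step
  have g7 : σ₆.nat 7 = σ.nat 7 := by
    rw [f1 7 (by norm_num) (by norm_num), e1 7 (by norm_num),
      n4 7 (by norm_num) (by norm_num) (by norm_num)]
  have g6 : σ₆.nat 6 = σ₂.nat 6 := by
    rw [f1 6 (by norm_num) (by norm_num), e1 6 (by norm_num), d1 6 (by norm_num),
      c1 6 (by norm_num) (by norm_num)]
  have g9 : σ₆.nat 9 = base d := by rw [f1 9 (by norm_num) (by norm_num), e1 9 (by norm_num), s4]
  have g0 : σ₆.nat 0 = n + 1 := by rw [f2, z5]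
  have q5 : σ₆.real 5 = 1 / (4 + (I.γ * ‖I.θ‖) ^ 2) := by
    rw [f3 5 (by omega), e2 5 (by omega), d2 5 (by omega), c2.other 5 (by omega),
      b2 5 (by omega), h5]
  obtain ⟨s, hs⟩ : ∃ s, s = σ₂.real 4 := ⟨_, rfl⟩
  have s3 : σ₃.real 4 = s := by rw [c2.other 4 (by omega), hs]
  have s4' : σ₄.real 4 = s := by rw [d2 4 (by omega), s3]
  have s5 : σ₅.real 4 = s := by rw [e2 4 (by omega), s4']
  have arr3 : ∀ r j, j < d → r < 3 → σ₃.real (addr d r j) = σ₁.real (addr d r j) :=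
    fun r j hj hr => by rw [c2.row r j hj hr, r2 _ (le_addr _ _ _)]
  have dev1 : ∀ j : Fin d, devN I σ₁ a j = I.A.dev p a j := fun j => by
    rw [a2.dev _ j.2, hR.dev]
  have hmean : ∀ j : Fin d, σ₆.real (addr d 0 j) = I.A.mean (I.A.mix p s a) j := by
    intro j
    have hlt := RAM.addr_lt (d := d) (r := 0) (j := j) (by omega) j.2
    have hd3 : devN I σ₃ (σ₃.nat 8) j = I.A.dev p a j := by
      rw [c1 8 (by norm_num) (by norm_num), b1 8 (by norm_num), a1 8 (by norm_num) (by norm_num),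
        h8, devN, arr3 0 j j.2 (by norm_num), ← devN, dev1]
    rw [f3 _ hlt, e2 _ hlt, d4 j j.2, hd3, arr3 0 j j.2 (by norm_num),
      a2.row 0 j j.2 (by norm_num) (by norm_num), hR.mean, s3, ActionSet.mean_mix]
    simp
  have hmat : ∀ r (j : Fin d), 3 ≤ r → r < 3 + 2 * d →
      σ₆.real (addr d r j) = σ₃.real (addr d r j) := by
    intro r j hr hr'
    have hlt := RAM.addr_lt (d := d) hr' j.2
    rw [f3 _ hlt, e2 _ hlt, d3 r j j.2 (by omega)]
  have hpinv : ∀ i j : Fin d, pinvN d σ₆ i j = (K i j + σ₂.real 8 * (k i * k j)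
      + σ₂.real 9 * (k i * z j + z i * k j) + σ₂.real 10 * (z i * z j)) / (1 - s) := by
    intro i j
    rw [pinvN, hmat _ j (by omega) (by omega), ← pinvN, c2.pinv_new i j i.2 j.2 trivial, newPinv,
      pinvN, r2 _ (le_addr _ _ _), r2 _ (le_addr _ _ _), r2 _ (le_addr _ _ _),
      r2 _ (le_addr _ _ _), r2 _ (le_addr _ _ _), ← pinvN, a2.pinv _ j.2, hR.pinv, hk', hk', hz',
      hz', hs]
  have hproj : ∀ i j : Fin d, projN d σ₆ i j = Q i j - σ₂.real 11 * (z i * z j) := by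
    intro i j
    rw [projN, hmat _ j (by omega) (by omega), ← projN, c2.proj_new i j i.2 j.2 trivial, newProj,
      projN, r2 _ (le_addr _ _ _), r2 _ (le_addr _ _ _), r2 _ (le_addr _ _ _), ← projN,
      a2.proj _ j.2, hR.proj, hz', hz']
  have hweight : ∀ b : Fin I.A.card, weightN d σ₆ b = I.A.mix p s a b := by
    intro b
    have hb' : weightN d σ₅ b = (1 - s) * weightN d σ b := by
      unfold weightN
      rw [z5, hR.length, Finset.mul_sum]
      refine Finset.sum_congr rfl fun t ht => ?_
      have ht' := Finset.mem_range.mp ht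
      rw [e1 _ (by omega), n4 _ (by omega) (by omega) (by omega), e3 t (by omega), s4',
        d2 _ (by omega), c2.other _ (by omega), r2 _ (by omega), a2.list _ (by omega)]
      split_ifs
      · ring
      · ring
    rw [f4, hb', hR.weight, s5, i5, ActionSet.mix]
    congr 1
    simp only [Fin.val_inj, eq_comm]
  by_cases hpos : 0 < ζ
  · obtain ⟨v1, v2, v3, v4, v5, v6⟩ := b3 hpos
    refine h1 hpos σ₆ g7 fun s' hs' => ?_
    obtain rfl : s' = s := by rw [hs', hs, v2]
    refine ⟨g0, ?_, g9, q5, hmean, fun i j => ?_, fun i j => ?_, hweight⟩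
    · rw [g6, v1, a1 6 (by norm_num) (by norm_num), hR.rank]
    · rw [hpinv, v3, v4, v5, ← hs']
      simp only [ActionSet.Design.extendK, Matrix.smul_apply, Matrix.add_apply, Matrix.sub_apply, Matrix.vecMulVec_apply,
        smul_eq_mul]
      rw [div_eq_inv_mul]
      congr 1
      field_simp
      ring
    · rw [hproj, v6]
      simp only [Matrix.smul_apply, Matrix.sub_apply, Matrix.vecMulVec_apply, smul_eq_mul, one_div]
  · obtain ⟨v1, v2, v3, v4, v5, v6⟩ := b4 hpos
    refine h2 hpos σ₆ g7 fun s' hs' => ?_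
    obtain rfl : s' = s := by rw [hs', hs, v2]
    refine ⟨g0, ?_, g9, q5, hmean, fun i j => ?_, fun i j => ?_, hweight⟩
    · rw [g6, v1, a1 6 (by norm_num) (by norm_num), hR.rank]
    · rw [hpinv, v3, v4, v5, ← hs]
      simp only [ActionSet.Design.stepK, Matrix.smul_apply, Matrix.sub_apply, Matrix.vecMulVec_apply,
        smul_eq_mul]
      rw [div_eq_inv_mul]
      congr 1
      ring
    · rw [hproj, v6]
      ring

end RAM

namespace RAM

variable {d : ℕ} {I : BarrierInput d} {L : Limits}

open NExp RExp Prog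

theorem Represents.of_eq {σ σ' : State} {p : Fin I.A.card → ℝ} {K Q : Matrix (Fin d) (Fin d) ℝ}
    {r n : ℕ} (h : Represents I σ p K Q r n)
    (hn : ∀ x, x = 0 ∨ 6 ≤ x → x ≠ 7 → x ≠ 8 → σ'.nat x = σ.nat x)
    (hr : ∀ x, 4 ≤ x → σ'.real x = σ.real x) : Represents I σ' p K Q r n := by
  have hb := le_base' (d := d)
  have h0 : σ'.nat 0 = σ.nat 0 := hn 0 (by norm_num) (by norm_num) (by norm_num)
  refine ⟨?_, ?_, ?_, ?_, fun j => ?_, fun i j => ?_, fun i j => ?_, fun a => ?_⟩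
  · rw [h0, h.length]
  · rw [hn 6 (by norm_num) (by norm_num) (by norm_num), h.rank]
  · rw [hn 9 (by norm_num) (by norm_num) (by norm_num), h.start]
  · rw [hr 5 (by norm_num), h.stepSize]
  · rw [hr _ (by have := le_addr d 0 j; omega), h.mean]
  · rw [← h.pinv, pinvN, pinvN, hr _ (by have := le_addr d (3 + (d + i)) j; omega)]
  · rw [← h.proj, projN, projN, hr _ (by have := le_addr d (3 + i) j; omega)]
  · rw [← h.weight, weightN, weightN, h0]
    refine Finset.sum_congr rfl fun t _ => ?_
    rw [hn _ (by omega) (by omega) (by omega), hr _ (by omega)]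

/-- One step of the main loop. -/
def improve : Prog :=
  .seq scan (.ite (.ltReal (.ofNat (.const 0)) (.real 3))
    (.seq (.setNat (.const 8) (.nat 4)) update)
    (.ite (.ltReal (.mul (.ofNat (.const 2)) (.ofNat (.nat 6))) (.real 2))
      (.seq (.setNat (.const 8) (.nat 5)) update)
      (.setNat (.const 7) (.const 0))))

open ActionSet in
/-- The invariant of the main loop. -/
def Invariant (I : BarrierInput d) (n : ℕ) (σ : State) : Prop :=
  ∃ (p : Fin I.A.card → ℝ) (K Q : Matrix (Fin d) (Fin d) ℝ) (r m : ℕ),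
    Represents I σ p K Q r m ∧ Progress I.A I.θ I.γ p K Q r m ∧
      ((σ.nat 7 = 1 ∧ m = n + 1) ∨ (σ.nat 7 = 0 ∧ (∀ i, Q.mulVec (I.A.dev p i) = 0) ∧
        ∀ i, I.A.dev p i ⬝ᵥ K.mulVec (I.A.dev p i) - I.γ * (I.A.dev p i ⬝ᵥ I.θ.ofLp) ≤ 2 * I.A.dim))

open ActionSet in
theorem improve_run {M n : ℕ} (hL : L.Room I M) (hγ : 0 < I.γ) {σ : State}
    {p : Fin I.A.card → ℝ} {K Q : Matrix (Fin d) (Fin d) ℝ} {r : ℕ}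
    (hR : Represents I σ p K Q r (n + 1)) (hP : Progress I.A I.θ I.γ p K Q r (n + 1))
    (hM : n + 1 ≤ M) (h7 : σ.nat 7 = 1) :
    Run L I improve σ (L.nats * L.nats * (I.A.card + 1)) (Invariant I (n + 1)) := by
  have hd : d + 1 ≤ L.nats := by have := le_base d; rw [hL.nats]; omega
  have hN1 : L.nats * L.nats ≤ L.nats * L.nats * (I.A.card + 1) :=
    Nat.le_mul_of_pos_right _ (Nat.succ_pos _)
  have hN2 : 1 ≤ L.nats * L.nats * (I.A.card + 1) :=
    le_trans (Nat.mul_pos (by omega) (by omega)) hN1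
  refine Run.seq ((scan_run hL (φ := fun σ' => Run L I _ σ' _ _) ?_).mono
    (Nat.mul_le_mul_right _ (Nat.mul_le_mul hd hd)) fun _ h => h)
  intro σ₁ a1 a2 a3 a4
  have hR₁ : Represents I σ₁ p K Q r (n + 1) := hR.of_eq (fun x hx _ _ => a1 x hx) a2
  obtain ⟨b1, b2, b3⟩ := a3
  obtain ⟨c1, c2, c3⟩ := a4
  have b2' := hR.projForm ⟨_, b1⟩
  have c2' := hR.pinvForm ⟨_, c1⟩
  rw [← b2] at b2'
  rw [← c2] at c2'
  refine Run.ite hL.fit hN2 (fun hb => ?_) fun hb => Run.ite hL.fit hN2 (fun hc => ?_) fun hc => ?_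
  · simp only [Test.holds, const_val, RExp.cell_val, ofNat_val, Nat.cast_zero] at hb
    refine Run.seq (Run.setNat hL.fit hN2 (Or.inl ⟨by simp, ?_⟩) ?_)
    · exact (Nat.size_le_size (by simpa using b1.le)).trans hL.fit.card
    have hR₂ : Represents I (σ₁.setNat I (.const 8) (.nat 4)) p K Q r (n + 1) :=
      hR₁.of_eq (fun x _ _ h8 => by simp [h8]) fun x _ => rfl
    refine (update_run hL hR₂ hM hP.rank_le ⟨_, b1⟩ (by simp) rfl rfl rfl rfl ?_ ?_).mono hN1
      fun _ h => h
    · intro hpos σ₃ g7 hs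
      refine ⟨_, _, _, _, _, hs _ rfl, hP.extend hγ ⟨_, b1⟩ (fun j => ?_) rfl rfl rfl rfl rfl hpos,
        Or.inl ⟨?_, rfl⟩⟩
      · rw [← hR.projForm, ← b2']
        exact b3 j j.2
      · rw [g7]; simp [a1 7, h7]
    · intro hpos
      rw [← b2'] at hpos
      exact absurd hb hpos
  · simp only [Test.holds, const_val, RExp.cell_val, ofNat_val, Nat.cast_zero, not_lt] at hb
    simp only [Test.holds, const_val, RExp.cell_val, RExp.mul_val, ofNat_val, NExp.cell_val,
      hR₁.rank] at hc
    have hQ : ∀ i, Q.mulVec (I.A.dev p i) = 0 := fun i => hP.design.Q_mulVec_eq_zero (by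
      rw [← hR.projForm]; exact (b3 i i.2).trans hb)
    refine Run.seq (Run.setNat hL.fit hN2 (Or.inl ⟨by simp, ?_⟩) ?_)
    · exact (Nat.size_le_size (by simpa using c1.le)).trans hL.fit.card
    have hR₂ : Represents I (σ₁.setNat I (.const 8) (.nat 5)) p K Q r (n + 1) :=
      hR₁.of_eq (fun x _ _ h8 => by simp [h8]) fun x _ => rfl
    refine (update_run hL hR₂ hM hP.rank_le ⟨_, c1⟩ (by simp) rfl rfl rfl rfl ?_ ?_).mono hN1
      fun _ h => h
    · intro hpos
      simp [hQ] at hpos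
    · intro _ σ₃ g7 hs
      refine ⟨_, _, _, _, _, hs _ rfl, hP.step hQ ⟨_, c1⟩ rfl rfl rfl ?_, Or.inl ⟨?_, rfl⟩⟩
      · rw [← c2']
        exact_mod_cast hc
      · rw [g7]; simp [a1 7, h7]
  · simp only [Test.holds, const_val, RExp.cell_val, ofNat_val, Nat.cast_zero, not_lt] at hb
    simp only [Test.holds, const_val, RExp.cell_val, RExp.mul_val, ofNat_val, NExp.cell_val,
      hR₁.rank, not_lt] at hc
    have hQ : ∀ i, Q.mulVec (I.A.dev p i) = 0 := fun i => hP.design.Q_mulVec_eq_zero (by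
      rw [← hR.projForm]; exact (b3 i i.2).trans hb)
    refine Run.setNat hL.fit hN2 (Or.inl ⟨by simp, by simp⟩) ?_
    refine ⟨p, K, Q, r, n + 1, hR₁.of_eq (fun x _ h7 _ => by simp [h7]) fun x _ => rfl, hP,
      Or.inr ⟨by simp, hQ, fun i => ?_⟩⟩
    rw [← hR.pinvForm, ← hP.design.rank_eq_dim hQ]
    exact (c3 i i.2).trans (by exact_mod_cast hc)

/-- The main loop. -/
def optimize : Prog := .loop (.ltNat (.const 0) (.nat 7)) improve

open ActionSet in
theorem optimize_run {M : ℕ} (hL : L.Room I M) (hγ : 0 < I.γ) {σ : State} {φ : State → Prop}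
    (hM : ∀ n : ℕ, (n : ℝ) ≤ d + 1 + 72 * gapBound I.A I.θ I.γ → n ≤ M)
    (hI : Invariant I 0 σ)
    (h : ∀ σ' p K Q r m, Represents I σ' p K Q r m → m ≤ M → I.A.Design p K Q r →
      (∀ i, Q.mulVec (I.A.dev p i) = 0) →
      (∀ i, I.A.dev p i ⬝ᵥ K.mulVec (I.A.dev p i) - I.γ * (I.A.dev p i ⬝ᵥ I.θ.ofLp)
        ≤ 2 * I.A.dim) → φ σ') :
    Run L I optimize σ (L.nats * L.nats * (I.A.card + 1) * (M + 1)) φ := by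
  have hN2 : 1 ≤ L.nats * L.nats * (I.A.card + 1) :=
    Nat.mul_pos (Nat.mul_pos (by have := hL.nats; omega) (by have := hL.nats; omega))
      (Nat.succ_pos _)
  refine Run.loop hL.fit hN2 (Invariant I) M hI ?_ ?_
  · rintro k σ' - ⟨p, K, Q, r, m, hR, hP, h'⟩ hb
    simp only [Test.holds, const_val, NExp.cell_val] at hb
    rcases h' with ⟨h7, rfl⟩ | ⟨h7, -⟩
    · have hk := hM _ hP.count_le
      exact ⟨hk, improve_run hL hγ hR hP hk h7⟩
    · omega
  · rintro k σ' ⟨p, K, Q, r, m, hR, hP, h'⟩ hb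
    simp only [Test.holds, const_val, NExp.cell_val] at hb
    rcases h' with ⟨h7, rfl⟩ | ⟨h7, hQ, hw⟩
    · omega
    · exact h σ' p K Q r m hR (hM _ hP.count_le) hP.design hQ hw

end RAM

namespace RAM

variable {d : ℕ} {I : BarrierInput d} {L : Limits}

open NExp RExp Prog

/-- Computes the weight of the actions that raise the rank of the covariance. -/
def initStepSize : Prog :=
  .seq (.setReal (.const 5) (.ofNat (.const 4)))
    (.seq (forTo 3 .dim (.setReal (.const 5)
      (.add (.real 5) (.mul (.mul .gamma (.theta (.nat 3))) (.mul .gamma (.theta (.nat 3)))))))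
      (.setReal (.const 5) (.div (.ofNat (.const 1)) (.real 5))))

theorem initStepSize_run {M : ℕ} (hL : L.Room I M) {σ : State} {φ : State → Prop}
    (h : ∀ σ', (∀ x, x ≠ 3 → σ'.nat x = σ.nat x) →
      (∀ x, x ≠ 5 → σ'.real x = σ.real x) →
      σ'.real 5 = 1 / (4 + (I.γ * ‖I.θ‖) ^ 2) → φ σ') :
    Run L I initStepSize σ (d + 1) φ := by
  have hreal := hL.reals_gt
  refine Run.seq (Run.setReal hL.fit (by omega) (by simp; omega) ?_)
  refine Run.seq ?_
  rw [← one_mul (d + 1)]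
  refine Run.forTo hL.fit (by norm_num) le_rfl d hL.fit.dim
    (fun k σ' => (∀ x, x ≠ 3 → σ'.nat x = σ.nat x) ∧
      (∀ x, x ≠ 5 → σ'.real x = σ.real x) ∧
      σ'.real 5 = 4 + ∑ j ∈ Finset.range k, (I.γ * thetaN I j) * (I.γ * thetaN I j))
    (fun k σ' _ => rfl) ?_ ?_ ?_
  · exact ⟨fun x hx => by simp [hx], fun x hx => by simp [hx], by simp⟩
  · rintro k σ' hk h1 ⟨i1, i2, i3⟩
    refine Run.setReal hL.fit le_rfl (by simp; omega) ⟨h1, fun x hx => by simp [hx, i1],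
      fun x hx => by simp [hx, i2], ?_⟩
    simp [h1, i3, Finset.sum_range_succ]
    ring
  · rintro σ' h1 ⟨i1, i2, i3⟩
    refine Run.setReal hL.fit (by omega) (by simp; omega) (h _ i1 (fun x hx => by simp [hx, i2]) ?_)
    simp only [State.setReal_real, const_val, if_true, div_val, ofNat_val, RExp.cell_val, i3,
      Nat.cast_one]
    congr 2
    rw [Finset.sum_range, mul_pow, EuclideanSpace.norm_sq_eq, Finset.mul_sum]
    refine Finset.sum_congr rfl fun j _ => ?_
    simp [thetaN]
    ring

/-- Sets the projection to the identity. -/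
def initProj : Prog :=
  forTo 3 .dim (.setReal (.entry (.add (.const 3) (.nat 3)) (.nat 3)) (.ofNat (.const 1)))

theorem initProj_run {M : ℕ} (hL : L.Room I M) {σ : State} {φ : State → Prop}
    (h : ∀ σ', (∀ x, x ≠ 3 → σ'.nat x = σ.nat x) →
      (∀ x, (∀ i < d, x ≠ addr d (3 + i) i) → σ'.real x = σ.real x) →
      (∀ i < d, σ'.real (addr d (3 + i) i) = 1) → φ σ') :
    Run L I initProj σ (d + 1) φ := by
  rw [← one_mul (d + 1)]
  refine Run.forTo hL.fit (by norm_num) le_rfl d hL.fit.dim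
    (fun k σ' => (∀ x, x ≠ 3 → σ'.nat x = σ.nat x) ∧
      (∀ x, (∀ i < d, x ≠ addr d (3 + i) i) → σ'.real x = σ.real x) ∧
      ∀ i < k, σ'.real (addr d (3 + i) i) = 1)
    (fun k σ' _ => rfl) ?_ ?_ ?_
  · exact ⟨fun x hx => by simp [hx], fun x _ => rfl, by simp⟩
  · rintro k σ' hk h1 ⟨i1, i2, i3⟩
    have ha := addr_lt (d := d) (r := 3 + k) (j := k) (by omega) hk
    refine Run.setReal hL.fit le_rfl (by simp [h1, hL.reals]; omega) ⟨h1,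
      fun x hx => by simp [hx, i1], fun x hx => ?_, fun i hi => ?_⟩
    · simp only [State.put_real, State.setReal_real, entry_val, NExp.add_val, const_val,
        NExp.cell_val, h1, if_neg (hx k hk), i2 x hx]
    · simp only [State.put_real, State.setReal_real, entry_val, NExp.add_val, const_val,
        NExp.cell_val, h1, ofNat_val, Nat.cast_one]
      split_ifs with he
      · rfl
      · refine i3 i (lt_of_le_of_ne (Nat.le_of_lt_succ hi) ?_)
        rintro rfl
        exact he rfl
  · rintro σ' h1 ⟨i1, i2, i3⟩
    exact h σ' i1 i2 i3

/-- Sets the mean to the action `nat 5`. -/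
def initMean : Prog :=
  forTo 3 .dim (.setReal (.entry (.const 0) (.nat 3)) (.action (.nat 5) (.nat 3)))

theorem initMean_run {M : ℕ} (hL : L.Room I M) {σ : State} {φ : State → Prop}
    (h : ∀ σ', (∀ x, x ≠ 3 → σ'.nat x = σ.nat x) →
      (∀ x, (∀ j < d, x ≠ addr d 0 j) → σ'.real x = σ.real x) →
      (∀ j < d, σ'.real (addr d 0 j) = actN I (σ.nat 5) j) → φ σ') :
    Run L I initMean σ (d + 1) φ := by
  rw [← one_mul (d + 1)]
  refine Run.forTo hL.fit (by norm_num) le_rfl d hL.fit.dim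
    (fun k σ' => (∀ x, x ≠ 3 → σ'.nat x = σ.nat x) ∧
      (∀ x, (∀ j < d, x ≠ addr d 0 j) → σ'.real x = σ.real x) ∧
      ∀ j < k, σ'.real (addr d 0 j) = actN I (σ.nat 5) j)
    (fun k σ' _ => rfl) ?_ ?_ ?_
  · exact ⟨fun x hx => by simp [hx], fun x _ => rfl, by simp⟩
  · rintro k σ' hk h1 ⟨i1, i2, i3⟩
    have ha := addr_lt (d := d) (r := 0) (j := k) (by omega) hk
    have h5 : σ'.nat 5 = σ.nat 5 := i1 5 (by norm_num)
    refine Run.setReal hL.fit le_rfl (by simp [h1, hL.reals]; omega) ⟨h1,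
      fun x hx => by simp [hx, i1], fun x hx => ?_, fun i hi => ?_⟩
    · simp only [State.put_real, State.setReal_real, entry_val, const_val,
        NExp.cell_val, h1, if_neg (hx k hk), i2 x hx]
    · simp only [State.put_real, State.setReal_real, entry_val, const_val,
        NExp.cell_val, h1, action_val, h5]
      split_ifs with he
      · rw [((addr_inj (by omega) hk).mp he).2]
      · refine i3 i (lt_of_le_of_ne (Nat.le_of_lt_succ hi) ?_)
        rintro rfl
        exact he rfl
  · rintro σ' h1 ⟨i1, i2, i3⟩
    exact h σ' i1 i2 i3

/-- Starts with the point mass at an action of least estimated loss. -/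
def prepare : Prog :=
  .seq (.setNat (.const 9)
      (.add (.const 12) (.mul .dim (.add (.const 3) (.mul (.const 2) .dim)))))
    (.seq initStepSize (.seq initProj (.seq scan (.seq initMean
      (.seq (.setNat (.const 8) (.nat 5)) (.seq (.setReal (.const 4) (.ofNat (.const 1)))
        (.seq push (.setNat (.const 7) (.const 1)))))))))

@[simp] theorem State.init_nat (x : ℕ) : State.init.nat x = 0 := rfl
@[simp] theorem State.init_real (x : ℕ) : State.init.real x = 0 := rfl

theorem prepare_run {M : ℕ} (hL : L.Room I M) {φ : State → Prop}
    (h : ∀ σ', Invariant I 0 σ' → φ σ') :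
    Run L I prepare State.init (L.nats * L.nats * (I.A.card + 1)) φ := by
  have hd : d + 1 ≤ L.nats := by have := le_base d; rw [hL.nats]; omega
  have hN1 : L.nats * L.nats ≤ L.nats * L.nats * (I.A.card + 1) :=
    Nat.le_mul_of_pos_right _ (Nat.succ_pos _)
  have hN2 : 1 ≤ L.nats * L.nats * (I.A.card + 1) :=
    le_trans (Nat.mul_pos (by omega) (by omega)) hN1
  have hN3 : d + 1 ≤ L.nats * L.nats * (I.A.card + 1) :=
    le_trans (hd.trans (Nat.le_mul_of_pos_left _ (by omega))) hN1
  have hb := le_base' (d := d)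
  have hreal := hL.reals_gt
  refine Run.seq (Run.setNat hL.fit hN2 (Or.inl ⟨by simp, hL.size_le ?_⟩) ?_)
  · simp only [NExp.add_val, const_val, NExp.mul_val, dim_val, base]; omega
  obtain ⟨σ₀, hσ₀⟩ : ∃ σ₀, σ₀ = State.init.setNat I (.const 9)
    (.add (.const 12) (.mul .dim (.add (.const 3) (.mul (.const 2) .dim)))) := ⟨_, rfl⟩
  rw [← hσ₀]
  have n0 : ∀ x, σ₀.nat x = if x = 9 then base d else 0 := by
    intro x
    rw [hσ₀, State.setNat_nat]
    by_cases hx : x = 9 <;> simp [base, hx]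
  have r0 : ∀ x, σ₀.real x = 0 := fun x => by rw [hσ₀]; rfl
  refine Run.seq ((initStepSize_run hL (φ := fun σ' => Run L I _ σ' _ _)
    fun σ₁ a1 a2 a3 => ?_).mono hN3 fun _ h => h)
  refine Run.seq ((initProj_run hL (φ := fun σ' => Run L I _ σ' _ _)
    fun σ₂ b1 b2 b3 => ?_).mono hN3 fun _ h => h)
  have hsm : ∀ x, x < 12 → σ₂.real x = σ₁.real x := fun x hx =>
    b2 x fun i _ => by have := le_addr d (3 + i) i; omega
  have hz : ∀ x, 12 ≤ x → (∀ i < d, x ≠ addr d (3 + i) i) → σ₂.real x = 0 := fun x hx hx' => by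
    rw [b2 x hx', a2 x (by omega), r0]
  have hmean0 : ∀ j < d, σ₂.real (addr d 0 j) = 0 := fun j hj => hz _ (le_addr _ _ _) fun i hi => by
    rw [Ne, addr_inj hj hi]; omega
  have hpinv0 : ∀ i < d, ∀ j < d, pinvN d σ₂ i j = 0 := fun i hi j hj =>
    hz _ (le_addr _ _ _) fun i' hi' => by rw [Ne, addr_inj hj hi']; omega
  have hproj0 : ∀ i j : Fin d, projN d σ₂ i j = (1 : Matrix (Fin d) (Fin d) ℝ) i j := by
    intro i j
    rw [Matrix.one_apply, projN]
    split_ifs with hij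
    · rw [hij]; exact b3 j j.2
    · refine hz _ (le_addr _ _ _) fun i' hi' => ?_
      rw [Ne, addr_inj j.2 hi']
      rw [Fin.ext_iff] at hij
      omega
  refine Run.seq ((scan_run hL (φ := fun σ' => Run L I _ σ' _ _) ?_).mono
    (Nat.mul_le_mul_right _ (Nat.mul_le_mul hd hd)) fun _ h => h)
  rintro σ₃ c1 c2 - ⟨c3, c4, c5⟩
  refine Run.seq ((initMean_run hL (φ := fun σ' => Run L I _ σ' _ _)
    fun σ₄ d1 d2 d3 => ?_).mono hN3 fun _ h => h)
  have e5 : σ₄.nat 5 = σ₃.nat 5 := d1 5 (by norm_num)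
  have e4 : ∀ x, x = 0 ∨ 6 ≤ x → σ₄.nat x = σ₀.nat x := fun x hx => by
    rw [d1 x (by omega), c1 x hx, b1 x (by omega), a1 x (by omega)]
  refine Run.seq (Run.setNat hL.fit hN2 (Or.inl ⟨by simp, ?_⟩) ?_)
  · exact (Nat.size_le_size (by simpa [e5] using c3.le)).trans hL.fit.card
  refine Run.seq (Run.setReal hL.fit hN2 (by simp; omega) ?_)
  obtain ⟨σ₅, hσ₅⟩ : ∃ σ₅, σ₅ = (σ₄.setNat I (.const 8) (.nat 5)).setReal I (.const 4)
    (.ofNat (.const 1)) := ⟨_, rfl⟩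
  rw [← hσ₅]
  have f1 : ∀ x, σ₅.nat x = if x = 8 then σ₃.nat 5 else σ₄.nat x := fun x => by
    rw [hσ₅, State.setReal_nat, State.setNat_nat]; simp [e5]
  have f2 : ∀ x, σ₅.real x = if x = 4 then 1 else σ₄.real x := fun x => by
    rw [hσ₅, State.setReal_real]; simp
  have f0 : σ₅.nat 0 = 0 := by
    rw [f1, if_neg (by norm_num), e4 0 (by norm_num), n0, if_neg (by norm_num)]
  have f9 : σ₅.nat 9 = base d := by
    rw [f1, if_neg (by norm_num), e4 9 (by norm_num), n0, if_pos rfl]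
  have f8 : σ₅.nat 8 = σ₃.nat 5 := by rw [f1, if_pos rfl]
  have farr : ∀ x, 12 ≤ x → (∀ j < d, x ≠ addr d 0 j) → σ₅.real x = σ₂.real x := fun x hx hx' => by
    rw [f2, if_neg (by omega), d2 x hx', c2 x (by omega)]
  have hrow : ∀ r j, j < d → 3 ≤ r → σ₅.real (addr d r j) = σ₂.real (addr d r j) :=
    fun r j hj hr => farr _ (le_addr _ _ _) fun j' hj' => by rw [Ne, addr_inj hj hj']; omega
  refine Run.seq (push_run hL hN2 f9 (by omega) (by rw [f8]; exact c3) fun σ₆ g1 g2 g3 g4 => ?_)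
  refine Run.setNat hL.fit hN2 (Or.inl ⟨by simp, ?_⟩) (h _ ?_)
  · exact hL.size_le (by simp)
  obtain ⟨i, hi⟩ : ∃ i : Fin I.A.card, i = ⟨σ₃.nat 5, c3⟩ := ⟨_, rfl⟩
  have hiv : (i : ℕ) = σ₃.nat 5 := by rw [hi]
  have hlt : ∀ r j, r < 3 + 2 * d → j < d → σ₆.real (addr d r j) = σ₅.real (addr d r j) :=
    fun r j hr hj => g3 _ (addr_lt hr hj)
  have hform : ∀ j : Fin I.A.card, pinvForm I σ₂ j =
      -(I.γ * ((I.A.action j).ofLp ⬝ᵥ I.θ.ofLp)) := by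
    intro j
    rw [pinvForm, Finset.sum_range, dotProduct, Finset.mul_sum, ← Finset.sum_neg_distrib]
    refine Finset.sum_congr rfl fun x _ => ?_
    rw [Finset.sum_eq_zero fun y hy => by
      rw [hpinv0 x x.2 y (Finset.mem_range.mp hy), zero_mul], add_zero, devN, hmean0 x x.2]
    simp [actN, thetaN]
  refine ⟨Pi.single i 1, 0, 1, 0, 1, Represents.of_eq (σ := σ₆) ?_
    (fun x _ h7 _ => by simp [h7]) fun x _ => rfl, ActionSet.Progress.single fun j => ?_,
    Or.inl ⟨by simp, rfl⟩⟩
  · refine ⟨by rw [g2, f0], ?_, ?_, ?_, fun j => ?_, fun i j => ?_, fun i j => ?_, fun a => ?_⟩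
    · rw [g1 6 (by norm_num) (by norm_num), f1, if_neg (by norm_num), e4 6 (by norm_num), n0,
        if_neg (by norm_num)]
    · rw [g1 9 (by norm_num) (by norm_num), f9]
    · rw [g3 5 (by omega), f2, if_neg (by norm_num), d2, c2 5 (by norm_num), hsm 5 (by norm_num),
        a3]
      intro j _
      have := le_addr d 0 j
      omega
    · rw [hlt 0 j (by omega) j.2, f2, if_neg (by have := le_addr d 0 j; omega), d3 j j.2,
        ActionSet.mean_single, hi]
      simp [actN, c3]
    · rw [pinvN, hlt _ _ (by omega) j.2, hrow _ _ j.2 (by omega)]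
      simpa [pinvN] using hpinv0 i i.2 j j.2
    · rw [projN, hlt _ _ (by omega) j.2, hrow _ _ j.2 (by omega)]
      exact hproj0 i j
    · rw [g4, weightN, f0, f8, f2, if_pos rfl, ← hiv, Pi.single_apply]
      simp [Fin.ext_iff, eq_comm]
  · have h1 := c5 j j.2
    rw [c4, ← hiv, hform, hform] at h1
    linarith

/-- Turns the list of weights into the output format. -/
def finish : Prog :=
  .seq (forTo 1 (.nat 9) (.setReal (.nat 1) (.ofNat (.const 0))))
    (.setNat (.const 0) (.add (.nat 9) (.nat 0)))

theorem finish_run {M : ℕ} (hL : L.Room I M) {σ : State} {φ : State → Prop}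
    (h9 : σ.nat 9 = base d) (hn : σ.nat 0 ≤ M)
    (h : ∀ σ', (∀ a : Fin I.A.card, σ'.weights I.A.card a = weightN d σ a) → φ σ') :
    Run L I finish σ (base d + 1) φ := by
  refine Run.seq ?_
  rw [← one_mul (base d + 1)]
  have hb := le_base' (d := d)
  refine Run.forTo hL.fit (by norm_num) le_rfl (base d) (hL.size_le (by omega))
    (fun k σ' => (∀ x, x ≠ 1 → σ'.nat x = σ.nat x) ∧
      (∀ x, σ'.real x = if x < k then 0 else σ.real x))
    (fun k σ' i => by simp [i.1, h9]) ?_ ?_ ?_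
  · exact ⟨fun x hx => by simp [hx], fun x => by simp⟩
  · rintro k σ' hk h1 ⟨i1, i2⟩
    refine Run.setReal hL.fit le_rfl (by simp [h1, hL.reals]; omega) ⟨h1,
      fun x hx => by simp [hx, i1], fun x => ?_⟩
    simp only [State.put_real, State.setReal_real, NExp.cell_val, const_val, h1, ofNat_val,
      Nat.cast_zero, i2]
    rcases lt_trichotomy x k with h' | rfl | h'
    · rw [if_neg (by omega), if_pos h', if_pos (by omega)]
    · rw [if_pos rfl, if_pos (by omega)]
    · rw [if_neg (by omega), if_neg (by omega), if_neg (by omega)]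
  · rintro σ' h1 ⟨i1, i2⟩
    have e0 : σ'.nat 0 = σ.nat 0 := i1 0 (by norm_num)
    have e9 : σ'.nat 9 = base d := by rw [i1 9 (by norm_num), h9]
    refine Run.setNat hL.fit (by omega) (Or.inl ⟨by simp, ?_⟩) (h _ fun a => ?_)
    · exact hL.size_le (by simp [e0, e9]; omega)
    · have z : (σ'.setNat I (.const 0) (.add (.nat 9) (.nat 0))).nat 0 = base d + σ.nat 0 := by
        simp [e0, e9]
      rw [State.weights, z, Finset.sum_range_add, weightN, Finset.sum_eq_zero, zero_add]
      · refine Finset.sum_congr rfl fun t _ => ?_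
        have e1 : (σ'.setNat I (.const 0) (.add (.nat 9) (.nat 0))).nat (base d + t + 1) =
            σ.nat (base d + 1 + t) := by
          rw [State.setNat_nat, const_val, if_neg (by omega), i1 _ (by omega)]
          congr 1
          omega
        have e2 : σ'.real (base d + t) = σ.real (base d + t) := by rw [i2, if_neg (by omega)]
        rw [e1, State.setNat_real, e2]
      · intro t ht
        rw [State.setNat_real, i2, if_pos (Finset.mem_range.mp ht), ite_self]

/-- The program. -/
def barrierProg : Prog := .seq prepare (.seq optimize finish)

end RAM

namespace RAM

variable {d : ℕ} {I : BarrierInput d} {L : Limits}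

open ActionSet in
theorem barrierProg_run {M : ℕ} (hL : L.Room I M) (hγ : 0 < I.γ)
    (hM : ∀ n : ℕ, (n : ℝ) ≤ d + 1 + 72 * gapBound I.A I.θ I.γ → n ≤ M)
    {φ : State → Prop}
    (h : ∀ σ' p K Q r, σ'.weights I.A.card = p → I.A.Design p K Q r →
      (∀ i, Q.mulVec (I.A.dev p i) = 0) →
      (∀ i, I.A.dev p i ⬝ᵥ K.mulVec (I.A.dev p i) - I.γ * (I.A.dev p i ⬝ᵥ I.θ.ofLp)
        ≤ 2 * I.A.dim) → φ σ') :
    Run L I barrierProg State.init (L.nats * L.nats * (I.A.card + 1) * (M + 1)) φ := by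
  have hb : base d + 1 ≤ L.nats := by rw [hL.nats]; omega
  refine Run.seq ((prepare_run hL (φ := fun σ' => Run L I _ σ' _ _) fun σ₁ h1 => ?_).mono
    (Nat.le_mul_of_pos_right _ M.succ_pos) fun _ h => h)
  refine Run.seq (optimize_run hL hγ hM h1 fun σ₂ p K Q r m hR hm hD hQ hs => ?_)
  refine (finish_run hL hR.start (hR.length ▸ hm) fun σ₃ h3 => ?_).mono ?_ fun _ h => h
  · refine h σ₃ p K Q r (funext fun a => ?_) hD hQ hs
    rw [h3, hR.weight]
  · calc base d + 1 ≤ L.nats * L.nats := hb.trans (Nat.le_mul_of_pos_left _ (by omega))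
      _ ≤ L.nats * L.nats * (I.A.card + 1) := Nat.le_mul_of_pos_right _ (Nat.succ_pos _)
      _ ≤ _ := Nat.le_mul_of_pos_right _ M.succ_pos

theorem Limits.holds_init (L : Limits) (I : BarrierInput d) : L.Holds I State.init := by
  constructor <;> simp

theorem _root_.Nat.size_le_one_add_log {n : ℕ} (hn : 0 < n) :
    (n.size : ℝ) ≤ 2 * (1 + Real.log n) := by
  have h1 : 2 ^ (n.size - 1) ≤ n := by
    by_contra hc
    have := Nat.size_le.mpr (not_le.mp hc)
    have := Nat.size_pos.mpr hn
    omega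
  have h2 : ((n.size - 1 : ℕ) : ℝ) * Real.log 2 ≤ Real.log n := by
    rw [← Real.log_pow]
    refine Real.log_le_log (by positivity) ?_
    exact_mod_cast h1
  have h3 : (n.size : ℝ) = ((n.size - 1 : ℕ) : ℝ) + 1 := by
    have := Nat.size_pos.mpr hn
    rw [Nat.cast_sub this]; simp
  have h4 := Real.log_two_gt_d9
  have h5 : (0 : ℝ) ≤ ((n.size - 1 : ℕ) : ℝ) := Nat.cast_nonneg _
  rw [h3]
  nlinarith

/-- The number of steps of the main loop is at most this. -/
noncomputable def maxSteps (d : ℕ) (x : ℝ) : ℕ := ⌊512 * (d : ℝ) ^ 2 * (1 + Real.log (1 + x))⌋₊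

/-- Limits for the working memory of the program. -/
noncomputable def barrierLimits (I : BarrierInput d) : Limits where
  bits := I.A.card.size + (base d + maxSteps d (I.γ * ‖I.θ‖) + 2)
  nats := base d + maxSteps d (I.γ * ‖I.θ‖) + 2
  reals := base d + maxSteps d (I.γ * ‖I.θ‖) + 1

theorem _root_.Nat.size_le_self (n : ℕ) : n.size ≤ n :=
  Nat.size_le.mpr Nat.lt_two_pow_self

theorem barrierLimits_room (I : BarrierInput d) :
    (barrierLimits I).Room I (maxSteps d (I.γ * ‖I.θ‖)) where
  fit :=
    { one_le := by simp only [barrierLimits]; omega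
      card := Nat.le_add_right _ _
      dim := by
        have h1 := Nat.size_le_self d
        have h2 := le_base d
        simp only [barrierLimits]; omega
      nats := by
        have := le_base' (d := d)
        simp only [barrierLimits]; omega }
  nats := rfl
  reals := rfl
  size_nats := (Nat.size_le_self _).trans (Nat.le_add_left _ _)

theorem barrierLimits_nats_le (hd : 0 < d) {x : ℝ} (hx : 0 ≤ x) :
    ((base d + maxSteps d x + 2 : ℕ) : ℝ) ≤ 531 * (d : ℝ) ^ 2 * (1 + Real.log (1 + x)) := by
  have hl : 0 ≤ Real.log (1 + x) := Real.log_nonneg (by linarith)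
  have hd1 : (1 : ℝ) ≤ d := by exact_mod_cast hd
  have h1 : (maxSteps d x : ℝ) ≤ 512 * (d : ℝ) ^ 2 * (1 + Real.log (1 + x)) :=
    Nat.floor_le (by positivity)
  have h2 : (0 : ℝ) ≤ (d : ℝ) ^ 2 * Real.log (1 + x) := by positivity
  push_cast [base]
  nlinarith

theorem barrierProg_computes :
    ∃ C : ℝ, ∀ (d : ℕ) (A : ActionSet d) (θ : EuclideanSpace ℝ (Fin d)) (γ : ℝ), 0 < d → 0 < γ →
        ∃ (p : Fin A.card → ℝ) (time memory : ℕ),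
          barrierProg.Computes ⟨A, θ, γ⟩ p time memory ∧
          (time : ℝ) ≤ C * A.card * (d : ℝ) ^ 10 *
            ((1 + Real.log A.card) * (1 + Real.log (1 + γ * ‖θ‖))) ^ 10 ∧
          (memory : ℝ) ≤ C * (1 + Real.log A.card) * (d : ℝ) ^ 10 *
            (1 + Real.log (1 + γ * ‖θ‖)) ∧
          p ∈ A.Dist ∧
          (∀ q ∈ A.Dist, A.barrier θ γ p ≤ A.barrier θ γ q + (((A.dim : ℝ) / γ : ℝ) : EReal)) ∧
          (∀ (i : Fin A.card) (θ' : EuclideanSpace ℝ (Fin d)),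
            inner ℝ (A.mean p - A.action i) θ' - γ / 4 * quadForm (A.cov p) (θ - θ')
              ≤ 2 * ((A.dim : ℝ) / γ)) := by
  refine ⟨32 * 531 ^ 5 * barrierProg.wt + 36000, fun d A θ γ hd hγ => ?_⟩
  obtain ⟨I, hI⟩ : ∃ I : BarrierInput d, I = ⟨A, θ, γ⟩ := ⟨_, rfl⟩
  obtain ⟨x, hx⟩ : ∃ x, x = γ * ‖θ‖ := ⟨_, rfl⟩
  have hx0 : 0 ≤ x := by rw [hx]; positivity
  obtain ⟨G, hG⟩ : ∃ G, G = 1 + Real.log (1 + x) := ⟨_, rfl⟩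
  obtain ⟨l, hl⟩ : ∃ l, l = 1 + Real.log A.card := ⟨_, rfl⟩
  have hG1 : 1 ≤ G := by
    have : 0 ≤ Real.log (1 + x) := Real.log_nonneg (by linarith)
    rw [hG]; linarith
  have hc1 : (1 : ℝ) ≤ A.card := by exact_mod_cast A.card_pos
  have hl1 : 1 ≤ l := by
    have := Real.log_nonneg hc1
    rw [hl]; linarith
  have hd1 : (1 : ℝ) ≤ d := by exact_mod_cast hd
  obtain ⟨M, hMe⟩ : ∃ M, M = maxSteps d x := ⟨_, rfl⟩
  obtain ⟨n, hn⟩ : ∃ n, n = base d + M + 2 := ⟨_, rfl⟩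
  have hIA : I.A = A := by rw [hI]
  have hroom : (barrierLimits I).Room I M := by
    have := barrierLimits_room I
    rwa [hI, ← hx, ← hMe, ← hI] at this
  have hM : ∀ m : ℕ, (m : ℝ) ≤ d + 1 + 72 * A.gapBound θ γ → m ≤ M := fun m hm => by
    rw [hMe, hx]
    exact Nat.le_floor (hm.trans (A.gapBound_le hd θ hγ))
  subst hI
  obtain ⟨σ', t, m, h1, h2, h3, -, p, hp, hdist, hbar, htr⟩ := barrierProg_run hroom hγ hM
    (φ := fun σ' => ∃ p, σ'.weights A.card = p ∧ p ∈ A.Dist ∧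
      (∀ q ∈ A.Dist, A.barrier θ γ p ≤ A.barrier θ γ q + (((A.dim : ℝ) / γ : ℝ) : EReal)) ∧
      (∀ (i : Fin A.card) (θ' : EuclideanSpace ℝ (Fin d)),
        inner ℝ (A.mean p - A.action i) θ' - γ / 4 * quadForm (A.cov p) (θ - θ')
          ≤ 2 * ((A.dim : ℝ) / γ)))
    (fun σ' p K Q r hp hD hQ hs => ⟨p, hp, hD.mem, fun q hq => hD.barrier_le hQ θ hγ hs hq,
      fun i θ' => hD.tradeoff_le hQ θ hγ hs i θ'⟩) (Limits.holds_init _ _)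
  have hnats : (barrierLimits ⟨A, θ, γ⟩).nats = n := by rw [hroom.nats, hn]
  have hreals : (barrierLimits ⟨A, θ, γ⟩).reals ≤ n := by rw [hroom.reals, hn]; omega
  have hbits : (barrierLimits ⟨A, θ, γ⟩).bits = A.card.size + n := by
    rw [hn, hMe, hx]; rfl
  have hnG : (n : ℝ) ≤ 531 * (d : ℝ) ^ 2 * G := by
    rw [hn, hMe, hG]; exact barrierLimits_nats_le hd hx0
  have hs : (A.card.size : ℝ) ≤ 2 * l := by rw [hl]; exact Nat.size_le_one_add_log A.card_pos
  have hs1 : 1 ≤ A.card.size := Nat.size_pos.mpr A.card_pos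
  have hn1 : 1 ≤ n := by omega
  refine ⟨p, t, m, ⟨σ', h1, hp.symm⟩, ?_, ?_, hdist, hbar, htr⟩
  · rw [← hx, ← hG, ← hl]
    have e1 : t ≤ (n * n * (A.card + 1) * (M + 1)) * barrierProg.wt * (A.card.size + n) ^ 2 := by
      rw [hnats, hbits] at h2; exact h2
    have e2 : (n * n * (A.card + 1) * (M + 1)) * barrierProg.wt * (A.card.size + n) ^ 2
        ≤ (n * n * (2 * A.card) * n) * barrierProg.wt * (2 * (A.card.size * n)) ^ 2 := by
      have := A.card_pos
      gcongr
      · omega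
      · omega
      · nlinarith
    have e3 : (t : ℝ) ≤ ((n * n * (2 * A.card) * n) * barrierProg.wt *
        (2 * (A.card.size * n)) ^ 2 : ℝ) := by exact_mod_cast e1.trans e2
    refine e3.trans ?_
    calc ((n * n * (2 * A.card) * n) * barrierProg.wt * (2 * (A.card.size * n)) ^ 2 : ℝ)
        = 8 * barrierProg.wt * A.card * (n : ℝ) ^ 5 * (A.card.size : ℝ) ^ 2 := by ring
      _ ≤ 8 * barrierProg.wt * A.card * (531 * (d : ℝ) ^ 2 * G) ^ 5 * (2 * l) ^ 2 := by gcongr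
      _ = (32 * 531 ^ 5 * barrierProg.wt) * A.card * (d : ℝ) ^ 10 * (l ^ 2 * G ^ 5) := by ring
      _ ≤ (32 * 531 ^ 5 * barrierProg.wt + 36000) * A.card * (d : ℝ) ^ 10 * (l ^ 10 * G ^ 10) := by
          gcongr
          · linarith
          · norm_num
          · norm_num
      _ = _ := by rw [mul_pow]
  · rw [← hx, ← hG, ← hl]
    have e1 : m ≤ 10 * (1 + (A.card.size + n)) + n * (1 + A.card.size) + n := by
      have := h3
      rw [Limits.memory, hnats, hbits] at this
      change m ≤ 10 * (1 + (A.card.size + n)) + n * (1 + A.card.size) + _ at this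
      omega
    have e2 : 10 * (1 + (A.card.size + n)) + n * (1 + A.card.size) + n ≤ 33 * (n * A.card.size) := by
      nlinarith
    have e3 : (m : ℝ) ≤ 33 * (n * A.card.size) := by exact_mod_cast e1.trans e2
    calc (m : ℝ) ≤ 33 * (n * A.card.size) := e3
      _ ≤ 33 * ((531 * (d : ℝ) ^ 2 * G) * (2 * l)) := by gcongr
      _ = 35046 * l * (d : ℝ) ^ 2 * G := by ring
      _ ≤ _ := by
        have : (0 : ℝ) ≤ 32 * 531 ^ 5 * barrierProg.wt := by positivity
        gcongr
        · linarith
        · norm_num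

end RAM

section

variable {Ω : Type*} {mΩ : MeasurableSpace Ω} {ℙ : Measure Ω} [IsProbabilityMeasure ℙ]
  {m : MeasurableSpace Ω} {n : ℕ}

theorem apply_eq_sum_indicator (X : Ω → Fin n) (g : Fin n → Ω → ℝ) :
    (fun ω => g (X ω) ω) =
      fun ω => ∑ i, (X ⁻¹' {i}).indicator (fun _ => (1 : ℝ)) ω * g i ω := by
  funext ω
  rw [Finset.sum_eq_single (X ω)]
  · simp
  · intro i _ hi
    rw [Set.indicator_of_notMem, zero_mul]
    simpa using hi.symm
  · simp

theorem measurable_apply_fin {X : Ω → Fin n} (hX : Measurable[m] X) {g : Fin n → Ω → ℝ}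
    (hg : ∀ i, Measurable[m] (g i)) : Measurable[m] fun ω => g (X ω) ω := by
  rw [apply_eq_sum_indicator]
  refine Finset.measurable_sum _ fun i _ => Measurable.mul ?_ (hg i)
  exact measurable_const.indicator (hX (measurableSet_singleton i))

theorem integral_sampled (hm : m ≤ mΩ) {X : Ω → Fin n} (hX : Measurable[mΩ] X) {q : Ω → Fin n → ℝ}
    (hq : ∀ i, ℙ[(X ⁻¹' {i}).indicator (fun _ => (1 : ℝ)) | m] =ᵐ[ℙ] fun ω => q ω i)
    {g : Fin n → Ω → ℝ} (hg : ∀ i, Measurable[m] (g i)) {B : ℝ} (hB : ∀ i ω, |g i ω| ≤ B) :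
    Integrable (fun ω => ∑ i, q ω i * g i ω) ℙ ∧
      ∫ ω, g (X ω) ω ∂ℙ = ∫ ω, ∑ i, q ω i * g i ω ∂ℙ := by
  have hind : ∀ i, Integrable ((X ⁻¹' {i}).indicator (fun _ => (1 : ℝ))) ℙ := fun i =>
    (integrable_const 1).indicator (hX (measurableSet_singleton i))
  have hmul : ∀ i, Integrable ((X ⁻¹' {i}).indicator (fun _ => (1 : ℝ)) * g i) ℙ := fun i => by
    refine (hind i).mul_bdd (c := B) ((hg i).mono hm le_rfl).aestronglyMeasurable ?_
    exact Filter.Eventually.of_forall fun ω => hB i ω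
  have hce : ∀ i, ℙ[(X ⁻¹' {i}).indicator (fun _ => (1 : ℝ)) * g i | m] =ᵐ[ℙ]
      fun ω => q ω i * g i ω := fun i => by
    refine (condExp_mul_of_stronglyMeasurable_right (hg i).stronglyMeasurable (hmul i)
      (hind i)).trans ?_
    filter_upwards [hq i] with ω hω
    rw [Pi.mul_apply, hω]
  have hint : ∀ i, Integrable (fun ω => q ω i * g i ω) ℙ := fun i =>
    integrable_condExp.congr (hce i)
  refine ⟨integrable_finsetSum _ fun i _ => hint i, ?_⟩
  have hmul' : ∀ i, Integrable (fun ω => (X ⁻¹' {i}).indicator (fun _ => (1 : ℝ)) ω * g i ω) ℙ :=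
    hmul
  rw [apply_eq_sum_indicator, integral_finsetSum _ fun i _ => hmul' i,
    integral_finsetSum _ fun i _ => hint i]
  refine Finset.sum_congr rfl fun i _ => ?_
  rw [← integral_congr_ae (hce i), integral_condExp hm]
  rfl

theorem integral_mul_eq_of_condExp (hm : m ≤ mΩ) {h l c : Ω → ℝ} (hh : Measurable[m] h)
    (hl : Integrable l ℙ) (hc : ℙ[l | m] =ᵐ[ℙ] c) {B : ℝ} (hB : ∀ ω, |h ω| ≤ B) :
    ∫ ω, h ω * l ω ∂ℙ = ∫ ω, h ω * c ω ∂ℙ := by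
  have hmul : Integrable (h * l) ℙ :=
    hl.bdd_mul (c := B) (hh.mono hm le_rfl).aestronglyMeasurable
      (Filter.Eventually.of_forall fun ω => hB ω)
  have := condExp_mul_of_stronglyMeasurable_left hh.stronglyMeasurable hmul hl
  rw [show (∫ ω, h ω * l ω ∂ℙ) = ∫ ω, (h * l) ω ∂ℙ from rfl, ← integral_condExp hm]
  refine integral_congr_ae ?_
  filter_upwards [this, hc] with ω h1 h2
  rw [h1, Pi.mul_apply, h2]

end

namespace ActionSet

variable {d : ℕ} {A : ActionSet d}

theorem quadForm_cov_le (p : Fin A.card → ℝ) (u : EuclideanSpace ℝ (Fin d)) :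
    quadForm (A.cov p) u ≤ ∑ i, p i * (inner ℝ (A.action i) u) ^ 2 := by
  have h : quadForm (A.cov p) u =
      ∑ i, p i * (inner ℝ (A.action i) u) ^ 2 - ((A.mean p).ofLp ⬝ᵥ u.ofLp) ^ 2 := by
    simp only [quadForm, cov, secondMoment, Matrix.sub_mulVec, dotProduct_sub, Matrix.sum_mulVec,
      dotProduct_sum, Matrix.smul_mulVec, dotProduct_smul, Matrix.vecMulVec_mulVec,
      EuclideanSpace.inner_eq_dotProduct]
    congr 1
    · refine Finset.sum_congr rfl fun i _ => ?_
      simp [dotProduct_comm u.ofLp]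
      ring_nf
      simp
    · simp [dotProduct_comm u.ofLp]
      ring
  rw [h]
  linarith [sq_nonneg ((A.mean p).ofLp ⬝ᵥ u.ofLp)]

theorem inner_mean (p : Fin A.card → ℝ) (u : EuclideanSpace ℝ (Fin d)) :
    inner ℝ (A.mean p) u = ∑ i, p i * inner ℝ (A.action i) u := by
  simp [mean, sum_inner, inner_smul_left]

/-- The one-round regret of a distribution with a good exploration-exploitation tradeoff. -/
theorem regret_le {p : Fin A.card → ℝ} (hp : p ∈ A.Dist) {θ f : EuclideanSpace ℝ (Fin d)} {γ D : ℝ}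
    (hγ : 0 < γ)
    (h : ∀ i, inner ℝ (A.mean p - A.action i) f - γ / 4 * quadForm (A.cov p) (θ - f) ≤ D)
    {ν : Fin A.card → ℝ} {s : ℝ} (hs : ∀ i, |inner ℝ (A.action i) f - ν i| ≤ s)
    (i : Fin A.card) :
    ∑ j, p j * ν j - ν i ≤ D + γ / 4 * ∑ j, p j * (inner ℝ (A.action j) (θ - f)) ^ 2 + 2 * s := by
  have h1 := h i
  rw [inner_sub_left, inner_mean] at h1
  have h2 : γ / 4 * quadForm (A.cov p) (θ - f)
      ≤ γ / 4 * ∑ j, p j * (inner ℝ (A.action j) (θ - f)) ^ 2 :=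
    mul_le_mul_of_nonneg_left (quadForm_cov_le p _) (by positivity)
  have h3 : ∑ j, p j * ν j ≤ ∑ j, p j * inner ℝ (A.action j) f + s := by
    have : ∑ j, p j * ν j ≤ ∑ j, p j * (inner ℝ (A.action j) f + s) :=
      Finset.sum_le_sum fun j _ => mul_le_mul_of_nonneg_left
        (by have := (abs_le.mp (hs j)).1; linarith) (hp.1 j)
    simp only [mul_add, Finset.sum_add_distrib, ← Finset.sum_mul, hp.2, one_mul] at this
    exact this
  have h4 := (abs_le.mp (hs i)).2
  linarith

end ActionSet

section

variable {Ω : Type*} {mΩ : MeasurableSpace Ω} {ℙ : Measure Ω} [IsProbabilityMeasure ℙ]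
  {m : MeasurableSpace Ω} {d : ℕ} {A : ActionSet d}

theorem integrable_apply_fin {n : ℕ} {X : Ω → Fin n} (hX : Measurable[mΩ] X) {g : Fin n → Ω → ℝ}
    (hg : ∀ i, Measurable[mΩ] (g i)) {B : ℝ} (hB : ∀ i ω, |g i ω| ≤ B) :
    Integrable (fun ω => g (X ω) ω) ℙ :=
  Integrable.of_bound (measurable_apply_fin hX hg).aestronglyMeasurable B
    (Filter.Eventually.of_forall fun ω => hB _ ω)

theorem exists_abs_le_fin {n : ℕ} (c : Fin n → ℝ) : ∃ B, ∀ i, |c i| ≤ B :=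
  ⟨∑ i, |c i|, fun i => Finset.single_le_sum (f := fun i => |c i|) (fun _ _ => abs_nonneg _)
    (Finset.mem_univ i)⟩

namespace ActionSet

variable {θ : Ω → EuclideanSpace ℝ (Fin d)}

theorem measurable_inner_sub (hθ : Measurable[m] θ) (f : EuclideanSpace ℝ (Fin d))
    (i : Fin A.card) : Measurable[m] fun ω => inner ℝ (A.action i) (θ ω - f) := by
  have h : Continuous fun u : EuclideanSpace ℝ (Fin d) => inner ℝ (A.action i) (u - f) := by
    fun_prop
  exact h.measurable.comp hθ

theorem abs_inner_sub_le {B : ℝ} (hB : ∀ i ω, |inner ℝ (A.action i) (θ ω)| ≤ B)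
    (f : EuclideanSpace ℝ (Fin d)) (i : Fin A.card) (ω : Ω) :
    |inner ℝ (A.action i) (θ ω - f)| ≤ B + ‖f‖ := by
  rw [inner_sub_right]
  have h1 := (abs_real_inner_le_norm (A.action i) f).trans
    (mul_le_of_le_one_left (norm_nonneg f) (A.norm_le_one i))
  exact (abs_sub _ _).trans (add_le_add (hB i ω) h1)

theorem integral_regret_le (hm : m ≤ mΩ) {X : Ω → Fin A.card} (hX : Measurable[mΩ] X)
    {q : Ω → Fin A.card → ℝ}
    (hq : ∀ i, ℙ[(X ⁻¹' {i}).indicator (fun _ => (1 : ℝ)) | m] =ᵐ[ℙ] fun ω => q ω i)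
    (hqd : ∀ ω, q ω ∈ A.Dist) (hθ : Measurable[m] θ) {B : ℝ}
    (hB : ∀ i ω, |inner ℝ (A.action i) (θ ω)| ≤ B) {f : EuclideanSpace ℝ (Fin d)} {γ D : ℝ}
    (hγ : 0 < γ)
    (h : ∀ ω i, inner ℝ (A.mean (q ω) - A.action i) f
      - γ / 4 * quadForm (A.cov (q ω)) (θ ω - f) ≤ D)
    {ν : Fin A.card → ℝ} {s : ℝ} (hs : ∀ i, |inner ℝ (A.action i) f - ν i| ≤ s) :
    ∫ ω, (ν (X ω) - ⨅ i, ν i) ∂ℙ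
      ≤ D + γ / 4 * ∫ ω, (inner ℝ (A.action (X ω)) (θ ω - f)) ^ 2 ∂ℙ + 2 * s := by
  have : Nonempty (Fin A.card) := ⟨⟨0, A.card_pos⟩⟩
  obtain ⟨i, hi⟩ := exists_eq_ciInf_of_finite (f := ν)
  obtain ⟨c, hc⟩ := exists_abs_le_fin ν
  obtain ⟨h1, h2⟩ := integral_sampled (ℙ := ℙ) hm hX hq (g := fun i _ => ν i)
    (fun i => measurable_const) (fun i _ => hc i)
  obtain ⟨h3, h4⟩ := integral_sampled (ℙ := ℙ) hm hX hq
    (g := fun i ω => (inner ℝ (A.action i) (θ ω - f)) ^ 2)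
    (fun i => (measurable_inner_sub hθ f i).pow_const 2) (B := (B + ‖f‖) ^ 2)
    (fun i ω => by
      rw [abs_pow]
      exact pow_le_pow_left₀ (abs_nonneg _) (abs_inner_sub_le hB f i ω) 2)
  have h5 : Integrable (fun ω => ν (X ω)) ℙ :=
    integrable_apply_fin hX (g := fun i _ => ν i) (fun i => measurable_const) (fun i _ => hc i)
  rw [integral_sub h5 (integrable_const _), h2, h4, ← hi, integral_const, probReal_univ, one_smul]
  have h6 : ∫ ω, ∑ j, q ω j * ν j ∂ℙ ≤ ∫ ω, ((ν i + D + 2 * s) + γ / 4 *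
      ∑ j, q ω j * (inner ℝ (A.action j) (θ ω - f)) ^ 2) ∂ℙ := by
    refine integral_mono h1 ((integrable_const _).add (h3.const_mul _)) fun ω => ?_
    have := regret_le (hqd ω) hγ (h ω) hs i
    dsimp only
    linarith
  rw [integral_add (integrable_const _) (h3.const_mul _), integral_const_mul, integral_const,
    probReal_univ, one_smul] at h6
  linarith

theorem integral_cross_ge (hm : m ≤ mΩ) {X : Ω → Fin A.card} (hX : Measurable[mΩ] X)
    (hθ : Measurable[m] θ) {B : ℝ}
    (hB : ∀ i ω, |inner ℝ (A.action i) (θ ω)| ≤ B) {f : EuclideanSpace ℝ (Fin d)}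
    {ν : Fin A.card → ℝ} {s : ℝ} (hs : ∀ i, (inner ℝ (A.action i) f - ν i) ^ 2 ≤ s)
    {l : Ω → ℝ} (hl : Integrable l ℙ)
    (hlm : ℙ[l | m ⊔ MeasurableSpace.comap X ⊤] =ᵐ[ℙ] fun ω => ν (X ω)) :
    Integrable (fun ω => (inner ℝ (A.action (X ω)) (θ ω - f)) ^ 2 +
        2 * (inner ℝ (A.action (X ω)) (θ ω - f) * (inner ℝ (A.action (X ω)) f - l ω))) ℙ ∧
      (∫ ω, (inner ℝ (A.action (X ω)) (θ ω - f)) ^ 2 ∂ℙ) / 2 - 2 * s ≤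
      ∫ ω, ((inner ℝ (A.action (X ω)) (θ ω - f)) ^ 2 +
        2 * (inner ℝ (A.action (X ω)) (θ ω - f) * (inner ℝ (A.action (X ω)) f - l ω))) ∂ℙ := by
  have hX' : Measurable[m ⊔ MeasurableSpace.comap X ⊤] X :=
    (comap_measurable X).mono le_sup_right le_rfl
  have hm' : m ⊔ MeasurableSpace.comap X ⊤ ≤ mΩ := sup_le hm hX.comap_le
  obtain ⟨c, hc⟩ := exists_abs_le_fin ν
  obtain ⟨c', hc'⟩ := exists_abs_le_fin fun i => inner ℝ (A.action i) f
  have hgm : ∀ i, Measurable[m ⊔ MeasurableSpace.comap X ⊤]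
      fun ω => inner ℝ (A.action i) (θ ω - f) :=
    fun i => (measurable_inner_sub hθ f i).mono le_sup_left le_rfl
  have hg : ∀ i, Measurable[mΩ] fun ω => inner ℝ (A.action i) (θ ω - f) :=
    fun i => (hgm i).mono hm' le_rfl
  have hb := abs_inner_sub_le hB f
  have hGm : Measurable[m ⊔ MeasurableSpace.comap X ⊤]
      fun ω => inner ℝ (A.action (X ω)) (θ ω - f) :=
    measurable_apply_fin (g := fun i ω => inner ℝ (A.action i) (θ ω - f)) hX' hgm
  have hint2 : Integrable (fun ω => (inner ℝ (A.action (X ω)) (θ ω - f)) ^ 2) ℙ :=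
    integrable_apply_fin (g := fun i ω => (inner ℝ (A.action i) (θ ω - f)) ^ 2) hX
      (fun i => (hg i).pow_const 2) (B := (B + ‖f‖) ^ 2) fun i ω => by
        rw [abs_pow]
        exact pow_le_pow_left₀ (abs_nonneg _) (hb i ω) 2
  have hintc : ∀ (b : Fin A.card → ℝ), Integrable
      (fun ω => inner ℝ (A.action (X ω)) (θ ω - f) * b (X ω)) ℙ := fun b => by
    obtain ⟨c, hc⟩ := exists_abs_le_fin b
    refine integrable_apply_fin (g := fun i ω => inner ℝ (A.action i) (θ ω - f) * b i) hX
      (fun i => (hg i).mul_const _) (B := (B + ‖f‖) * c) fun i ω => ?_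
    rw [abs_mul]
    exact mul_le_mul (hb i ω) (hc i) (abs_nonneg _) ((abs_nonneg _).trans (hb i ω))
  have hintl : Integrable (fun ω => inner ℝ (A.action (X ω)) (θ ω - f) * l ω) ℙ :=
    hl.bdd_mul (c := B + ‖f‖) (hGm.mono hm' le_rfl).aestronglyMeasurable
      (Filter.Eventually.of_forall fun ω => hb _ ω)
  have hswap := integral_mul_eq_of_condExp (ℙ := ℙ) hm' hGm hl hlm (fun ω => hb _ ω)
  have hcross : Integrable (fun ω => 2 * (inner ℝ (A.action (X ω)) (θ ω - f) *
      (inner ℝ (A.action (X ω)) f - l ω))) ℙ := by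
    simp only [mul_sub]
    exact ((hintc fun i => inner ℝ (A.action i) f).sub hintl).const_mul 2 |>.congr
      (Filter.Eventually.of_forall fun ω => by simp [mul_sub])
  refine ⟨hint2.add hcross, ?_⟩
  have e1 : ∫ ω, 2 * (inner ℝ (A.action (X ω)) (θ ω - f) *
      (inner ℝ (A.action (X ω)) f - l ω)) ∂ℙ =
      2 * ∫ ω, inner ℝ (A.action (X ω)) (θ ω - f) *
        (inner ℝ (A.action (X ω)) f - ν (X ω)) ∂ℙ := by
    rw [integral_const_mul]
    simp only [mul_sub]
    rw [integral_sub (hintc fun i => inner ℝ (A.action i) f) hintl,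
      integral_sub (hintc fun i => inner ℝ (A.action i) f) (hintc ν), hswap]
  have hintd : Integrable (fun ω => inner ℝ (A.action (X ω)) (θ ω - f) *
      (inner ℝ (A.action (X ω)) f - ν (X ω))) ℙ :=
    hintc fun i => inner ℝ (A.action i) f - ν i
  have e2 : ∫ ω, ((-1 / 4) * (inner ℝ (A.action (X ω)) (θ ω - f)) ^ 2 - s) ∂ℙ ≤
      ∫ ω, inner ℝ (A.action (X ω)) (θ ω - f) *
        (inner ℝ (A.action (X ω)) f - ν (X ω)) ∂ℙ := by
    refine integral_mono ((hint2.const_mul _).sub (integrable_const _)) hintd fun ω => ?_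
    have := hs (X ω)
    dsimp only
    nlinarith [sq_nonneg (inner ℝ (A.action (X ω)) (θ ω - f) / 2 +
      (inner ℝ (A.action (X ω)) f - ν (X ω)))]
  rw [integral_sub (hint2.const_mul _) (integrable_const _), integral_const_mul, integral_const,
    probReal_univ, one_smul] at e2
  rw [integral_add hint2 hcross, e1]
  linarith

end ActionSet

end

namespace RegressionOracle

variable {d : ℕ} {X : Type*} {alg : RegressionOracle d X} {F : Set (X → EuclideanSpace ℝ (Fin d))}
  {T : ℕ} {R : ℝ}

theorem predict_update (x : ℕ → X) (a : ℕ → EuclideanSpace ℝ (Fin d)) (l : ℕ → ℝ) (t : ℕ)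
    (v : EuclideanSpace ℝ (Fin d)) (w : ℝ) :
    alg.predict x (Function.update a t v) (Function.update l t w) t = alg.predict x a l t := by
  unfold predict
  congr 1
  refine List.map_congr_left fun s hs => ?_
  have : s ≠ t := (List.mem_range.mp hs).ne
  rw [Function.update_of_ne this, Function.update_of_ne this]

theorem RegretAtMost.sum_le (h : alg.RegretAtMost F T R) {f : X → EuclideanSpace ℝ (Fin d)}
    (hf : f ∈ F) (x : ℕ → X) {a : ℕ → EuclideanSpace ℝ (Fin d)} {l : ℕ → ℝ}
    (hal : ∀ t < T, ‖a t‖ ≤ 1 ∧ l t ∈ Set.Icc (-1 : ℝ) 1) :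
    ∑ t ∈ Finset.range T, (inner ℝ (a t) (alg.predict x a l t) - l t) ^ 2 ≤
      R + ∑ t ∈ Finset.range T, (inner ℝ (a t) (f (x t)) - l t) ^ 2 := by
  have h1 := h x a l hal
  have h2 : ⨅ f : F, ∑ t ∈ Finset.range T, (inner ℝ (a t) (f.1 (x t)) - l t) ^ 2 ≤
      ∑ t ∈ Finset.range T, (inner ℝ (a t) (f (x t)) - l t) ^ 2 :=
    ciInf_le ⟨0, by
      rintro _ ⟨g, rfl⟩
      exact Finset.sum_nonneg fun _ _ => sq_nonneg _⟩ (⟨f, hf⟩ : F)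
  linarith

/-- The predictions of an oracle with bounded regret are bounded along all directions. -/
theorem RegretAtMost.abs_inner_predict_le (h : alg.RegretAtMost F T R)
    {f : X → EuclideanSpace ℝ (Fin d)} (hf : f ∈ F) (x : ℕ → X)
    {a : ℕ → EuclideanSpace ℝ (Fin d)} {l : ℕ → ℝ}
    (hal : ∀ t < T, ‖a t‖ ≤ 1 ∧ l t ∈ Set.Icc (-1 : ℝ) 1) {t : ℕ} (ht : t < T)
    {v : EuclideanSpace ℝ (Fin d)} (hv : ‖v‖ ≤ 1) :
    |inner ℝ v (alg.predict x a l t)| ≤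
      1 + (R + ∑ s ∈ Finset.range T, (‖f (x s)‖ + 1) ^ 2) := by
  have hal' : ∀ s < T, ‖Function.update a t v s‖ ≤ 1 ∧
      Function.update l t 0 s ∈ Set.Icc (-1 : ℝ) 1 := by
    intro s hs
    by_cases hst : s = t
    · subst hst; simp [hv]
    · simpa [Function.update_of_ne hst] using hal s hs
  have h1 := h.sum_le hf x hal'
  have h2 := Finset.single_le_sum (f := fun s => (inner ℝ (Function.update a t v s)
    (alg.predict x (Function.update a t v) (Function.update l t 0) s) -
      Function.update l t 0 s) ^ 2) (fun _ _ => sq_nonneg _) (Finset.mem_range.mpr ht)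
  have h3 : ∑ s ∈ Finset.range T, (inner ℝ (Function.update a t v s) (f (x s)) -
      Function.update l t 0 s) ^ 2 ≤ ∑ s ∈ Finset.range T, (‖f (x s)‖ + 1) ^ 2 := by
    refine Finset.sum_le_sum fun s hs => ?_
    obtain ⟨g1, g2⟩ := hal' s (Finset.mem_range.mp hs)
    rw [← sq_abs]
    refine pow_le_pow_left₀ (abs_nonneg _) ((abs_sub _ _).trans (add_le_add ?_ (abs_le.mpr g2))) 2
    exact (abs_real_inner_le_norm _ _).trans (mul_le_of_le_one_left (norm_nonneg _) g1)
  simp only [predict_update, Function.update_self, sub_zero] at h2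
  have h4 : |inner ℝ v (alg.predict x a l t)| ≤ 1 + (inner ℝ v (alg.predict x a l t)) ^ 2 := by
    rw [← sq_abs]
    nlinarith [sq_nonneg (|inner ℝ v (alg.predict x a l t)| - 1 / 2)]
  linarith

end RegressionOracle

namespace IsInteraction

variable {Ω : Type*} {mΩ : MeasurableSpace Ω} {ℙ : Measure Ω} [IsProbabilityMeasure ℙ]
  {d T : ℕ} {X : Type*} {F : Set (X → EuclideanSpace ℝ (Fin d))} {alg : RegressionOracle d X}
  {R γ : ℝ} {μ : EuclideanSpace ℝ (Fin d) → X → ℝ} {x : ℕ → X} {A : ℕ → ActionSet d}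
  {ℱ : Filtration ℕ mΩ} {act : (t : ℕ) → Ω → Fin (A t).card}
  {dist : (t : ℕ) → Ω → Fin (A t).card → ℝ} {loss : ℕ → Ω → ℝ} {P : RAM.Prog}

theorem pseudoRegret_le_sum (h : IsInteraction P γ T alg μ x A ℙ ℱ act dist loss) (hγ : 0 < γ)
    (hdist : ∀ t < T, ∀ ω, dist t ω ∈ (A t).Dist)
    (htr : ∀ t < T, ∀ ω i θ', inner ℝ ((A t).mean (dist t ω) - (A t).action i) θ' -
      γ / 4 * quadForm ((A t).cov (dist t ω)) (banditPrediction alg x A act loss t ω - θ')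
        ≤ 2 * (d / γ))
    (hR : alg.RegretAtMost F T R) {f : X → EuclideanSpace ℝ (Fin d)} (hf : f ∈ F) {s : ℕ → ℝ}
    (hs : ∀ t i, |inner ℝ ((A t).action i) (f (x t)) - μ ((A t).action i) (x t)| ≤ s t) :
    pseudoRegret μ x A T ℙ act ≤ 2 * (d * T / γ) +
      γ / 4 * (2 * R + 4 * ∑ t ∈ Finset.range T, s t ^ 2) + 2 * ∑ t ∈ Finset.range T, s t := by
  have hal : ∀ ω, ∀ t < T, ‖(A t).action (act t ω)‖ ≤ 1 ∧ loss t ω ∈ Set.Icc (-1 : ℝ) 1 :=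
    fun ω t ht => ⟨(A t).norm_le_one _, h.loss_mem t ht ω⟩
  obtain ⟨B, hBe⟩ : ∃ B, B = 1 + (R + ∑ t ∈ Finset.range T, (‖f (x t)‖ + 1) ^ 2) := ⟨_, rfl⟩
  have hB : ∀ t < T, ∀ i ω,
      |inner ℝ ((A t).action i) (banditPrediction alg x A act loss t ω)| ≤ B := by
    intro t ht i ω
    rw [hBe]
    exact hR.abs_inner_predict_le hf x (hal ω) ht ((A t).norm_le_one i)
  have hX : ∀ t < T, Measurable[mΩ] (act t) := fun t ht =>
    (h.measurable_act t ht).mono (ℱ.le _) le_rfl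
  have hl : ∀ t < T, Integrable (loss t) ℙ := fun t ht =>
    Integrable.of_bound ((h.measurable_loss t ht).mono (ℱ.le _) le_rfl).aestronglyMeasurable 1
      (Filter.Eventually.of_forall fun ω => abs_le.mpr (h.loss_mem t ht ω))
  have hs2 : ∀ t i, (inner ℝ ((A t).action i) (f (x t)) - μ ((A t).action i) (x t)) ^ 2 ≤
      s t ^ 2 := fun t i => by
    rw [← sq_abs]
    exact pow_le_pow_left₀ (abs_nonneg _) (hs t i) 2
  obtain ⟨W, hW⟩ : ∃ W : ℕ → ℝ, W = fun t => ∫ ω, (inner ℝ ((A t).action (act t ω))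
    (banditPrediction alg x A act loss t ω - f (x t))) ^ 2 ∂ℙ := ⟨_, rfl⟩
  have hround : ∀ t < T, ∫ ω, (μ ((A t).action (act t ω)) (x t) -
      ⨅ i, μ ((A t).action i) (x t)) ∂ℙ ≤ 2 * (d / γ) + γ / 4 * W t + 2 * s t := by
    intro t ht
    rw [hW]
    exact ActionSet.integral_regret_le (ℱ.le t) (hX t ht) (h.sampled t ht) (hdist t ht)
      (h.measurable_prediction t ht) (hB t ht) hγ (fun ω i => htr t ht ω i (f (x t)))
      (ν := fun i => μ ((A t).action i) (x t)) (hs t)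
  have hcross := fun t ht => ActionSet.integral_cross_ge (ℱ.le t) (hX t ht)
    (h.measurable_prediction t ht) (hB t ht) (ν := fun i => μ ((A t).action i) (x t)) (hs2 t)
    (hl t ht) (h.loss_mean t ht)
  have hW' : ∀ t, W t = ∫ ω, (inner ℝ ((A t).action (act t ω))
    (banditPrediction alg x A act loss t ω - f (x t))) ^ 2 ∂ℙ := fun t => by rw [hW]
  have hcross' := fun t ht => (hcross t ht).2
  simp only [← hW'] at hcross'
  have hsum : ∑ t ∈ Finset.range T, W t ≤ 2 * R + 4 * ∑ t ∈ Finset.range T, s t ^ 2 := by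
    have h1 : ∑ t ∈ Finset.range T, (W t / 2 - 2 * s t ^ 2) ≤ R := by
      refine (Finset.sum_le_sum fun t ht =>
        hcross' t (Finset.mem_range.mp ht)).trans ?_
      rw [← integral_finsetSum _ fun t ht => (hcross t (Finset.mem_range.mp ht)).1]
      have h2 : ∫ _, R ∂ℙ = R := by rw [integral_const, probReal_univ, one_smul]
      rw [← h2]
      refine integral_mono (integrable_finsetSum _ fun t ht =>
        (hcross t (Finset.mem_range.mp ht)).1) (integrable_const _) fun ω => ?_
      have h3 := hR.sum_le hf x (hal ω)
      dsimp only
      rw [← sub_le_iff_le_add, ← Finset.sum_sub_distrib] at h3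
      refine le_trans (le_of_eq (Finset.sum_congr rfl fun t _ => ?_)) h3
      rw [inner_sub_right, banditPrediction]
      ring
    rw [Finset.sum_sub_distrib, ← Finset.sum_div, ← Finset.mul_sum] at h1
    linarith
  have hint : ∀ t ∈ Finset.range T, Integrable (fun ω => μ ((A t).action (act t ω)) (x t) -
      ⨅ i, μ ((A t).action i) (x t)) ℙ := fun t ht => by
    obtain ⟨c, hc⟩ := exists_abs_le_fin fun i => μ ((A t).action i) (x t)
    exact (integrable_apply_fin (hX t (Finset.mem_range.mp ht))
      (g := fun i _ => μ ((A t).action i) (x t)) (fun i => measurable_const)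
      (fun i _ => hc i)).sub (integrable_const _)
  rw [pseudoRegret, integral_finsetSum _ hint]
  refine (Finset.sum_le_sum fun t ht => hround t (Finset.mem_range.mp ht)).trans ?_
  rw [Finset.sum_add_distrib, Finset.sum_add_distrib, Finset.sum_const, Finset.card_range,
    nsmul_eq_mul, ← Finset.mul_sum, ← Finset.mul_sum]
  have := mul_le_mul_of_nonneg_left hsum (show 0 ≤ γ / 4 by positivity)
  have e : (T : ℝ) * (2 * (d / γ)) = 2 * (d * T / γ) := by ring
  linarith

theorem misspecification_nonneg : 0 ≤ misspecification F μ x A T :=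
  Real.iInf_nonneg fun _ => Real.sqrt_nonneg _

theorem pseudoRegret_le (h : IsInteraction P γ T alg μ x A ℙ ℱ act dist loss) (hγ : 0 < γ)
    (hT : 0 < T) (hF : F.Nonempty)
    (hdist : ∀ t < T, ∀ ω, dist t ω ∈ (A t).Dist)
    (htr : ∀ t < T, ∀ ω i θ', inner ℝ ((A t).mean (dist t ω) - (A t).action i) θ' -
      γ / 4 * quadForm ((A t).cov (dist t ω)) (banditPrediction alg x A act loss t ω - θ')
        ≤ 2 * (d / γ))
    (hR : alg.RegretAtMost F T R) {ε : ℝ} (hε : misspecification F μ x A T ≤ ε) :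
    pseudoRegret μ x A T ℙ act ≤ 2 * (d * T / γ) + γ * (R / 2 + ε ^ 2 * T) + 2 * (ε * T) := by
  have hT0 : (0 : ℝ) < T := by exact_mod_cast hT
  have key : ∀ e, ε < e → pseudoRegret μ x A T ℙ act ≤
      2 * (d * T / γ) + γ * (R / 2 + e ^ 2 * T) + 2 * (e * T) := by
    intro e he
    have : Nonempty F := hF.to_subtype
    have he0 : 0 < e := (misspecification_nonneg.trans hε).trans_lt he
    obtain ⟨⟨f, hf⟩, hfe⟩ := exists_lt_of_ciInf_lt (hε.trans_lt he)
    rw [Real.sqrt_lt' he0, one_div, inv_mul_lt_iff₀ hT0] at hfe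
    obtain ⟨v, hv⟩ : ∃ v : ℕ → ℝ, v = fun t => ⨆ i : Fin (A t).card,
      (inner ℝ ((A t).action i) (f (x t)) - μ ((A t).action i) (x t)) ^ 2 := ⟨_, rfl⟩
    have hv0 : ∀ t, 0 ≤ v t := fun t => by
      rw [hv]; exact Real.iSup_nonneg fun _ => sq_nonneg _
    have hvle : ∀ t i, (inner ℝ ((A t).action i) (f (x t)) - μ ((A t).action i) (x t)) ^ 2 ≤
        v t := fun t i => by
      rw [hv]
      exact le_ciSup (f := fun i : Fin (A t).card =>
        (inner ℝ ((A t).action i) (f (x t)) - μ ((A t).action i) (x t)) ^ 2)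
        (Set.finite_range _).bddAbove i
    have h1 := h.pseudoRegret_le_sum hγ hdist htr hR hf (s := fun t => Real.sqrt (v t))
      fun t i => Real.abs_le_sqrt (hvle t i)
    have h2 : ∑ t ∈ Finset.range T, Real.sqrt (v t) ^ 2 ≤ T * e ^ 2 := by
      rw [Finset.sum_congr rfl fun t _ => Real.sq_sqrt (hv0 t)]
      rw [hv]
      exact hfe.le
    have h3 : ∑ t ∈ Finset.range T, Real.sqrt (v t) ≤ e * T := by
      refine abs_le_of_sq_le_sq' ?_ (by positivity) |>.2
      refine sq_sum_le_card_mul_sum_sq.trans ?_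
      rw [Finset.card_range]
      nlinarith
    have h4 : γ / 4 * (2 * R + 4 * ∑ t ∈ Finset.range T, Real.sqrt (v t) ^ 2) ≤
        γ / 4 * (2 * R + 4 * (T * e ^ 2)) := by gcongr
    nlinarith
  have hc : Continuous fun e : ℝ => 2 * (d * T / γ) + γ * (R / 2 + e ^ 2 * T) + 2 * (e * T) := by
    fun_prop
  exact ge_of_tendsto (hc.continuousWithinAt (s := Set.Ioi ε) (x := ε)).tendsto
    (Filter.eventually_of_mem self_mem_nhdsWithin key)

end IsInteraction

theorem optimal_rate_le {D T R ε γ : ℝ} (hD : 1 ≤ D) (hT : 0 < T) (hR : 0 ≤ R) (hε : 0 ≤ ε)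
    (hγ : 0 < γ) (h : γ = Real.sqrt (D * T / (R + ε ^ 2 * T))) :
    D * T / γ + γ * (R + ε ^ 2 * T) + ε * T ≤
      3 * (Real.sqrt (D * T * R) + ε * Real.sqrt D * T) := by
  obtain ⟨S, hS⟩ : ∃ S, S = R + ε ^ 2 * T := ⟨_, rfl⟩
  rw [← hS] at h ⊢
  have hS0 : 0 < S := by
    refine lt_of_le_of_ne (by rw [hS]; positivity) fun h0 => ?_
    rw [← h0, div_zero, Real.sqrt_zero] at h
    exact hγ.ne' h
  have hDT : 0 < D * T := by positivity
  have h1 : γ * γ = D * T / S := by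
    rw [h]; exact Real.mul_self_sqrt (by positivity)
  have h2 : γ * S = Real.sqrt (D * T * S) := by
    rw [eq_comm, Real.sqrt_eq_iff_mul_self_eq (by positivity) (by positivity)]
    symm
    calc γ * S * (γ * S) = (γ * γ) * S * S := by ring
      _ = _ := by rw [h1]; field_simp
  have h3 : D * T / γ = γ * S := by
    rw [div_eq_iff hγ.ne']
    calc D * T = D * T / S * S := by field_simp
      _ = _ := by rw [← h1]; ring
  have h4 : Real.sqrt (D * T * S) ≤ Real.sqrt (D * T * R) + ε * Real.sqrt D * T := by
    have e1 : ε * Real.sqrt D * T = Real.sqrt (D * T * (ε ^ 2 * T)) := by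
      rw [eq_comm, Real.sqrt_eq_iff_mul_self_eq (by positivity) (by positivity)]
      symm
      calc ε * Real.sqrt D * T * (ε * Real.sqrt D * T)
          = (Real.sqrt D * Real.sqrt D) * (ε ^ 2 * T ^ 2) := by ring
        _ = _ := by rw [Real.mul_self_sqrt (by positivity)]; ring
    rw [e1, hS, mul_add]
    have e2 : 0 ≤ D * T * R := by positivity
    have e3 : 0 ≤ D * T * (ε ^ 2 * T) := by positivity
    refine Real.sqrt_le_iff.mpr ⟨by positivity, ?_⟩
    nlinarith [Real.sq_sqrt e2, Real.sq_sqrt e3,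
      mul_nonneg (Real.sqrt_nonneg (D * T * R)) (Real.sqrt_nonneg (D * T * (ε ^ 2 * T)))]
  have h5 : ε * T ≤ ε * Real.sqrt D * T := by
    have : 1 ≤ Real.sqrt D := Real.one_le_sqrt.mpr hD
    nlinarith [mul_nonneg hε hT.le]
  have := Real.sqrt_nonneg (D * T * R)
  rw [h3, h2]
  linarith

theorem proposition6 :
    ∃ (P : RAM.Prog) (C : ℝ) (k : ℕ),
      -- the cost and the quality of the distribution computed in one round
      (∀ (d : ℕ) (A : ActionSet d) (θ : EuclideanSpace ℝ (Fin d)) (γ : ℝ), 0 < d → 0 < γ →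
        ∃ (p : Fin A.card → ℝ) (time memory : ℕ),
          P.Computes ⟨A, θ, γ⟩ p time memory ∧
          (time : ℝ) ≤ C * A.card * (d : ℝ) ^ k *
            ((1 + Real.log A.card) * (1 + Real.log (1 + γ * ‖θ‖))) ^ k ∧
          (memory : ℝ) ≤ C * (1 + Real.log A.card) * (d : ℝ) ^ k *
            (1 + Real.log (1 + γ * ‖θ‖)) ∧
          p ∈ A.Dist ∧
          (∀ q ∈ A.Dist, A.barrier θ γ p ≤ A.barrier θ γ q + (((A.dim : ℝ) / γ : ℝ) : EReal)) ∧
          (∀ (i : Fin A.card) (θ' : EuclideanSpace ℝ (Fin d)),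
            inner ℝ (A.mean p - A.action i) θ' - γ / 4 * quadForm (A.cov p) (θ - θ')
              ≤ 2 * ((A.dim : ℝ) / γ))) ∧
      -- the regret of the bandit algorithm that samples from the computed distributions
      (∀ (d T : ℕ) (X : Type*) (F : Set (X → EuclideanSpace ℝ (Fin d)))
        (alg : RegressionOracle d X) (R ε γ : ℝ)
        (μ : EuclideanSpace ℝ (Fin d) → X → ℝ) (x : ℕ → X) (A : ℕ → ActionSet d)
        (Ω : Type*) (mΩ : MeasurableSpace Ω) (ℙ : Measure Ω) (ℱ : Filtration ℕ mΩ)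
        (act : (t : ℕ) → Ω → Fin (A t).card) (dist : (t : ℕ) → Ω → Fin (A t).card → ℝ)
        (loss : ℕ → Ω → ℝ),
        0 < d → 0 < T → F.Nonempty → 0 ≤ R → 0 < γ → IsProbabilityMeasure ℙ →
        alg.RegretAtMost F T R →
        misspecification F μ x A T ≤ ε →
        IsInteraction P γ T alg μ x A ℙ ℱ act dist loss →
        pseudoRegret μ x A T ℙ act ≤ C * (d * T / γ + γ * (R + ε ^ 2 * T) + ε * T) ∧
        (γ = Real.sqrt (d * T / (R + ε ^ 2 * T)) →
          pseudoRegret μ x A T ℙ act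
            ≤ C * (Real.sqrt (d * T * R) + ε * Real.sqrt d * T))) := by
  obtain ⟨C, hC⟩ := RAM.barrierProg_computes
  refine ⟨RAM.barrierProg, |C| + 6, 10, fun d A θ γ hd hγ => ?_, ?_⟩
  · obtain ⟨p, t, m, h1, h2, h3, h4⟩ := hC d A θ γ hd hγ
    have hle : C ≤ |C| + 6 := (le_abs_self C).trans (by linarith)
    have hl : 0 ≤ Real.log A.card := Real.log_natCast_nonneg _
    have hG : 0 ≤ Real.log (1 + γ * ‖θ‖) :=
      Real.log_nonneg (le_add_of_nonneg_right (by positivity))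
    exact ⟨p, t, m, h1, h2.trans (by gcongr), h3.trans (by gcongr), h4⟩
  · intro d T X F alg R ε γ μ x A Ω mΩ ℙ ℱ act dist loss hd hT hF hR hγ hprob hreg hmis hint
    have hquality : ∀ t < T, ∀ ω, dist t ω ∈ (A t).Dist ∧ ∀ i θ',
        inner ℝ ((A t).mean (dist t ω) - (A t).action i) θ' -
          γ / 4 * quadForm ((A t).cov (dist t ω)) (banditPrediction alg x A act loss t ω - θ')
            ≤ 2 * (d / γ) := by
      intro t ht ω
      obtain ⟨p, _, _, h1, -, -, h2, -, h3⟩ :=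
        hC d (A t) (banditPrediction alg x A act loss t ω) γ hd hγ
      obtain ⟨_, _, h4⟩ := hint.computed t ht ω
      rw [h4.unique h1]
      refine ⟨h2, fun i θ' => (h3 i θ').trans ?_⟩
      have : ((A t).dim : ℝ) ≤ d := by exact_mod_cast (A t).dim_le
      gcongr
    have hε : 0 ≤ ε := IsInteraction.misspecification_nonneg.trans hmis
    have hd1 : (1 : ℝ) ≤ d := by exact_mod_cast hd
    have hT0 : (0 : ℝ) < T := by exact_mod_cast hT
    have hmain : pseudoRegret μ x A T ℙ act ≤
        2 * (d * T / γ + γ * (R + ε ^ 2 * T) + ε * T) := by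
      have h1 := hint.pseudoRegret_le hγ hT hF (fun t ht ω => (hquality t ht ω).1)
        (fun t ht ω => (hquality t ht ω).2) hreg hmis
      have h2 : 0 ≤ γ * R := by positivity
      have h3 : 0 ≤ γ * (ε ^ 2 * T) := by positivity
      linarith
    refine ⟨hmain.trans ?_, fun h => hmain.trans ?_⟩
    · gcongr
      linarith [abs_nonneg C]
    · calc 2 * (d * T / γ + γ * (R + ε ^ 2 * T) + ε * T)
          ≤ 2 * (3 * (Real.sqrt (d * T * R) + ε * Real.sqrt d * T)) := by
            gcongr
            exact optimal_rate_le hd1 hT0 hR hε hγ h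
        _ = 6 * (Real.sqrt (d * T * R) + ε * Real.sqrt d * T) := by ring
        _ ≤ _ := by
            gcongr
            linarith [abs_nonneg C]
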